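/- **Theorem 3.2 (Evolution of the NTK with the CK).** Let $\varphi:\mathbb R\to\mathbb R$ (the feature-mapping function, applied entrywise) be differentiable and let $a:\mathbb R\to\mathbb R$ (the activation function) be twice differentiable, and assume that $\varphi,\varphi',a,a'$ are square-integrable with respect to $\mathcal N(0,s)$ for every $s\ge 0$, so that the Gaussian expectations below are finite. For an input dimension $d\ge 0$ and layer widths $n_0,n_1,\dots$ consider the network $$f^0(x)=W^0x+b^0,\qquad f^1(x)=\tfrac1{\sqrt{n_0}}W^1\varphi(f^0(x))+b^1,\qquad f^l(x)=\tfrac1{\sqrt{n_{l-1}}}W^l a(f^{l-1}(x))+b^l\quad(2\le l\le L),$$ where $W^0\in\mathbb R^{n_0\times d}$, $W^l\in\mathbb R^{n_l\times n_{l-1}}$ for $l\ge1$, $b^l\in\mathbb R^{n_l}$, and $\theta=(W^l,b^l)_{0\le l\le L}$ is the vector of all parameters. At initialisation the entries of $\theta=\theta_0$ are i.i.d. $\mathcal N(0,1)$. Put $\Sigma^0(x,x')=\langle x,x'\rangle+1$ and, for $l\ge 1$, with $\phi=\varphi$ if $l=1$ and $\phi=a$ if $l\ge2$, $$\Sigma^l(x,x')=\mathbb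 E[\phi(u)\phi(v)]+1,\qquad \dot\Sigma^l(x,x')=\mathbb E[\phi'(u)\phi'(v)],\qquad (u,v)\sim\mathcal N\!\left(0,\begin{pmatrix}\Sigma^{l-1}(x,x)&\Sigma^{l-1}(x,x')\\ \Sigma^{l-1}(x',x)&\Sigma^{l-1}(x',x')\end{pmatrix}\right).$$ Then there are deterministic kernels $\Theta^l:\mathbb R^d\times\mathbb R^d\to\mathbb R$ ($l\ge0$), depending only on $\varphi,a,d$, such that for all $l\ge 0$ and all $x,x'\in\mathbb R^d$ $$\nabla_\theta f^l_i(x;\theta_0)^{T}\,\nabla_\theta f^l_{i'}(x';\theta_0)\longrightarrow \delta_{ii'}\,\Theta^l(x,x')\quad\text{in probability}$$ as $n_0,\dots,n_{l-1}\to\infty$ jointly, uniformly in the depth $L\ge l$, in the remaining widths, and in the neurons $i,i'$ of layer $l$. These kernels satisfy $\Theta^0(x,x')=\langle x,x'\rangle+1$, $$\Theta^1(x,x')=\Theta^0(x,x')\,\dot\Sigma^1(x,x')+\Sigma^1(x,x'),\qquad \Theta^l(x,x')=\Theta^{l-1}(x,x')\,\dot\Sigma^l(x,x')+\Sigma^l(x,x')\quad(l\ge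 2).$$ -/

import Mathlib

open MeasureTheory ProbabilityTheory
open scoped NNReal Gradient

namespace FeatureNet

noncomputable section

/-- Number of inputs of a neuron of layer `l`, for input dimension `d` and layer widths
`n 0, n 1, n 2, …`. -/
def fanIn (d : ℕ) (n : ℕ → ℕ) : ℕ → ℕ
  | 0 => d
  | l + 1 => n l

/-- Index set of all scalar parameters of a network with layers `0, …, L`: layer `k` has a weight
matrix of size `n k × fanIn d n k` and a bias vector of length `n k`. -/
abbrev ParamIdx (L d : ℕ) (n : ℕ → ℕ) : Type :=
  Σ k : Fin (L + 1), (Fin (n k) × Fin (fanIn d n k)) ⊕ Fin (n k)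

/-- The parameter space (the space of all `θ`), with its Euclidean structure. -/
abbrev Params (L d : ℕ) (n : ℕ → ℕ) : Type := EuclideanSpace ℝ (ParamIdx L d n)

/-- Entry `(i, j)` of the weight matrix of layer `l`. -/
def weight {L d : ℕ} {n : ℕ → ℕ} (θ : Params L d n) (l : ℕ) (hl : l ≤ L)
    (i : Fin (n l)) (j : Fin (fanIn d n l)) : ℝ :=
  θ ⟨⟨l, Nat.lt_succ_of_le hl⟩, Sum.inl (i, j)⟩

/-- Entry `i` of the bias vector of layer `l`. -/
def bias {L d : ℕ} {n : ℕ → ℕ} (θ : Params L d n) (l : ℕ) (hl : l ≤ L) (i : Fin (n l)) : ℝ :=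
  θ ⟨⟨l, Nat.lt_succ_of_le hl⟩, Sum.inr i⟩

/-- The nonlinearity applied entrywise to the output of layer `l`: the feature map `φ` for `l = 0`
(it enters layer `1`), the activation function `a` for `l ≥ 1`. -/
def nonlin (φ a : ℝ → ℝ) : ℕ → ℝ → ℝ
  | 0 => φ
  | _ + 1 => a

/-- The layer functions `f^l_i(x; θ)`:
`f^0 = W^0 x + b^0`, `f^1 = W^1 φ(f^0) / √(n 0) + b^1`,
`f^l = W^l a(f^{l-1}) / √(n (l-1)) + b^l` for `l ≥ 2`. -/
def layer (φ a : ℝ → ℝ) {L d : ℕ} {n : ℕ → ℕ} (θ : Params L d n) (x : EuclideanSpace ℝ (Fin d)) :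
    (l : ℕ) → l ≤ L → Fin (n l) → ℝ
  | 0, hl, i => (∑ j : Fin d, weight θ 0 hl i j * x j) + bias θ 0 hl i
  | l + 1, hl, i =>
      (1 / √(n l : ℝ)) * (∑ j : Fin (n l), weight θ (l + 1) hl i j *
        nonlin φ a l (layer φ a θ x l (Nat.le_of_succ_le hl) j)) + bias θ (l + 1) hl i

/-- The empirical neural tangent kernel of layer `l` at parameters `θ`, for the neurons `i`, `i'`:
`⟨∇_θ f^l_i(x; θ), ∇_θ f^l_{i'}(x'; θ)⟩`. -/
def empiricalNTK (φ a : ℝ → ℝ) {L d : ℕ} {n : ℕ → ℕ} (θ : Params L d n) (l : ℕ) (hl : l ≤ L)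
    (x x' : EuclideanSpace ℝ (Fin d)) (i i' : Fin (n l)) : ℝ :=
  inner ℝ (∇ (fun ϑ : Params L d n => layer φ a ϑ x l hl i) θ)
    (∇ (fun ϑ : Params L d n => layer φ a ϑ x' l hl i') θ)

/-- The centred bivariate Gaussian law of the pair of values at `x`, `x'` of a centred Gaussian
process with covariance kernel `K`. -/
def pairLaw {X : Type*} (K : X → X → ℝ) (x x' : X) : Measure (EuclideanSpace ℝ (Fin 2)) :=
  multivariateGaussian 0 !![K x x, K x x'; K x' x, K x' x']

/-- The conjugate kernels `Σ^l`: `Σ^0(x, x') = ⟨x, x'⟩ + 1` and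
`Σ^{l+1}(x, x') = E[σ(u) σ(v)] + 1`, where `(u, v)` has the centred Gaussian law with covariance
given by `Σ^l`, and `σ` is `φ` for `l = 0` and `a` for `l ≥ 1`. -/
def CK (φ a : ℝ → ℝ) (d : ℕ) :
    ℕ → EuclideanSpace ℝ (Fin d) → EuclideanSpace ℝ (Fin d) → ℝ
  | 0, x, x' => inner ℝ x x' + 1
  | l + 1, x, x' =>
      (∫ u, nonlin φ a l (u 0) * nonlin φ a l (u 1) ∂(pairLaw (CK φ a d l) x x')) + 1

/-- The derivative kernels: `CKDot φ a d l` for `l ≥ 1` is `Σ̇^l(x, x') = E[σ'(u) σ'(v)]`, where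
`(u, v)` has the centred Gaussian law with covariance given by `Σ^{l-1}`, and `σ` is `φ` for `l = 1`
and `a` for `l ≥ 2`. There is no derivative kernel for `l = 0`; the value `0` there is not used. -/
def CKDot (φ a : ℝ → ℝ) (d : ℕ) :
    ℕ → EuclideanSpace ℝ (Fin d) → EuclideanSpace ℝ (Fin d) → ℝ
  | 0, _, _ => 0
  | l + 1, x, x' =>
      ∫ u, deriv (nonlin φ a l) (u 0) * deriv (nonlin φ a l) (u 1) ∂(pairLaw (CK φ a d l) x x')

/-- `g` is square-integrable with respect to every centred Gaussian law on the line. -/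
def GaussianSqIntegrable (g : ℝ → ℝ) : Prop :=
  ∀ v : ℝ≥0, MemLp g 2 (gaussianReal 0 v)

/-- `Θ` is the limit in probability, as all the widths `n 0, …, n (l-1)` of the layers below layer
`l` tend to infinity jointly, of the empirical neural tangent kernel of layer `l` at an
initialisation with i.i.d. standard Gaussian weights and biases. Different neurons of layer `l`
decouple in the limit, so that the limit is `Θ` on the diagonal and `0` off it; it is uniform in
the neurons, in the width of layer `l` and in the layers above `l`. -/
def NTKTendsto (φ a : ℝ → ℝ) (d l : ℕ)
    (Θ : EuclideanSpace ℝ (Fin d) → EuclideanSpace ℝ (Fin d) → ℝ) : Prop :=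
  ∀ x x' : EuclideanSpace ℝ (Fin d), ∀ ε > (0 : ℝ), ∀ δ > (0 : ℝ), ∃ N : ℕ,
    ∀ (L : ℕ) (hl : l ≤ L) (n : ℕ → ℕ), (∀ k < l, N ≤ n k) → ∀ i i' : Fin (n l),
      (stdGaussian (Params L d n)).real
        {θ | ε ≤ |empiricalNTK φ a θ l hl x x' i i' - (if i = i' then Θ x x' else 0)|} ≤ δ

end

end FeatureNet

/-!
Networks of all widths and depths are cut out of one infinite array of independent standard
Gaussian parameters (`arrayLaw`, `map_cutParams`), so that convergence in probability becomes
convergence along a single filter `whp` on pairs (widths and neurons, array), and limits can be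
computed with the usual calculus. The filter also carries the two neurons, which makes the limits
uniform in them; the depth and the widths of the higher layers drop out because the kernel of layer
`l` depends on the layers up to `l` only (`empiricalNTK_cutParams`).

Backpropagation (`empiricalNTK_succ`) shows that the kernel of layer `l` between neurons `i`, `i'`
is `δ (⟨α, α'⟩ + 1) + wᵢᵀ M wᵢ'`, where `α`, `α'` are the input vectors of layer `l`
(`inputVec`) and `M` is a matrix which depends on the lower layers (`backForm`). Three statements
are propagated from one layer to the next:

* `⟨α, α'⟩ + 1` tends to the conjugate kernel (`covTendsto`);
* `tr M` tends to the difference of the limiting neural tangent kernel and the conjugate kernel;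
* the squared Frobenius norm of `M` tends to `0` (the last two are `backFormTendsto`).

Since the variance of `wᵢᵀ M wᵢ` around `tr M`, and that of `wᵢᵀ M wᵢ'` around `0` for `i ≠ i'`, are
at most a constant times this norm, these statements give the limit of the kernel
(`tendsto_kernelValue`). The entries of the next matrix are `1 / n` times products of
`σ'(uⱼ) σ'(vⱼ')` with the kernel values, so that its trace is an average over neurons, and the sum of
the squares of its entries has `n` diagonal terms, which are negligible by truncation, and
off-diagonal terms controlled by the norm of the previous matrix.

Each step works conditionally on the lower layers: the neurons of a layer are then independent and
identically distributed, and quantities are bounded in `L¹` and returned to probability by a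
conditional Markov inequality (`tendsto_whp_of_condExp`). The nonlinearities and their derivatives
are only square integrable against Gaussian laws, without growth conditions, and two devices make up
for this. As the bias contributes variance `1`, all preactivations have variance at least `1`, and
the Gaussian law of variance `v ∈ [1, V]` is at most `√V` times that of variance `V`
(`gaussianReal_zero_le_smul`); this gives uniform integrability, hence a law of large numbers with
uniform rates (`lintegral_average_le`) and, with Lévy's continuity theorem, continuity of the
Gaussian expectations in the covariance (`continuousWithinAt_gaussKernel`). Products of `σ'(u)²`
with functions of the weights have no evident higher moments, but integrating the bias first
replaces `σ'(u)²` by a function of growth `exp (m² / 8V)` in the linear part `m` of `u`, to which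
the Cauchy–Schwarz inequality applies (`lintegral_sq_preact_mul_le`).

The derivative of `φ` need not be continuous. It enters only at layer `0`, whose covariances are
exact, so that no continuity of the Gaussian expectation is needed there
(`tendsto_gaussKernel_layerGram`).
-/

namespace FeatureNet

noncomputable section

open Filter Topology
open scoped ENNReal

/-! ### Recursions for the gradient and the neural tangent kernel -/

/-- The standard basis vector of the parameter space at the index `p`. -/
def paramBasis {L d : ℕ} {n : ℕ → ℕ} (p : ParamIdx L d n) : Params L d n :=
  EuclideanSpace.single p 1

lemma inner_paramBasis_left {L d : ℕ} {n : ℕ → ℕ} (p : ParamIdx L d n) (v : Params L d n) :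
    inner ℝ (paramBasis p) v = v p := by
  rw [paramBasis, EuclideanSpace.inner_single_left]
  simp

lemma paramBasis_apply {L d : ℕ} {n : ℕ → ℕ} (p q : ParamIdx L d n) :
    paramBasis p q = if q = p then 1 else 0 := by
  simp [paramBasis]

/-- The part of the gradient of the `i`-th neuron of layer `l` that lies in the parameters of
layer `l`, when that layer receives the input vector `α`. -/
def ownGrad {L d : ℕ} {n : ℕ → ℕ} (l : ℕ) (hl : l ≤ L) (α : Fin (fanIn d n l) → ℝ)
    (i : Fin (n l)) : Params L d n :=
  (∑ j, α j • paramBasis ⟨⟨l, Nat.lt_succ_of_le hl⟩, Sum.inl (i, j)⟩) +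
    paramBasis ⟨⟨l, Nat.lt_succ_of_le hl⟩, Sum.inr i⟩

/-- The gradient of the `i`-th neuron of layer `l`, computed by backpropagation. -/
def layerGrad (φ a : ℝ → ℝ) {L d : ℕ} {n : ℕ → ℕ} (θ : Params L d n)
    (x : EuclideanSpace ℝ (Fin d)) : (l : ℕ) → l ≤ L → Fin (n l) → Params L d n
  | 0, hl, i => ownGrad 0 hl (fun j => x j) i
  | l + 1, hl, i =>
      ownGrad (l + 1) hl (fun j => (1 / √(n l : ℝ)) *
        nonlin φ a l (layer φ a θ x l (Nat.le_of_succ_le hl) j)) i +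
      (1 / √(n l : ℝ)) • ∑ j : Fin (n l), (weight θ (l + 1) hl i j *
        deriv (nonlin φ a l) (layer φ a θ x l (Nat.le_of_succ_le hl) j)) •
          layerGrad φ a θ x l (Nat.le_of_succ_le hl) j

lemma nonlin_differentiable {φ a : ℝ → ℝ} (hφ : Differentiable ℝ φ) (ha : Differentiable ℝ a) :
    ∀ l, Differentiable ℝ (nonlin φ a l)
  | 0 => hφ
  | _ + 1 => ha

lemma hasFDerivAt_param {L d : ℕ} {n : ℕ → ℕ} (p : ParamIdx L d n) (θ : Params L d n) :
    HasFDerivAt (fun ϑ : Params L d n => ϑ p) (innerSL ℝ (paramBasis p)) θ := by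
  have h : (fun ϑ : Params L d n => ϑ p) = innerSL ℝ (paramBasis p) := by
    ext ϑ
    simp [inner_paramBasis_left]
  rw [h]
  exact (innerSL ℝ (paramBasis p)).hasFDerivAt

lemma hasFDerivAt_layer {φ a : ℝ → ℝ} (hφ : Differentiable ℝ φ) (ha : Differentiable ℝ a)
    {L d : ℕ} {n : ℕ → ℕ} (θ : Params L d n) (x : EuclideanSpace ℝ (Fin d)) :
    ∀ (l : ℕ) (hl : l ≤ L) (i : Fin (n l)),
      HasFDerivAt (fun ϑ : Params L d n => layer φ a ϑ x l hl i)
        (innerSL ℝ (layerGrad φ a θ x l hl i)) θ := by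
  intro l
  induction l with
  | zero =>
    intro hl i
    have h := (HasFDerivAt.fun_sum (u := Finset.univ) fun (j : Fin d) _ =>
      ((hasFDerivAt_param (n := n) ⟨⟨0, Nat.lt_succ_of_le hl⟩, Sum.inl (i, j)⟩ θ).mul_const
        (x j))).add (hasFDerivAt_param ⟨⟨0, Nat.lt_succ_of_le hl⟩, Sum.inr i⟩ θ)
    refine (h.congr_fderiv ?_)
    simp only [layerGrad, ownGrad, map_add, map_sum, map_smul]
    rfl
  | succ l ih =>
    intro hl i
    have h := ((HasFDerivAt.fun_sum (u := Finset.univ) fun (j : Fin (n l)) _ =>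
      ((hasFDerivAt_param (n := n) ⟨⟨l + 1, Nat.lt_succ_of_le hl⟩, Sum.inl (i, j)⟩ θ).mul
        (((nonlin_differentiable hφ ha l _).hasDerivAt).comp_hasFDerivAt θ
          (ih (Nat.le_of_succ_le hl) j)))).const_mul (1 / √(n l : ℝ))).add
      (hasFDerivAt_param ⟨⟨l + 1, Nat.lt_succ_of_le hl⟩, Sum.inr i⟩ θ)
    refine (h.congr_fderiv ?_)
    simp only [layerGrad, ownGrad, map_add, map_sum, map_smul, smul_add, Finset.sum_add_distrib,
      Finset.smul_sum, smul_smul, weight, Function.comp]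
    rw [add_assoc]
    exact add_comm _ _

lemma gradient_layer {φ a : ℝ → ℝ} (hφ : Differentiable ℝ φ) (ha : Differentiable ℝ a)
    {L d : ℕ} {n : ℕ → ℕ} (θ : Params L d n) (x : EuclideanSpace ℝ (Fin d))
    (l : ℕ) (hl : l ≤ L) (i : Fin (n l)) :
    ∇ (fun ϑ : Params L d n => layer φ a ϑ x l hl i) θ = layerGrad φ a θ x l hl i :=
  HasGradientAt.gradient (hasFDerivAt_layer hφ ha θ x l hl i)

lemma ownGrad_apply_of_ne {L d : ℕ} {n : ℕ → ℕ} {l : ℕ} {hl : l ≤ L}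
    {α : Fin (fanIn d n l) → ℝ} {i : Fin (n l)} {p : ParamIdx L d n} (hp : (p.1 : ℕ) ≠ l) :
    ownGrad l hl α i p = 0 := by
  have h1 : ∀ y, p ≠ ⟨⟨l, Nat.lt_succ_of_le hl⟩, y⟩ := by
    rintro y rfl
    exact hp rfl
  simp [ownGrad, paramBasis_apply, h1]

/-- The gradient of a neuron of layer `l` has no components in the parameters of higher layers. -/
lemma layerGrad_apply_of_lt (φ a : ℝ → ℝ) {L d : ℕ} {n : ℕ → ℕ} (θ : Params L d n)
    (x : EuclideanSpace ℝ (Fin d)) : ∀ (l : ℕ) (hl : l ≤ L) (i : Fin (n l)) (p : ParamIdx L d n),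
      l < (p.1 : ℕ) → layerGrad φ a θ x l hl i p = 0 := by
  intro l
  induction l with
  | zero =>
    intro hl i p hp
    exact ownGrad_apply_of_ne hp.ne'
  | succ l ih =>
    intro hl i p hp
    have := fun j => ih (Nat.le_of_succ_le hl) j p (by omega)
    simp [layerGrad, ownGrad_apply_of_ne hp.ne', this]

lemma inner_ownGrad_left {L d : ℕ} {n : ℕ → ℕ} (l : ℕ) (hl : l ≤ L)
    (α : Fin (fanIn d n l) → ℝ) (i : Fin (n l)) (v : Params L d n) :
    inner ℝ (ownGrad l hl α i) v =
      (∑ j, α j * v ⟨⟨l, Nat.lt_succ_of_le hl⟩, Sum.inl (i, j)⟩) +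
        v ⟨⟨l, Nat.lt_succ_of_le hl⟩, Sum.inr i⟩ := by
  simp [ownGrad, inner_add_left, sum_inner, real_inner_smul_left, inner_paramBasis_left]

lemma inner_ownGrad_ownGrad {L d : ℕ} {n : ℕ → ℕ} (l : ℕ) (hl : l ≤ L)
    (α β : Fin (fanIn d n l) → ℝ) (i i' : Fin (n l)) :
    inner ℝ (ownGrad l hl α i) (ownGrad l hl β i') =
      if i = i' then (∑ j, α j * β j) + 1 else 0 := by
  rw [inner_ownGrad_left]
  by_cases h : i = i'
  · subst h
    simp [ownGrad, paramBasis_apply]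
  · simp [ownGrad, paramBasis_apply, h]

lemma empiricalNTK_zero {φ a : ℝ → ℝ} (hφ : Differentiable ℝ φ) (ha : Differentiable ℝ a)
    {L d : ℕ} {n : ℕ → ℕ} (θ : Params L d n) (hl : 0 ≤ L)
    (x x' : EuclideanSpace ℝ (Fin d)) (i i' : Fin (n 0)) :
    empiricalNTK φ a θ 0 hl x x' i i' = if i = i' then (∑ j, x j * x' j) + 1 else 0 := by
  simp only [empiricalNTK, gradient_layer hφ ha, layerGrad]
  exact inner_ownGrad_ownGrad 0 hl _ _ i i'

/-- The recursion for the empirical neural tangent kernel: the parameters of layer `l + 1`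
contribute on the diagonal, and those of the lower layers contribute a bilinear form in the rows
`i`, `i'` of the weight matrix of layer `l + 1`. -/
lemma empiricalNTK_succ {φ a : ℝ → ℝ} (hφ : Differentiable ℝ φ) (ha : Differentiable ℝ a)
    {L d : ℕ} {n : ℕ → ℕ} (θ : Params L d n) (l : ℕ) (hl : l + 1 ≤ L)
    (x x' : EuclideanSpace ℝ (Fin d)) (i i' : Fin (n (l + 1))) :
    empiricalNTK φ a θ (l + 1) hl x x' i i' =
      (if i = i' then (∑ j : Fin (n l),
        ((1 / √(n l : ℝ)) * nonlin φ a l (layer φ a θ x l (Nat.le_of_succ_le hl) j)) *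
        ((1 / √(n l : ℝ)) * nonlin φ a l (layer φ a θ x' l (Nat.le_of_succ_le hl) j))) + 1
        else 0) +
      ∑ j : Fin (n l), ∑ j' : Fin (n l), weight θ (l + 1) hl i j *
        (1 / (n l : ℝ) * (deriv (nonlin φ a l) (layer φ a θ x l (Nat.le_of_succ_le hl) j) *
          deriv (nonlin φ a l) (layer φ a θ x' l (Nat.le_of_succ_le hl) j') *
          empiricalNTK φ a θ l (Nat.le_of_succ_le hl) x x' j j')) *
        weight θ (l + 1) hl i' j' := by
  have hl' := Nat.le_of_succ_le hl
  have hz : ∀ (y : EuclideanSpace ℝ (Fin d)) (j : Fin (n l)) (p : ParamIdx L d n),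
      (p.1 : ℕ) = l + 1 → layerGrad φ a θ y l hl' j p = 0 :=
    fun y j p hp => layerGrad_apply_of_lt φ a θ y l hl' j p (by omega)
  have hz1 : ∀ (β : Fin (fanIn d n (l + 1)) → ℝ) (i₀ : Fin (n (l + 1)))
      (y : EuclideanSpace ℝ (Fin d)) (j : Fin (n l)),
      inner ℝ (ownGrad (l + 1) hl β i₀) (layerGrad φ a θ y l hl' j) = 0 := by
    intro β i₀ y j
    rw [inner_ownGrad_left]
    simp [hz]
  have hz2 : ∀ (β : Fin (fanIn d n (l + 1)) → ℝ) (i₀ : Fin (n (l + 1)))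
      (y : EuclideanSpace ℝ (Fin d)) (j : Fin (n l)),
      inner ℝ (layerGrad φ a θ y l hl' j) (ownGrad (l + 1) hl β i₀) = 0 := by
    intro β i₀ y j
    rw [real_inner_comm, hz1]
  have hs : (1 / √(n l : ℝ)) * (1 / √(n l : ℝ)) = 1 / (n l : ℝ) := by
    rw [div_mul_div_comm, Real.mul_self_sqrt (Nat.cast_nonneg _), one_mul]
  simp only [empiricalNTK, gradient_layer hφ ha]
  rw [layerGrad, layerGrad, inner_add_left, inner_add_right, inner_add_right,
    inner_ownGrad_ownGrad]
  simp only [real_inner_smul_left, real_inner_smul_right, sum_inner, inner_sum, hz1, hz2,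
    mul_zero, Finset.sum_const_zero, add_zero, zero_add]
  congr 1
  conv_rhs => rw [Finset.sum_comm]
  rw [Finset.mul_sum]
  refine Finset.sum_congr rfl fun j' _ => ?_
  rw [Finset.mul_sum, Finset.mul_sum, Finset.mul_sum]
  refine Finset.sum_congr rfl fun j _ => ?_
  linear_combination (weight θ (l + 1) hl i j * weight θ (l + 1) hl i' j' *
    deriv (nonlin φ a l) (layer φ a θ x l hl' j) *
    deriv (nonlin φ a l) (layer φ a θ x' l hl' j') *
    inner ℝ (layerGrad φ a θ x l hl' j) (layerGrad φ a θ x' l hl' j')) * hs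

/-! ### Networks as functions of an infinite array of parameters -/

/-- The parameters of one neuron with infinitely many inputs: the weights are the entries at
`some k`, the bias is the entry at `none`. -/
abbrev Row : Type := Option ℕ → ℝ

/-- The parameters of a layer with infinitely many neurons. -/
abbrev LayerArray : Type := ℕ → Row

/-- The parameters of infinitely many layers of infinite width. The networks of all widths and
depths are cut out of one such array, so that all of them live on one probability space. -/
abbrev ParamArray : Type := ℕ → LayerArray

/-- The law of a row of independent standard Gaussian entries. -/
def rowLaw : Measure Row := Measure.infinitePi fun _ => gaussianReal 0 1

/-- The law of a layer of independent standard Gaussian entries. -/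
def layerLaw : Measure LayerArray := Measure.infinitePi fun _ => rowLaw

/-- The law of an array of independent standard Gaussian entries. -/
def arrayLaw : Measure ParamArray := Measure.infinitePi fun _ => layerLaw

instance : IsProbabilityMeasure rowLaw := by unfold rowLaw; infer_instance

instance : IsProbabilityMeasure layerLaw := by unfold layerLaw; infer_instance

instance : IsProbabilityMeasure arrayLaw := by unfold arrayLaw; infer_instance

/-- The preactivation of a neuron with parameters `r` at the input vector `α` of length `m`. -/
def preact (m : ℕ) (α : ℕ → ℝ) (r : Row) : ℝ :=
  (∑ k ∈ Finset.range m, r (some k) * α k) + r none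

/-- The bilinear form of the leading `m × m` block of `M`, evaluated at the weights of two
neurons. -/
def weightForm (m : ℕ) (M : ℕ → ℕ → ℝ) (r r' : Row) : ℝ :=
  ∑ j ∈ Finset.range m, ∑ k ∈ Finset.range m, r (some j) * M j k * r' (some k)

/-- The inner product of the first `m` entries. -/
def dotRange (m : ℕ) (α β : ℕ → ℝ) : ℝ := ∑ k ∈ Finset.range m, α k * β k

/-- The trace of the leading `m × m` block. -/
def traceRange (m : ℕ) (M : ℕ → ℕ → ℝ) : ℝ := ∑ k ∈ Finset.range m, M k k

/-- The squared Frobenius norm of the leading `m × m` block. -/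
def frobSq (m : ℕ) (M : ℕ → ℕ → ℝ) : ℝ :=
  ∑ j ∈ Finset.range m, ∑ k ∈ Finset.range m, M j k ^ 2

/-- The kernel value of two neurons with parameters `r`, `r'` in a layer with input vectors `α`,
`β`, when the lower layers contribute the bilinear form of `M`; `same` says whether the two neurons
are the same one. -/
def kernelValue (m : ℕ) (α β : ℕ → ℝ) (M : ℕ → ℕ → ℝ) (same : Prop) [Decidable same]
    (r r' : Row) : ℝ :=
  (if same then dotRange m α β + 1 else 0) + weightForm m M r r'

/-- The input vector of layer `l`, including the normalisation `1 / √(n (l - 1))`. -/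
def inputVec (φ a : ℝ → ℝ) {d : ℕ} (n : ℕ → ℕ) (x : EuclideanSpace ℝ (Fin d))
    (ω : ParamArray) : ℕ → ℕ → ℝ
  | 0, j => if h : j < d then x ⟨j, h⟩ else 0
  | l + 1, j => (1 / √(n l : ℝ)) *
      nonlin φ a l (preact (fanIn d n l) (inputVec φ a n x ω l) (ω l j))

/-- The matrix of the bilinear form that the layers below layer `l` contribute to the neural
tangent kernel of layer `l`. -/
def backForm (φ a : ℝ → ℝ) {d : ℕ} (n : ℕ → ℕ) (x x' : EuclideanSpace ℝ (Fin d))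
    (ω : ParamArray) : ℕ → ℕ → ℕ → ℝ
  | 0, _, _ => 0
  | l + 1, j, j' => 1 / (n l : ℝ) *
      (deriv (nonlin φ a l) (preact (fanIn d n l) (inputVec φ a n x ω l) (ω l j)) *
        deriv (nonlin φ a l) (preact (fanIn d n l) (inputVec φ a n x' ω l) (ω l j')) *
        kernelValue (fanIn d n l) (inputVec φ a n x ω l) (inputVec φ a n x' ω l)
          (backForm φ a n x x' ω l) (j = j') (ω l j) (ω l j'))

/-- The position in the array of a parameter of a finite network. -/
def paramPos {L d : ℕ} {n : ℕ → ℕ} : ParamIdx L d n → ℕ × ℕ × Option ℕ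
  | ⟨k, Sum.inl (i, j)⟩ => (k, i, some j)
  | ⟨k, Sum.inr i⟩ => (k, i, none)

lemma paramPos_injective {L d : ℕ} {n : ℕ → ℕ} :
    Function.Injective (paramPos (L := L) (d := d) (n := n)) := by
  rintro ⟨⟨k, hk⟩, (⟨⟨i, hi⟩, ⟨j, hj⟩⟩ | ⟨i, hi⟩)⟩ ⟨⟨k', hk'⟩, (⟨⟨i', hi'⟩, ⟨j', hj'⟩⟩ | ⟨i', hi'⟩)⟩ h <;>
    simp only [paramPos, Prod.mk.injEq, Option.some.injEq, reduceCtorEq, and_false] at h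
  · obtain ⟨rfl, rfl, rfl⟩ := h
    rfl
  · obtain ⟨rfl, rfl, -⟩ := h
    rfl

/-- The parameters of the finite network cut out of an array. -/
def cutParams (L d : ℕ) (n : ℕ → ℕ) (ω : ParamArray) : Params L d n :=
  WithLp.toLp 2 fun p => ω (paramPos p).1 (paramPos p).2.1 (paramPos p).2.2

lemma measurable_cutParams (L d : ℕ) (n : ℕ → ℕ) : Measurable (cutParams L d n) := by
  unfold cutParams
  fun_prop

/-- The networks cut out of a Gaussian array have independent standard Gaussian parameters. -/
lemma map_cutParams (L d : ℕ) (n : ℕ → ℕ) :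
    arrayLaw.map (cutParams L d n) = stdGaussian (Params L d n) := by
  have h : iIndepFun (fun (p : ℕ × ℕ × Option ℕ) (ω : ParamArray) => ω p.1 p.2.1 p.2.2)
      arrayLaw := by
    have h1 : iIndepFun (fun (p : ℕ × ℕ) (ω : ParamArray) => ω p.1 p.2) arrayLaw :=
      iIndepFun_uncurry_infinitePi' (X := fun _ _ r => r) (fun _ _ => rowLaw) (by fun_prop)
    have h2 := iIndepFun_uncurry' (P := arrayLaw) (ι := ℕ × ℕ) (κ := Option ℕ)
      (X := fun p o (ω : ParamArray) => ω p.1 p.2 o) (by fun_prop) h1 ?_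
    · exact h2.precomp (g := fun p : ℕ × ℕ × Option ℕ => ((p.1, p.2.1), p.2.2))
        (by rintro ⟨a, b, c⟩ ⟨a', b', c'⟩ h; simpa [and_assoc] using h)
    · rintro ⟨k, i⟩
      have h3 : iIndepFun (fun (o : Option ℕ) (r : Row) => r o) rowLaw :=
        iIndepFun_infinitePi (X := fun _ r => r) (by fun_prop)
      have h4 : MeasurePreserving (fun ω : ParamArray => ω k i) arrayLaw rowLaw :=
        (measurePreserving_eval_infinitePi (fun _ => rowLaw) i).comp
          (measurePreserving_eval_infinitePi (fun _ => layerLaw) k)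
      have : IsProbabilityMeasure (arrayLaw.map fun ω : ParamArray => ω k i) := by
        rw [h4.map_eq]
        infer_instance
      rw [← h4.map_eq, iIndepFun_iff_map_fun_eq_infinitePi_map (by fun_prop)] at h3
      rw [iIndepFun_iff_map_fun_eq_infinitePi_map (by fun_prop)]
      rw [Measure.map_map (by fun_prop) (by fun_prop)] at h3
      refine h3.trans ?_
      congr 1
      funext o
      rw [Measure.map_map (by fun_prop) (by fun_prop)]
      rfl
  have h' := h.precomp (paramPos_injective (L := L) (d := d) (n := n))
  have h5 : ∀ k i o, arrayLaw.map (fun ω : ParamArray => ω k i o) = gaussianReal 0 1 := by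
    intro k i o
    exact ((measurePreserving_eval_infinitePi (fun _ => gaussianReal 0 1) o).comp
      ((measurePreserving_eval_infinitePi (fun _ => rowLaw) i).comp
      (measurePreserving_eval_infinitePi (fun _ => layerLaw) k))).map_eq
  rw [iIndepFun_iff_map_fun_eq_infinitePi_map (by fun_prop)] at h'
  simp only [h5, Measure.infinitePi_eq_pi] at h'
  rw [← map_pi_eq_stdGaussian]
  rw [← h', Measure.map_map (by fun_prop) (by fun_prop)]
  rfl

lemma layer_cutParams (φ a : ℝ → ℝ) {L d : ℕ} {n : ℕ → ℕ} (ω : ParamArray)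
    (x : EuclideanSpace ℝ (Fin d)) : ∀ (l : ℕ) (hl : l ≤ L) (i : Fin (n l)),
      layer φ a (cutParams L d n ω) x l hl i =
        preact (fanIn d n l) (inputVec φ a n x ω l) (ω l i) := by
  intro l
  induction l with
  | zero =>
    intro hl i
    simp only [layer, preact, fanIn, inputVec, Finset.sum_range]
    simp [weight, bias, cutParams, paramPos]
  | succ l ih =>
    intro hl i
    simp only [layer, preact, fanIn, inputVec, Finset.sum_range, ih]
    simp only [weight, bias, cutParams, paramPos, Finset.mul_sum]
    congr 1
    refine Finset.sum_congr rfl fun j _ => ?_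
    ring

/-- The empirical neural tangent kernel of layer `l` in terms of the array; neither the depth nor
the widths of the layers from `l` on enter. -/
lemma empiricalNTK_cutParams {φ a : ℝ → ℝ} (hφ : Differentiable ℝ φ) (ha : Differentiable ℝ a)
    {L d : ℕ} {n : ℕ → ℕ} (ω : ParamArray) (x x' : EuclideanSpace ℝ (Fin d)) :
    ∀ (l : ℕ) (hl : l ≤ L) (i i' : Fin (n l)),
      empiricalNTK φ a (cutParams L d n ω) l hl x x' i i' =
        kernelValue (fanIn d n l) (inputVec φ a n x ω l) (inputVec φ a n x' ω l)
          (backForm φ a n x x' ω l) ((i : ℕ) = i') (ω l i) (ω l i') := by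
  intro l
  induction l with
  | zero =>
    intro hl i i'
    rw [empiricalNTK_zero hφ ha]
    simp [kernelValue, dotRange, weightForm, inputVec, backForm, fanIn, Finset.sum_range,
      Fin.ext_iff]
  | succ l ih =>
    intro hl i i'
    rw [empiricalNTK_succ hφ ha, kernelValue]
    simp only [ih, layer_cutParams, dotRange, weightForm, inputVec, backForm, fanIn,
      Finset.sum_range, Fin.ext_iff]
    congr 1

/-! ### Convergence in probability as convergence along a filter -/

/-- The sets of pairs `(c, ω)` whose sections have probability tending to `1` along `F`. A function
tends to `e` along this filter if and only if it converges to `e` in probability along `F`, so that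
the calculus of limits along filters applies to convergence in probability. -/
def whp {ι Ω : Type*} [MeasurableSpace Ω] (F : Filter ι) (μ : Measure Ω) : Filter (ι × Ω) where
  sets := {A | Tendsto (fun c => μ {ω | (c, ω) ∉ A}) F (𝓝 0)}
  univ_sets := by simpa using tendsto_const_nhds
  sets_of_superset := by
    intro A B hA hAB
    refine tendsto_of_tendsto_of_tendsto_of_le_of_le tendsto_const_nhds hA (fun _ => zero_le)
      fun c => measure_mono fun ω hω h => hω (hAB h)
  inter_sets := by
    intro A B hA hB
    have h := Tendsto.add hA hB
    rw [add_zero] at h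
    refine tendsto_of_tendsto_of_tendsto_of_le_of_le tendsto_const_nhds h (fun _ => zero_le)
      fun c => (measure_mono ?_).trans (measure_union_le _ _)
    intro ω hω
    by_contra h'
    simp only [Set.mem_union, Set.mem_ofPred_eq, not_or, not_not] at h'
    exact hω h'

lemma eventually_whp {ι Ω : Type*} [MeasurableSpace Ω] {F : Filter ι} {μ : Measure Ω}
    {p : ι × Ω → Prop} :
    (∀ᶠ c in whp F μ, p c) ↔ Tendsto (fun c => μ {ω | ¬ p (c, ω)}) F (𝓝 0) := Iff.rfl

lemma whp_mono {ι Ω : Type*} [MeasurableSpace Ω] {F G : Filter ι} (h : F ≤ G) (μ : Measure Ω) :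
    whp F μ ≤ whp G μ :=
  fun _ hA => Tendsto.mono_left (f := fun c => μ {ω | (c, ω) ∉ _}) hA h

lemma tendsto_fst_whp {ι Ω : Type*} [MeasurableSpace Ω] (F : Filter ι) (μ : Measure Ω) :
    Tendsto Prod.fst (whp F μ) F := by
  intro A hA
  refine eventually_whp.2 (tendsto_const_nhds.congr' ?_)
  filter_upwards [hA] with c hc
  symm
  have : {ω : Ω | ¬ (c, ω) ∈ Prod.fst ⁻¹' A} = ∅ := by
    ext ω
    simpa using hc
  exact this ▸ measure_empty

instance {ι Ω : Type*} [MeasurableSpace Ω] (F : Filter ι) [F.NeBot] (μ : Measure Ω)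
    [IsProbabilityMeasure μ] : (whp F μ).NeBot := by
  refine ⟨fun h => ?_⟩
  have h1 : ∅ ∈ whp F μ := by simp [h]
  have h2 : Tendsto (fun _ : ι => (1 : ℝ≥0∞)) F (𝓝 0) := by
    refine Tendsto.congr (fun c => ?_) (eventually_whp.1 h1)
    exact (congrArg μ (Set.eq_univ_of_forall fun ω h => h)).trans measure_univ
  exact one_ne_zero (tendsto_nhds_unique tendsto_const_nhds h2)

/-- Replacing one coordinate by an independent copy does not change a product law. -/
lemma measurePreserving_update {ι : Type*} [DecidableEq ι] {X : ι → Type*}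
    [∀ i, MeasurableSpace (X i)] (P : ∀ i, Measure (X i)) [∀ i, IsProbabilityMeasure (P i)]
    (l : ι) :
    MeasurePreserving (fun p : (∀ i, X i) × X l => Function.update p.1 l p.2)
      ((Measure.infinitePi P).prod (P l)) (Measure.infinitePi P) := by
  have hm : Measurable (fun p : (∀ i, X i) × X l => Function.update p.1 l p.2) := by
    refine measurable_pi_iff.2 fun i => ?_
    by_cases h : i = l
    · subst h
      simpa using measurable_snd
    · simpa [Function.update_of_ne h, Function.comp_def] using
        (measurable_pi_apply i).comp measurable_fst
  refine ⟨hm, Measure.eq_infinitePi _ fun s t ht => ?_⟩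
  rw [Measure.map_apply hm (MeasurableSet.pi s.countable_toSet fun i _ => ht i)]
  have h : (fun p : (∀ i, X i) × X l => Function.update p.1 l p.2) ⁻¹' Set.pi s t =
      Set.pi (s.erase l : Finset ι) t ×ˢ (if l ∈ s then t l else Set.univ) := by
    ext ⟨f, y⟩
    simp only [Set.mem_preimage, Set.mem_pi, Finset.mem_coe, Set.mem_prod, Finset.mem_erase]
    constructor
    · intro h
      refine ⟨fun i hi => by simpa [Function.update_of_ne hi.1] using h i hi.2, ?_⟩
      split_ifs with hl
      · simpa using h l hl
      · trivial
    · rintro ⟨h1, h2⟩ i hi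
      by_cases hil : i = l
      · subst hil
        simpa [hi] using h2
      · simpa [Function.update_of_ne hil] using h1 i ⟨hil, hi⟩
  rw [h, Measure.prod_prod, Measure.infinitePi_pi _ fun i _ => ht i]
  split_ifs with hl
  · rw [mul_comm, Finset.mul_prod_erase s (fun i => P i (t i)) hl]
  · rw [measure_univ, mul_one, Finset.erase_eq_of_notMem hl]

lemma lintegral_update {ι : Type*} [DecidableEq ι] {X : ι → Type*}
    [∀ i, MeasurableSpace (X i)] (P : ∀ i, Measure (X i)) [∀ i, IsProbabilityMeasure (P i)]
    (l : ι) {f : (∀ i, X i) → ℝ≥0∞} (hf : Measurable f) :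
    ∫⁻ x, f x ∂(Measure.infinitePi P) =
      ∫⁻ x, ∫⁻ y, f (Function.update x l y) ∂(P l) ∂(Measure.infinitePi P) := by
  have h := measurePreserving_update P l
  rw [← h.lintegral_comp hf]
  exact lintegral_prod _ (hf.comp h.measurable).aemeasurable

/-- A conditional Markov inequality: a nonnegative quantity tends to zero in probability as soon as
its conditional expectation, given all layers but layer `l`, does. -/
lemma tendsto_whp_of_condExp {ι : Type*} {F : Filter ι} (l : ℕ) {X : ι → ParamArray → ℝ≥0∞}
    (hX : ∀ c, Measurable (X c))
    (h : Tendsto (fun p : ι × ParamArray =>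
      ∫⁻ ω', X p.1 (Function.update p.2 l ω') ∂layerLaw) (whp F arrayLaw) (𝓝 0)) :
    Tendsto (fun p : ι × ParamArray => X p.1 p.2) (whp F arrayLaw) (𝓝 0) := by
  rw [ENNReal.tendsto_nhds_zero] at h ⊢
  intro ε hε
  rcases eq_or_ne ε ∞ with rfl | hε'
  · simp
  rw [eventually_whp, ENNReal.tendsto_nhds_zero]
  intro δ hδ
  rcases eq_or_ne δ ∞ with rfl | hδ'
  · simp
  have hδ2 : 0 < δ / 2 := ENNReal.half_pos hδ.ne'
  have h1 := eventually_whp.1 (h (ε * (δ / 2)) (ENNReal.mul_pos hε.ne' hδ2.ne'))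
  rw [ENNReal.tendsto_nhds_zero] at h1
  filter_upwards [h1 (δ / 2) hδ2] with c hc
  have hup := measurePreserving_update (fun _ : ℕ => layerLaw) l
  have hm : MeasurableSet {ω | ¬ X c ω ≤ ε} := (measurableSet_le (hX c) measurable_const).compl
  have hg : Measurable fun ω : ParamArray => ∫⁻ ω', X c (Function.update ω l ω') ∂layerLaw :=
    ((hX c).comp hup.measurable).lintegral_prod_right'
  set B := {ω | ¬ ∫⁻ ω', X c (Function.update ω l ω') ∂layerLaw ≤ ε * (δ / 2)} with hB
  have hBm : MeasurableSet B := (measurableSet_le hg measurable_const).compl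
  calc arrayLaw {ω | ¬ X c ω ≤ ε}
      = ∫⁻ ω, {ω | ¬ X c ω ≤ ε}.indicator 1 ω ∂arrayLaw := by
        rw [lintegral_indicator_one hm]
    _ = ∫⁻ ω, layerLaw {ω' | ¬ X c (Function.update ω l ω') ≤ ε} ∂arrayLaw := by
        unfold arrayLaw
        rw [lintegral_update (fun _ : ℕ => layerLaw) l (measurable_one.indicator hm)]
        refine lintegral_congr fun ω => ?_
        rw [← lintegral_indicator_one]
        · rfl
        · exact hm.preimage (hup.measurable.comp (measurable_const.prodMk measurable_id))
    _ ≤ ∫⁻ ω, (B.indicator 1 ω + δ / 2) ∂arrayLaw := by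
        refine lintegral_mono fun ω => ?_
        by_cases hω : ω ∈ B
        · simp only [Set.indicator_of_mem hω, Pi.one_apply]
          exact prob_le_one.trans le_self_add
        · simp only [Set.indicator_of_notMem hω, zero_add]
          have hω' : ∫⁻ ω', X c (Function.update ω l ω') ∂layerLaw ≤ ε * (δ / 2) := by
            simpa [hB] using hω
          have h2 := mul_meas_ge_le_lintegral (μ := layerLaw)
            (f := fun ω' => X c (Function.update ω l ω'))
            ((hX c).comp (hup.measurable.comp (measurable_const.prodMk measurable_id))) ε
          have h3 : ε * layerLaw {ω' | ¬ X c (Function.update ω l ω') ≤ ε} ≤ ε * (δ / 2) := by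
            refine le_trans (mul_le_mul_right (measure_mono fun ω' h' => ?_) ε) (h2.trans hω')
            exact (not_le.1 h').le
          exact (ENNReal.mul_le_mul_iff_right hε.ne' hε').1 h3
    _ = arrayLaw B + δ / 2 := by
        rw [lintegral_add_right _ measurable_const, lintegral_indicator_one hBm]
        simp
    _ ≤ δ / 2 + δ / 2 := by gcongr
    _ = δ := ENNReal.add_halves δ

/-! ### Joint laws of preactivations -/

/-- A linear combination of independent standard Gaussian variables is Gaussian. -/
lemma map_sum_gaussian {ι : Type*} (s : Finset ι) (c : ι → ℝ) :
    (Measure.infinitePi fun _ : ι => gaussianReal 0 1).map (fun r => ∑ k ∈ s, c k * r k) =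
      gaussianReal 0 (∑ k ∈ s, c k ^ 2).toNNReal := by
  classical
  induction s using Finset.induction_on with
  | empty => simp
  | insert i s hi ih =>
    have hind : iIndepFun (fun k (r : ι → ℝ) => c k * r k)
        (Measure.infinitePi fun _ : ι => gaussianReal 0 1) :=
      iIndepFun_infinitePi (X := fun k y => c k * y) (by fun_prop)
    have h1 := hind.indepFun_finsetSum_of_notMem (by fun_prop) hi
    have h2 := (gaussianReal_const_mul (measurePreserving_eval_infinitePi
      (fun _ : ι => gaussianReal 0 1) i).hasLaw (c i)).map_eq
    have ih' : (Measure.infinitePi fun _ : ι => gaussianReal 0 1).map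
        (∑ k ∈ s, fun r : ι → ℝ => c k * r k) = gaussianReal 0 (∑ k ∈ s, c k ^ 2).toNNReal := by
      rw [← ih]
      congr 1
      ext r
      simp
    have h3 := gaussianReal_add_gaussianReal_of_indepFun h1.symm h2 ih'
    convert h3 using 1
    · congr 1
      ext r
      simp [Finset.sum_insert hi]
    · rw [Finset.sum_insert hi, Real.toNNReal_add (by positivity) (by positivity)]
      congr 1
      · simp
      · congr 1
        rw [mul_one]
        exact (Real.toNNReal_of_nonneg (sq_nonneg _))

lemma measurable_preact (m : ℕ) (α : ℕ → ℝ) : Measurable (preact m α) := by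
  unfold preact
  fun_prop

lemma preact_eq_sum (m : ℕ) (α : ℕ → ℝ) (r : Row) :
    preact m α r = ∑ k ∈ Finset.insertNone (Finset.range m), Option.elim k 1 α * r k := by
  rw [Finset.sum_insertNone, preact]
  simp only [Option.elim_none, Option.elim_some, one_mul]
  rw [add_comm]
  congr 1
  exact Finset.sum_congr rfl fun k _ => mul_comm _ _

/-- The part of the preactivation of a neuron that comes from its weights. -/
def linForm (m : ℕ) (β : ℕ → ℝ) (r : Row) : ℝ := ∑ k ∈ Finset.range m, r (some k) * β k

lemma measurable_linForm (m : ℕ) (α : ℕ → ℝ) : Measurable (linForm m α) := by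
  unfold linForm
  fun_prop

lemma map_linForm (m : ℕ) (β : ℕ → ℝ) :
    rowLaw.map (linForm m β) = gaussianReal 0 (dotRange m β β).toNNReal := by
  have h := map_sum_gaussian ((Finset.range m).map Function.Embedding.some)
    (fun k : Option ℕ => Option.elim k 0 β)
  simp only [Finset.sum_map, Function.Embedding.some_apply, Option.elim_some] at h
  have h1 : (fun r : Row => ∑ k ∈ Finset.range m, β k * r (some k)) = linForm m β := by
    ext r
    exact Finset.sum_congr rfl fun k _ => mul_comm _ _
  rw [h1] at h
  refine h.trans ?_
  simp only [dotRange, pow_two]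

/-- The covariance matrix of the preactivations of a neuron at the inputs `α` and `β`. -/
def gramMatrix (m : ℕ) (α β : ℕ → ℝ) : Matrix (Fin 2) (Fin 2) ℝ :=
  !![dotRange m α α + 1, dotRange m α β + 1; dotRange m β α + 1, dotRange m β β + 1]

lemma dotRange_comm (m : ℕ) (α β : ℕ → ℝ) : dotRange m α β = dotRange m β α :=
  Finset.sum_congr rfl fun _ _ => mul_comm _ _

lemma dotRange_self_nonneg (m : ℕ) (α : ℕ → ℝ) : 0 ≤ dotRange m α α :=
  Finset.sum_nonneg fun _ _ => mul_self_nonneg _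

lemma quadForm_gramMatrix (m : ℕ) (α β : ℕ → ℝ) (t : Fin 2 → ℝ) :
    t ⬝ᵥ (gramMatrix m α β).mulVec t = ∑ k ∈ Finset.insertNone (Finset.range m),
      (t 0 * Option.elim k 1 α + t 1 * Option.elim k 1 β) ^ 2 := by
  rw [Finset.sum_insertNone]
  simp only [Option.elim_none, Option.elim_some, gramMatrix, dotProduct, Matrix.mulVec,
    Fin.sum_univ_two, Matrix.of_apply, Matrix.cons_val_zero, Matrix.cons_val_one,
    Matrix.cons_val', Matrix.cons_val_fin_one]
  have h : ∑ k ∈ Finset.range m, (t 0 * α k + t 1 * β k) ^ 2 =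
      t 0 ^ 2 * dotRange m α α + 2 * (t 0 * t 1) * dotRange m α β +
        t 1 ^ 2 * dotRange m β β := by
    simp only [dotRange, Finset.mul_sum, ← Finset.sum_add_distrib]
    exact Finset.sum_congr rfl fun k _ => by ring
  rw [h, dotRange_comm m β α]
  ring

lemma posSemidef_gramMatrix (m : ℕ) (α β : ℕ → ℝ) : (gramMatrix m α β).PosSemidef := by
  refine .of_dotProduct_mulVec_nonneg ?_ fun t => ?_
  · ext i j
    fin_cases i <;> fin_cases j <;> simp [gramMatrix, dotRange_comm]
  · rw [star_trivial, quadForm_gramMatrix]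
    exact Finset.sum_nonneg fun _ _ => sq_nonneg _

/-- The pair of preactivations of a neuron at two inputs, as a vector. -/
def preactPair (m : ℕ) (α β : ℕ → ℝ) (r : Row) : EuclideanSpace ℝ (Fin 2) :=
  !₂[preact m α r, preact m β r]

lemma measurable_preactPair (m : ℕ) (α β : ℕ → ℝ) : Measurable (preactPair m α β) := by
  unfold preactPair
  refine (WithLp.measurable_toLp 2 _).comp (measurable_pi_iff.2 fun i => ?_)
  fin_cases i
  · exact measurable_preact m α
  · exact measurable_preact m β

lemma map_preactPair (m : ℕ) (α β : ℕ → ℝ) :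
    rowLaw.map (preactPair m α β) = multivariateGaussian 0 (gramMatrix m α β) := by
  have := Measure.isProbabilityMeasure_map (μ := rowLaw) (measurable_preactPair m α β).aemeasurable
  refine Measure.ext_of_charFun (funext fun t => ?_)
  rw [charFun_multivariateGaussian (posSemidef_gramMatrix m α β), quadForm_gramMatrix,
    charFun_apply, integral_map (measurable_preactPair m α β).aemeasurable
      (Measurable.aestronglyMeasurable (by fun_prop))]
  have h := map_sum_gaussian (Finset.insertNone (Finset.range m))
    (fun k => t 0 * Option.elim k 1 α + t 1 * Option.elim k 1 β)
  have h1 : (fun r : Row => ∑ k ∈ Finset.insertNone (Finset.range m),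
      (t 0 * Option.elim k 1 α + t 1 * Option.elim k 1 β) * r k) =
      fun r => inner ℝ (preactPair m α β r) t := by
    funext r
    have h2 : inner ℝ (preactPair m α β r) t = t 0 * preact m α r + t 1 * preact m β r := by
      simp [preactPair, PiLp.inner_apply, Fin.sum_univ_two]
    rw [h2, preact_eq_sum, preact_eq_sum, Finset.mul_sum, Finset.mul_sum,
      ← Finset.sum_add_distrib]
    exact Finset.sum_congr rfl fun k _ => by ring
  rw [h1] at h
  have h2 := charFun_gaussianReal (μ := 0) (v := (∑ k ∈ Finset.insertNone (Finset.range m),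
    (t 0 * Option.elim k 1 α + t 1 * Option.elim k 1 β) ^ 2).toNNReal) 1
  rw [← h, charFun_apply_real, integral_map (by
    refine Measurable.aemeasurable ?_
    exact (measurable_preactPair m α β).inner_const) (Measurable.aestronglyMeasurable (by fun_prop))]
    at h2
  simp only [Complex.ofReal_one, one_mul, Complex.ofReal_zero, zero_mul, one_pow, mul_one,
    zero_sub] at h2
  rw [rowLaw, h2, Real.coe_toNNReal _ (Finset.sum_nonneg fun _ _ => sq_nonneg _)]
  simp

/-! ### Smoothing by the bias and uniform integrability -/

/-- Comparison of the Gaussian densities of mean `m` and variance `p` and of mean `0` and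
variance `V`. -/
lemma gaussianReal_le_smul {m : ℝ} {p V : ℝ≥0} {C : ℝ} (hp : p ≠ 0) (hV : V ≠ 0) (hC : 0 ≤ C)
    (h : ∀ x, gaussianPDFReal m p x ≤ C * gaussianPDFReal 0 V x) :
    gaussianReal m p ≤ ENNReal.ofReal C • gaussianReal 0 V := by
  rw [gaussianReal_of_var_ne_zero _ hp, gaussianReal_of_var_ne_zero _ hV,
    ← withDensity_smul _ (measurable_gaussianPDF 0 V)]
  refine withDensity_mono (ae_of_all _ fun x => ?_)
  simp only [gaussianPDF, Pi.smul_apply, smul_eq_mul]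
  rw [← ENNReal.ofReal_mul hC]
  exact ENNReal.ofReal_le_ofReal (h x)

/-- The centred Gaussian laws with variance between `1` and `V` are dominated by a multiple of the
one with variance `V`. -/
lemma gaussianReal_zero_le_smul {p V : ℝ≥0} (hp : 1 ≤ p) (hpV : p ≤ V) :
    gaussianReal 0 p ≤ ENNReal.ofReal √V • gaussianReal 0 V := by
  have hp0 : (0 : ℝ) < p := lt_of_lt_of_le one_pos (by exact_mod_cast hp)
  have hV0 : (0 : ℝ) < V := lt_of_lt_of_le hp0 (by exact_mod_cast hpV)
  have hpV' : (p : ℝ) ≤ V := by exact_mod_cast hpV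
  have hp1 : (1 : ℝ) ≤ p := by exact_mod_cast hp
  refine gaussianReal_le_smul (by rintro rfl; simp at hp0) (by rintro rfl; simp at hV0)
    (Real.sqrt_nonneg _) fun x => ?_
  simp only [gaussianPDFReal, sub_zero]
  rw [← mul_assoc]
  have hπ : (0 : ℝ) < 2 * Real.pi := by positivity
  have h1 : √(V : ℝ) * (√(2 * Real.pi * V))⁻¹ = (√(2 * Real.pi))⁻¹ := by
    rw [Real.sqrt_mul hπ.le, mul_inv, mul_comm, mul_assoc,
      inv_mul_cancel₀ (Real.sqrt_pos.2 hV0).ne', mul_one]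
  rw [h1]
  refine mul_le_mul ?_ ?_ (Real.exp_nonneg _) (by positivity)
  · refine inv_anti₀ (Real.sqrt_pos.2 hπ) (Real.sqrt_le_sqrt ?_)
    nlinarith
  · refine Real.exp_le_exp.2 ?_
    rw [neg_div, neg_div, neg_le_neg_iff]
    gcongr

/-- A Gaussian law of variance `1` is dominated by a centred one of larger variance, at a cost that
grows slowly with the mean: it is square integrable in a centred Gaussian mean of variance at most
`V`. -/
lemma gaussianReal_one_le_smul {m : ℝ} {V : ℝ≥0} (hV : 0 < V) :
    gaussianReal m 1 ≤ ENNReal.ofReal (√(1 + 4 * V) * Real.exp (m ^ 2 / (8 * V))) •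
      gaussianReal 0 (1 + 4 * V) := by
  have hV0 : (0 : ℝ) < V := by exact_mod_cast hV
  refine gaussianReal_le_smul one_ne_zero (by positivity) (by positivity) fun x => ?_
  simp only [gaussianPDFReal, sub_zero]
  push_cast
  have hπ : (0 : ℝ) < 2 * Real.pi := by positivity
  have hW : (0 : ℝ) < 1 + 4 * V := by positivity
  have h1 : √(1 + 4 * V : ℝ) * (√(2 * Real.pi * (1 + 4 * V)))⁻¹ = (√(2 * Real.pi))⁻¹ := by
    rw [Real.sqrt_mul hπ.le, mul_inv, mul_comm, mul_assoc,
      inv_mul_cancel₀ (Real.sqrt_pos.2 hW).ne', mul_one]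
  calc (√(2 * Real.pi * 1))⁻¹ * Real.exp (-(x - m) ^ 2 / (2 * 1))
      ≤ (√(2 * Real.pi))⁻¹ * Real.exp (m ^ 2 / (8 * V) + -x ^ 2 / (2 * (1 + 4 * V))) := by
        rw [mul_one, mul_one]
        gcongr
        -- the difference of the exponents is a square
        have h2 : m ^ 2 / (8 * V) + -x ^ 2 / (2 * (1 + 4 * V)) - -(x - m) ^ 2 / 2 =
            (4 * V * x - (1 + 4 * V) * m) ^ 2 / (8 * V * (1 + 4 * V)) := by
          field_simp
          ring
        have h3 : 0 ≤ (4 * V * x - (1 + 4 * V) * m) ^ 2 / (8 * V * (1 + 4 * V)) := by positivity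
        linarith
    _ = √(1 + 4 * V) * Real.exp (m ^ 2 / (8 * V)) *
        ((√(2 * Real.pi * (1 + 4 * V)))⁻¹ * Real.exp (-x ^ 2 / (2 * (1 + 4 * V)))) := by
        rw [Real.exp_add, ← h1]
        ring

lemma GaussianSqIntegrable.lintegral_lt_top {h : ℝ → ℝ} (hh : GaussianSqIntegrable h) (v : ℝ≥0) :
    ∫⁻ x, ENNReal.ofReal (h x ^ 2) ∂(gaussianReal 0 v) < ∞ :=
  ((hh v).integrable_sq).lintegral_lt_top

/-- A bound for the mass of `h ^ 2` above the level `t` which is uniform over the centred Gaussian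
laws with variance between `1` and `V`. -/
def tailMass (h : ℝ → ℝ) (V : ℝ≥0) (t : ℕ) : ℝ≥0∞ :=
  ENNReal.ofReal √V * ∫⁻ x in {x | (t : ℝ) < h x ^ 2}, ENNReal.ofReal (h x ^ 2) ∂(gaussianReal 0 V)

lemma lintegral_tail_le {h : ℝ → ℝ} {p V : ℝ≥0} (hp : 1 ≤ p)
    (hpV : p ≤ V) (t : ℕ) :
    ∫⁻ x in {x | (t : ℝ) < h x ^ 2}, ENNReal.ofReal (h x ^ 2) ∂(gaussianReal 0 p) ≤
      tailMass h V t := by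
  rw [tailMass, ← smul_eq_mul, ← lintegral_smul_measure, ← Measure.restrict_smul]
  exact lintegral_mono' (Measure.restrict_mono le_rfl (gaussianReal_zero_le_smul hp hpV)) le_rfl

lemma tendsto_tailMass {h : ℝ → ℝ} (hm : Measurable h) (hh : GaussianSqIntegrable h) (V : ℝ≥0) :
    Tendsto (tailMass h V) atTop (𝓝 0) := by
  have hf := hh.lintegral_lt_top V
  have hms : ∀ t : ℕ, MeasurableSet {x | (t : ℝ) < h x ^ 2} := fun t =>
    measurableSet_lt measurable_const (hm.pow_const 2)
  set ν := (gaussianReal 0 V).withDensity fun x => ENNReal.ofReal (h x ^ 2) with hν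
  have h1 : Tendsto (fun t : ℕ => ν {x | (t : ℝ) < h x ^ 2}) atTop
      (𝓝 (ν (⋂ t : ℕ, {x | (t : ℝ) < h x ^ 2}))) := by
    refine tendsto_measure_iInter_atTop (fun t => (hms t).nullMeasurableSet) ?_ ⟨0, ?_⟩
    · intro s t hst x hx
      exact lt_of_le_of_lt (Nat.cast_le.2 hst) (Set.mem_ofPred.1 hx)
    · refine ((measure_mono (Set.subset_univ _)).trans_lt ?_).ne
      rw [hν, withDensity_apply _ MeasurableSet.univ, Measure.restrict_univ]
      exact hf
  have h2 : (⋂ t : ℕ, {x | (t : ℝ) < h x ^ 2}) = ∅ := by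
    ext x
    simp only [Set.mem_iInter, Set.mem_empty_iff_false, iff_false, not_forall]
    obtain ⟨t, ht⟩ := exists_nat_ge (h x ^ 2)
    exact ⟨t, fun h => absurd (Set.mem_ofPred.1 h) (not_lt.2 ht)⟩
  rw [h2, measure_empty] at h1
  have h3 := ENNReal.Tendsto.const_mul (a := ENNReal.ofReal √V) h1 (Or.inr ENNReal.ofReal_ne_top)
  rw [mul_zero] at h3
  refine h3.congr fun t => ?_
  rw [tailMass, hν, withDensity_apply _ (hms t)]

/-- A bound for the second moment of the conditional expectation of `h ^ 2` of a preactivation,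
given the weights, which is uniform over the inputs of squared norm at most `V`. -/
def smoothBound (h : ℝ → ℝ) (V : ℝ≥0) : ℝ≥0∞ :=
  (ENNReal.ofReal √(1 + 4 * V) *
    ∫⁻ x, ENNReal.ofReal (h x ^ 2) ∂(gaussianReal 0 (1 + 4 * V))) ^ 2 *
    ∫⁻ x, ENNReal.ofReal (Real.exp (x ^ 2 / 4)) ∂(gaussianReal 0 1)

lemma lintegral_exp_sq_div_four_lt_top :
    ∫⁻ x, ENNReal.ofReal (Real.exp (x ^ 2 / 4)) ∂(gaussianReal 0 1) < ∞ := by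
  rw [gaussianReal_of_var_ne_zero _ one_ne_zero,
    lintegral_withDensity_eq_lintegral_mul _ (measurable_gaussianPDF 0 1) (by fun_prop)]
  have h1 : Integrable fun x : ℝ => (√(2 * Real.pi * (1 : ℝ≥0)))⁻¹ * Real.exp (-(1 / 4) * x ^ 2) :=
    (integrable_exp_neg_mul_sq (by norm_num)).const_mul _
  refine lt_of_eq_of_lt (lintegral_congr fun x => ?_) h1.lintegral_lt_top
  simp only [Pi.mul_apply, gaussianPDF]
  rw [← ENNReal.ofReal_mul (gaussianPDFReal_nonneg _ _ _), gaussianPDFReal, mul_assoc,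
    ← Real.exp_add]
  congr 3
  simp only [NNReal.coe_one]
  ring

lemma smoothBound_lt_top {h : ℝ → ℝ} (hh : GaussianSqIntegrable h) (V : ℝ≥0) :
    smoothBound h V < ∞ :=
  ENNReal.mul_lt_top (ENNReal.pow_lt_top (ENNReal.mul_lt_top ENNReal.ofReal_lt_top
    (hh.lintegral_lt_top _))) lintegral_exp_sq_div_four_lt_top

/-- Averaging `h ^ 2` over a unit Gaussian shift (the bias) makes it a function of moderate growth
of the remaining argument. -/
lemma lintegral_shift_le {h : ℝ → ℝ} (hm : Measurable h) {V : ℝ≥0} (hV : 0 < V) (m : ℝ) :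
    ∫⁻ b, ENNReal.ofReal (h (m + b) ^ 2) ∂(gaussianReal 0 1) ≤
      ENNReal.ofReal √(1 + 4 * V) *
        (∫⁻ x, ENNReal.ofReal (h x ^ 2) ∂(gaussianReal 0 (1 + 4 * V))) *
        ENNReal.ofReal (Real.exp (m ^ 2 / (8 * V))) := by
  have h1 : ∫⁻ b, ENNReal.ofReal (h (m + b) ^ 2) ∂(gaussianReal 0 1) =
      ∫⁻ y, ENNReal.ofReal (h y ^ 2) ∂(gaussianReal m 1) := by
    have := gaussianReal_map_const_add (μ := 0) (v := 1) m
    rw [zero_add] at this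
    rw [← this, lintegral_map (by fun_prop) (by fun_prop)]
  rw [h1]
  refine (lintegral_mono' (gaussianReal_one_le_smul hV) le_rfl).trans (le_of_eq ?_)
  rw [lintegral_smul_measure, smul_eq_mul, ENNReal.ofReal_mul (Real.sqrt_nonneg _)]
  ring

lemma lintegral_exp_linForm_le (m : ℕ) (α : ℕ → ℝ) {V : ℝ≥0} (hα : dotRange m α α ≤ V)
    (hV : 0 < V) :
    ∫⁻ r, ENNReal.ofReal (Real.exp (linForm m α r ^ 2 / (4 * V))) ∂rowLaw ≤
      ∫⁻ x, ENNReal.ofReal (Real.exp (x ^ 2 / 4)) ∂(gaussianReal 0 1) := by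
  have hV0 : (0 : ℝ) < V := by exact_mod_cast hV
  rw [← lintegral_map (f := fun y => ENNReal.ofReal (Real.exp (y ^ 2 / (4 * V)))) (by fun_prop)
    (measurable_linForm m α), map_linForm]
  have h0 := dotRange_self_nonneg m α
  have h1 := gaussianReal_map_const_mul (μ := 0) (v := 1) √(dotRange m α α)
  have h2 : gaussianReal 0 (dotRange m α α).toNNReal =
      (gaussianReal 0 1).map (√(dotRange m α α) * ·) := by
    rw [h1, mul_zero, mul_one]
    congr 1
    ext
    simp [Real.sq_sqrt h0, h0]
  rw [h2, lintegral_map (by fun_prop) (by fun_prop)]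
  refine lintegral_mono fun x => ENNReal.ofReal_le_ofReal (Real.exp_le_exp.2 ?_)
  rw [mul_pow, Real.sq_sqrt h0, div_le_div_iff₀ (by positivity) (by positivity)]
  have := mul_le_mul_of_nonneg_right hα (sq_nonneg x)
  linarith

/-- Weights of the form `h ^ 2` of a preactivation, with `h` merely square integrable, cost only a
constant factor and a second moment, when the weighted quantity does not depend on the bias. -/
lemma lintegral_sq_preact_mul_le {h : ℝ → ℝ} (hm : Measurable h) {m : ℕ} {α : ℕ → ℝ} {V : ℝ≥0}
    (hα : dotRange m α α ≤ V) (hV : 0 < V) {Y : Row → ℝ≥0∞} (hY : Measurable Y)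
    (hYb : ∀ r b, Y (Function.update r none b) = Y r) :
    ∫⁻ r, ENNReal.ofReal (h (preact m α r) ^ 2) * Y r ∂rowLaw ≤
      smoothBound h V ^ (1 / 2 : ℝ) * (∫⁻ r, Y r ^ 2 ∂rowLaw) ^ (1 / 2 : ℝ) := by
  have hpm := measurable_preact m α
  have hlm := measurable_linForm m α
  set D := ENNReal.ofReal √(1 + 4 * V) *
    ∫⁻ x, ENNReal.ofReal (h x ^ 2) ∂(gaussianReal 0 (1 + 4 * V)) with hD
  set E : Row → ℝ≥0∞ := fun r => D * ENNReal.ofReal (Real.exp (linForm m α r ^ 2 / (8 * V))) with hE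
  have hEm : Measurable E := by fun_prop
  have h1 : ∫⁻ r, ENNReal.ofReal (h (preact m α r) ^ 2) * Y r ∂rowLaw ≤
      ∫⁻ r, E r * Y r ∂rowLaw := by
    -- integrate the bias first
    rw [rowLaw, lintegral_update (fun _ : Option ℕ => gaussianReal 0 1) none (by fun_prop)]
    refine lintegral_mono fun r => ?_
    simp only [hYb]
    have hp : ∀ b, preact m α (Function.update r none b) = linForm m α r + b := by
      intro b
      simp [preact, linForm]
    simp only [hp]
    rw [lintegral_mul_const _ (by fun_prop)]
    exact mul_le_mul_left (lintegral_shift_le hm hV _) _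
  refine h1.trans ((ENNReal.lintegral_mul_le_Lp_mul_Lq rowLaw Real.HolderConjugate.two_two
    hEm.aemeasurable hY.aemeasurable).trans ?_)
  simp only [ENNReal.rpow_two]
  gcongr
  rw [smoothBound, ← hD]
  simp only [hE, mul_pow]
  rw [lintegral_const_mul _ (by fun_prop)]
  gcongr
  refine le_trans (le_of_eq (lintegral_congr fun r => ?_)) (lintegral_exp_linForm_le m α hα hV)
  rw [← ENNReal.ofReal_pow (Real.exp_nonneg _), ← Real.exp_nat_mul]
  congr 2
  push_cast
  field_simp
  ring

/-! ### Moments of a Gaussian row -/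

/-- Functions odd in one coordinate have mean zero, as flipping the sign of one coordinate preserves
the law of a row. -/
lemma integral_row_eq_zero_of_odd (i : Option ℕ) {f : Row → ℝ} (hf : Measurable f)
    (h : ∀ r, f (Function.update r i (-r i)) = -f r) : ∫ r, f r ∂rowLaw = 0 := by
  classical
  have hm : ∀ k : Option ℕ, Measurable fun y : ℝ => if k = i then -y else y := by
    intro k
    split_ifs <;> fun_prop
  have h1 := Measure.infinitePi_map_pi (fun _ : Option ℕ => gaussianReal 0 1) hm
  have h2 : ∀ k : Option ℕ, (gaussianReal 0 1).map (fun y : ℝ => if k = i then -y else y) =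
      gaussianReal 0 1 := by
    intro k
    split_ifs
    · rw [gaussianReal_map_neg, neg_zero]
    · exact Measure.map_id
  simp only [h2] at h1
  have h3 : (fun (r : Row) k => if k = i then -r k else r k) =
      fun r => Function.update r i (-r i) := by
    funext r k
    by_cases hk : k = i
    · subst hk
      simp
    · simp [hk]
  have h4 : ∫ r, f r ∂rowLaw = ∫ r, -f r ∂rowLaw := by
    have h5 : Measurable fun (r : Row) k => if k = i then -r k else r k :=
      measurable_pi_iff.2 fun k => (hm k).comp (measurable_pi_apply k)
    conv_lhs => rw [rowLaw, ← h1, integral_map h5.aemeasurable hf.aestronglyMeasurable]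
    refine integral_congr_ae (ae_of_all _ fun r => ?_)
    exact (congrArg f (congrFun h3 r)).trans (h r)
  rw [integral_neg] at h4
  linarith

lemma integral_eval_row (i : Option ℕ) {f : ℝ → ℝ} (hf : Measurable f) :
    ∫ r, f (r i) ∂rowLaw = ∫ x, f x ∂(gaussianReal 0 1) := by
  have h := measurePreserving_eval_infinitePi (fun _ : Option ℕ => gaussianReal 0 1) i
  rw [← h.map_eq, integral_map h.measurable.aemeasurable hf.aestronglyMeasurable]
  rfl

lemma integral_sq_gaussian : ∫ x, x ^ 2 ∂(gaussianReal 0 1) = 1 := by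
  have h := variance_id_gaussianReal (μ := 0) (v := 1)
  rw [variance_of_integral_eq_zero measurable_id.aemeasurable (by simp)] at h
  simpa using h

lemma integrable_pow_gaussian (k : ℕ) : Integrable (fun x : ℝ => x ^ k) (gaussianReal 0 1) :=
  ((memLp_id_gaussianReal (μ := 0) (v := 1) k).integrable_norm_pow').mono'
    (by fun_prop) (ae_of_all _ fun x => by simp)

lemma integrable_eval_row_pow (i : Option ℕ) (k : ℕ) :
    Integrable (fun r : Row => r i ^ k) rowLaw := by
  have h := measurePreserving_eval_infinitePi (fun _ : Option ℕ => gaussianReal 0 1) i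
  exact h.integrable_comp_of_integrable (integrable_pow_gaussian k)

lemma integrable_row_mul (i j : Option ℕ) : Integrable (fun r : Row => r i * r j) rowLaw := by
  refine ((integrable_eval_row_pow i 2).add (integrable_eval_row_pow j 2)).mono' (by fun_prop)
    (ae_of_all _ fun r => ?_)
  simp only [Pi.add_apply, Real.norm_eq_abs]
  exact abs_le.2 ⟨by nlinarith [sq_nonneg (r i + r j)], by nlinarith [sq_nonneg (r i - r j)]⟩

lemma integrable_row_mul_mul_mul (i j k l : Option ℕ) :
    Integrable (fun r : Row => r i * r j * (r k * r l)) rowLaw := by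
  refine ((((integrable_eval_row_pow i 4).add (integrable_eval_row_pow j 4)).add
    (integrable_eval_row_pow k 4)).add (integrable_eval_row_pow l 4)).mono' (by fun_prop)
    (ae_of_all _ fun r => ?_)
  simp only [Pi.add_apply, Real.norm_eq_abs]
  have h1 := sq_nonneg (r i ^ 2 - r j ^ 2)
  have h2 := sq_nonneg (r k ^ 2 - r l ^ 2)
  have h3 := sq_nonneg (r i * r j + r k * r l)
  have h4 := sq_nonneg (r i * r j - r k * r l)
  have h5 := sq_nonneg (r i ^ 2)
  have h6 := sq_nonneg (r j ^ 2)
  have h7 := sq_nonneg (r k ^ 2)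
  have h8 := sq_nonneg (r l ^ 2)
  exact abs_le.2 ⟨by nlinarith, by nlinarith⟩

lemma integral_row_mul (i j : Option ℕ) :
    ∫ r, r i * r j ∂rowLaw = if i = j then 1 else 0 := by
  split_ifs with h
  · subst h
    simp only [← pow_two]
    rw [integral_eval_row i (f := fun x => x ^ 2) (by fun_prop), integral_sq_gaussian]
  · refine integral_row_eq_zero_of_odd i (by fun_prop) fun r => ?_
    rw [Function.update_self, Function.update_of_ne (Ne.symm h)]
    ring

/-- The fourth moment of the standard Gaussian law. -/
def gaussFourth : ℝ := ∫ x, x ^ 4 ∂(gaussianReal 0 1)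

lemma integral_row_sq_mul_sq {i k : Option ℕ} (h : i ≠ k) :
    ∫ r, r i * r i * (r k * r k) ∂rowLaw = 1 := by
  have h1 := Measure.infinitePi_map_eval_prod (P := fun _ : Option ℕ => gaussianReal 0 1) h
  have h2 : ∫ r, r i * r i * (r k * r k) ∂rowLaw =
      ∫ p : ℝ × ℝ, p.1 ^ 2 * p.2 ^ 2 ∂((gaussianReal 0 1).prod (gaussianReal 0 1)) := by
    rw [← h1, integral_map (by fun_prop) (by fun_prop)]
    refine integral_congr_ae (ae_of_all _ fun r => ?_)
    simp only
    ring
  rw [h2, integral_prod_mul (fun x : ℝ => x ^ 2) (fun y : ℝ => y ^ 2), integral_sq_gaussian,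
    mul_one]

/-- The joint fourth moments of a row. -/
lemma integral_row_mul_mul_mul (i j k l : Option ℕ) :
    ∫ r, r i * r j * (r k * r l) ∂rowLaw =
      (if i = j ∧ k = l then 1 else 0) + (if i = k ∧ j = l then 1 else 0) +
        (if i = l ∧ j = k then 1 else 0) +
        (if i = j ∧ j = k ∧ k = l then gaussFourth - 3 else 0) := by
  have alone : ∀ i j k l : Option ℕ, i ≠ j → i ≠ k → i ≠ l →
      ∫ r, r i * r j * (r k * r l) ∂rowLaw = 0 := by
    intro i j k l h1 h2 h3
    refine integral_row_eq_zero_of_odd i (by fun_prop) fun r => ?_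
    rw [Function.update_self, Function.update_of_ne h1.symm, Function.update_of_ne h2.symm,
      Function.update_of_ne h3.symm]
    ring
  have sw1 : ∀ i j k l : Option ℕ, ∫ r, r i * r j * (r k * r l) ∂rowLaw =
      ∫ r, r j * r i * (r k * r l) ∂rowLaw := fun i j k l =>
    integral_congr_ae (ae_of_all _ fun r => by simp only; ring)
  have sw2 : ∀ i j k l : Option ℕ, ∫ r, r i * r j * (r k * r l) ∂rowLaw =
      ∫ r, r k * r l * (r i * r j) ∂rowLaw := fun i j k l =>
    integral_congr_ae (ae_of_all _ fun r => by simp only; ring)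
  have sw3 : ∀ i j k l : Option ℕ, ∫ r, r i * r j * (r k * r l) ∂rowLaw =
      ∫ r, r i * r k * (r j * r l) ∂rowLaw := fun i j k l =>
    integral_congr_ae (ae_of_all _ fun r => by simp only; ring)
  have four : ∀ i : Option ℕ, ∫ r, r i * r i * (r i * r i) ∂rowLaw = gaussFourth := by
    intro i
    rw [gaussFourth, ← integral_eval_row i (f := fun x => x ^ 4) (by fun_prop)]
    exact integral_congr_ae (ae_of_all _ fun r => by simp only; ring)
  by_cases hij : i = j
  · subst hij
    by_cases hkl : k = l
    · subst hkl
      by_cases hik : i = k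
      · subst hik
        rw [four]
        simp
        ring
      · rw [integral_row_sq_mul_sq hik]
        simp [hik]
    · by_cases hik : i = k
      · subst hik
        rw [sw2, sw1, alone l i i i (Ne.symm hkl) (Ne.symm hkl) (Ne.symm hkl)]
        simp [hkl]
      · rw [sw2, alone k l i i hkl (Ne.symm hik) (Ne.symm hik)]
        simp [hkl, hik]
  · by_cases hik : i = k
    · subst hik
      by_cases hjl : j = l
      · subst hjl
        rw [sw3, integral_row_sq_mul_sq hij]
        simp [hij, Ne.symm hij]
      · rw [sw1, alone j i i l (Ne.symm hij) (Ne.symm hij) hjl]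
        simp [hij, hjl, Ne.symm hij]
    · by_cases hil : i = l
      · subst hil
        by_cases hjk : j = k
        · subst hjk
          rw [sw2, sw1, sw2, sw3, integral_row_sq_mul_sq hij]
          simp [hij]
        · rw [sw1, alone j i k i (Ne.symm hij) hjk (Ne.symm hij)]
          simp [hij, hik, hjk]
      · rw [alone i j k l hij hik hil]
        simp [hij, hik, hil]

/-! ### Gaussian quadratic and bilinear forms -/

/-- The constant in the second moment bound for centred Gaussian quadratic forms. -/
def quadConst : ℝ := 2 + |gaussFourth - 3|

lemma quadConst_nonneg : 0 ≤ quadConst := by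
  unfold quadConst
  positivity

/-- The centred product of two entries of a row. -/
def centredProd (p : ℕ × ℕ) (r : Row) : ℝ :=
  r (some p.1) * r (some p.2) - if p.1 = p.2 then 1 else 0

lemma integrable_centredProd_mul (p q : ℕ × ℕ) :
    Integrable (fun r => centredProd p r * centredProd q r) rowLaw := by
  have h1 := integrable_row_mul_mul_mul (some p.1) (some p.2) (some q.1) (some q.2)
  have h2 := (integrable_row_mul (some p.1) (some p.2)).mul_const (if q.1 = q.2 then 1 else 0)
  have h3 := (integrable_row_mul (some q.1) (some q.2)).const_mul (if p.1 = p.2 then 1 else 0)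
  refine (((h1.sub h2).sub h3).add (integrable_const ((if p.1 = p.2 then (1 : ℝ) else 0) *
    (if q.1 = q.2 then 1 else 0)))).congr (ae_of_all _ fun r => ?_)
  simp only [centredProd, Pi.add_apply, Pi.sub_apply]
  ring

lemma integral_centredProd_mul (p q : ℕ × ℕ) :
    ∫ r, centredProd p r * centredProd q r ∂rowLaw =
      (if q = p then 1 else 0) + (if q = p.swap then 1 else 0) +
        (if q = p then (if p.1 = p.2 then gaussFourth - 3 else 0) else 0) := by
  have h1 := integrable_row_mul_mul_mul (some p.1) (some p.2) (some q.1) (some q.2)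
  have h2 := (integrable_row_mul (some p.1) (some p.2)).mul_const (if q.1 = q.2 then 1 else 0)
  have h3 := (integrable_row_mul (some q.1) (some q.2)).const_mul (if p.1 = p.2 then 1 else 0)
  have h : ∫ r, centredProd p r * centredProd q r ∂rowLaw =
      ∫ r, (r (some p.1) * r (some p.2) * (r (some q.1) * r (some q.2)) -
        r (some p.1) * r (some p.2) * (if q.1 = q.2 then 1 else 0) -
        (if p.1 = p.2 then 1 else 0) * (r (some q.1) * r (some q.2)) +
        (if p.1 = p.2 then (1 : ℝ) else 0) * (if q.1 = q.2 then 1 else 0)) ∂rowLaw := by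
    refine integral_congr_ae (ae_of_all _ fun r => ?_)
    simp only [centredProd]
    ring
  have h4 : Integrable (fun r : Row => r (some p.1) * r (some p.2) * (r (some q.1) * r (some q.2)) -
      r (some p.1) * r (some p.2) * (if q.1 = q.2 then 1 else 0)) rowLaw := h1.sub h2
  have h5 : Integrable (fun r : Row => r (some p.1) * r (some p.2) * (r (some q.1) * r (some q.2)) -
      r (some p.1) * r (some p.2) * (if q.1 = q.2 then 1 else 0) -
      (if p.1 = p.2 then 1 else 0) * (r (some q.1) * r (some q.2))) rowLaw := h4.sub h3
  rw [h, integral_add h5 (integrable_const _), integral_sub h4 h3, integral_sub h1 h2,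
    integral_mul_const, integral_const_mul, integral_row_mul_mul_mul, integral_row_mul,
    integral_row_mul]
  clear h h1 h2 h3 h4 h5
  obtain ⟨a, b⟩ := p
  obtain ⟨c, e⟩ := q
  simp only [Option.some.injEq, Prod.mk.injEq, Prod.swap_prod_mk, integral_const, probReal_univ,
    one_smul]
  by_cases hab : a = b
  · subst hab
    by_cases hce : c = e
    · subst hce
      by_cases hac : a = c
      · subst hac
        simp
        ring
      · simp [hac, Ne.symm hac]
    · have : ¬ (a = c ∧ a = e) := fun h => hce (h.1.symm.trans h.2)
      have h' : ¬ (c = a ∧ e = a) := fun h => hce (h.1.trans h.2.symm)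
      have h'' : ¬ (a = e ∧ a = c) := fun h => hce (h.2.symm.trans h.1)
      simp [hce, this, h', h'']
  · have h1 : (a = c ∧ b = e) ↔ (c = a ∧ e = b) := by
      constructor <;> rintro ⟨rfl, rfl⟩ <;> simp
    have h2 : (a = e ∧ b = c) ↔ (c = b ∧ e = a) := by
      constructor <;> rintro ⟨rfl, rfl⟩ <;> simp
    simp [hab, h1, h2]

lemma weightForm_sub_traceRange (m : ℕ) (M : ℕ → ℕ → ℝ) (r : Row) :
    weightForm m M r r - traceRange m M =
      ∑ p ∈ Finset.range m ×ˢ Finset.range m, M p.1 p.2 * centredProd p r := by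
  rw [Finset.sum_product, weightForm, traceRange, ← Finset.sum_sub_distrib]
  refine Finset.sum_congr rfl fun j hj => ?_
  simp only [centredProd, mul_sub, Finset.sum_sub_distrib, mul_ite, mul_one, mul_zero]
  rw [Finset.sum_ite_eq]
  simp only [hj, if_true]
  congr 1
  exact Finset.sum_congr rfl fun k _ => by ring

lemma frobSq_nonneg (m : ℕ) (M : ℕ → ℕ → ℝ) : 0 ≤ frobSq m M :=
  Finset.sum_nonneg fun _ _ => Finset.sum_nonneg fun _ _ => sq_nonneg _

lemma frobSq_eq_sum_product (m : ℕ) (M : ℕ → ℕ → ℝ) :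
    frobSq m M = ∑ p ∈ Finset.range m ×ˢ Finset.range m, M p.1 p.2 ^ 2 := by
  rw [Finset.sum_product, frobSq]

lemma frobSq_eq_sum_product_swap (m : ℕ) (M : ℕ → ℕ → ℝ) :
    frobSq m M = ∑ p ∈ Finset.range m ×ˢ Finset.range m, M p.2 p.1 ^ 2 := by
  rw [Finset.sum_product, frobSq, Finset.sum_comm]

lemma sq_weightForm_sub_eq (m : ℕ) (M : ℕ → ℕ → ℝ) (r : Row) :
    (weightForm m M r r - traceRange m M) ^ 2 =
      ∑ p ∈ Finset.range m ×ˢ Finset.range m, ∑ q ∈ Finset.range m ×ˢ Finset.range m,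
        M p.1 p.2 * M q.1 q.2 * (centredProd p r * centredProd q r) := by
  rw [weightForm_sub_traceRange, pow_two, Finset.sum_mul_sum]
  exact Finset.sum_congr rfl fun p _ => Finset.sum_congr rfl fun q _ => by ring

lemma integrable_sq_weightForm_sub (m : ℕ) (M : ℕ → ℕ → ℝ) :
    Integrable (fun r => (weightForm m M r r - traceRange m M) ^ 2) rowLaw := by
  simp only [sq_weightForm_sub_eq]
  exact integrable_finsetSum _ fun p _ => integrable_finsetSum _ fun q _ =>
    (integrable_centredProd_mul p q).const_mul _

/-- The variance of a Gaussian quadratic form is at most a constant times its squared Frobenius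
norm. -/
lemma integral_sq_weightForm_sub_le (m : ℕ) (M : ℕ → ℕ → ℝ) :
    ∫ r, (weightForm m M r r - traceRange m M) ^ 2 ∂rowLaw ≤ quadConst * frobSq m M := by
  simp only [sq_weightForm_sub_eq]
  rw [integral_finsetSum _ fun p _ => integrable_finsetSum _ fun q _ =>
    (integrable_centredProd_mul p q).const_mul _]
  have h : ∀ p ∈ Finset.range m ×ˢ Finset.range m,
      ∫ r, ∑ q ∈ Finset.range m ×ˢ Finset.range m,
        M p.1 p.2 * M q.1 q.2 * (centredProd p r * centredProd q r) ∂rowLaw ≤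
      (3 / 2 + |gaussFourth - 3|) * M p.1 p.2 ^ 2 + 1 / 2 * M p.2 p.1 ^ 2 := by
    intro p hp
    have hp' : p.swap ∈ Finset.range m ×ˢ Finset.range m := by
      simp only [Finset.mem_product] at hp
      simp [hp.1, hp.2]
    rw [integral_finsetSum _ fun q _ => (integrable_centredProd_mul p q).const_mul _]
    simp only [integral_const_mul, integral_centredProd_mul, mul_add, Finset.sum_add_distrib,
      mul_ite, mul_one, mul_zero, Finset.sum_ite_eq', hp, hp', if_true, Prod.fst_swap,
      Prod.snd_swap]
    have h1 := sq_nonneg (M p.1 p.2 - M p.2 p.1)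
    have h2 := le_abs_self (gaussFourth - 3)
    have h3 := abs_nonneg (gaussFourth - 3)
    have h4 := sq_nonneg (M p.1 p.2)
    split_ifs
    · nlinarith
    · nlinarith
  refine (Finset.sum_le_sum h).trans (le_of_eq ?_)
  rw [Finset.sum_add_distrib, ← Finset.mul_sum, ← Finset.mul_sum, ← frobSq_eq_sum_product,
    ← frobSq_eq_sum_product_swap, quadConst]
  ring

lemma measurable_weightForm (m : ℕ) (M : ℕ → ℕ → ℝ) :
    Measurable fun p : Row × Row => weightForm m M p.1 p.2 := by
  unfold weightForm
  fun_prop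

lemma measurable_weightForm_self (m : ℕ) (M : ℕ → ℕ → ℝ) :
    Measurable fun r : Row => weightForm m M r r := by
  unfold weightForm
  fun_prop

lemma lintegral_sq_weightForm_sub_le (m : ℕ) (M : ℕ → ℕ → ℝ) :
    ∫⁻ r, ENNReal.ofReal ((weightForm m M r r - traceRange m M) ^ 2) ∂rowLaw ≤
      ENNReal.ofReal (quadConst * frobSq m M) := by
  rw [← ofReal_integral_eq_lintegral_ofReal (integrable_sq_weightForm_sub m M)
    (ae_of_all _ fun r => sq_nonneg _)]
  exact ENNReal.ofReal_le_ofReal (integral_sq_weightForm_sub_le m M)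

/-- The fourth moment of a Gaussian linear form: its square is the quadratic form of a matrix of
rank one. -/
lemma lintegral_linForm_four_le (m : ℕ) (β : ℕ → ℝ) :
    ∫⁻ r, ENNReal.ofReal (linForm m β r ^ 4) ∂rowLaw ≤
      ENNReal.ofReal (2 * (quadConst + 1) * dotRange m β β ^ 2) := by
  set M : ℕ → ℕ → ℝ := fun j k => β j * β k
  have h1 : ∀ r, weightForm m M r r = linForm m β r ^ 2 := by
    intro r
    rw [weightForm, linForm, pow_two, Finset.sum_mul_sum]
    exact Finset.sum_congr rfl fun j _ => Finset.sum_congr rfl fun k _ => by simp only [M]; ring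
  have h2 : frobSq m M = dotRange m β β ^ 2 := by
    rw [frobSq, dotRange, pow_two, Finset.sum_mul_sum]
    exact Finset.sum_congr rfl fun j _ => Finset.sum_congr rfl fun k _ => by simp only [M]; ring
  have h3 : traceRange m M = dotRange m β β := rfl
  have hq := lintegral_sq_weightForm_sub_le m M
  rw [h2] at hq
  have hnn := quadConst_nonneg
  calc ∫⁻ r, ENNReal.ofReal (linForm m β r ^ 4) ∂rowLaw
      ≤ ∫⁻ r, (2 * ENNReal.ofReal ((weightForm m M r r - traceRange m M) ^ 2) +
          ENNReal.ofReal (2 * dotRange m β β ^ 2)) ∂rowLaw := by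
        refine lintegral_mono fun r => ?_
        rw [← ENNReal.ofReal_ofNat 2, ← ENNReal.ofReal_mul zero_le_two,
          ← ENNReal.ofReal_add (by positivity) (by positivity)]
        refine ENNReal.ofReal_le_ofReal ?_
        rw [h1, h3]
        nlinarith [sq_nonneg (linForm m β r ^ 2 - 2 * dotRange m β β)]
    _ ≤ 2 * ENNReal.ofReal (quadConst * dotRange m β β ^ 2) +
          ENNReal.ofReal (2 * dotRange m β β ^ 2) := by
        rw [lintegral_add_right _ measurable_const, lintegral_const_mul' _ _ (by simp)]
        simp only [lintegral_const, measure_univ, mul_one]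
        gcongr
    _ = _ := by
        rw [← ENNReal.ofReal_ofNat 2, ← ENNReal.ofReal_mul zero_le_two,
          ← ENNReal.ofReal_add (by positivity) (by positivity)]
        congr 1
        ring

lemma linForm_update_none (m : ℕ) (β : ℕ → ℝ) (r : Row) (b : ℝ) :
    linForm m β (Function.update r none b) = linForm m β r := by
  simp [linForm]

lemma weightForm_update_none (m : ℕ) (M : ℕ → ℕ → ℝ) (r : Row) (b : ℝ) :
    weightForm m M (Function.update r none b) (Function.update r none b) = weightForm m M r r := by
  simp [weightForm]

/-- The constant in the weighted second moment bounds for Gaussian linear and bilinear forms. -/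
def formConst (h : ℝ → ℝ) (V : ℝ≥0) : ℝ≥0∞ :=
  smoothBound h V ^ (1 / 2 : ℝ) * ENNReal.ofReal (2 * (quadConst + 1)) ^ (1 / 2 : ℝ)

lemma formConst_lt_top {h : ℝ → ℝ} (hh : GaussianSqIntegrable h) (V : ℝ≥0) :
    formConst h V < ∞ :=
  ENNReal.mul_lt_top (ENNReal.rpow_lt_top_of_nonneg (by norm_num) (smoothBound_lt_top hh V).ne)
    (ENNReal.rpow_lt_top_of_nonneg (by norm_num) ENNReal.ofReal_ne_top)

lemma lintegral_sq_preact_mul_linForm_le {h : ℝ → ℝ} (hm : Measurable h) {m : ℕ} {α : ℕ → ℝ}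
    {V : ℝ≥0} (hα : dotRange m α α ≤ V) (hV : 0 < V) (β : ℕ → ℝ) :
    ∫⁻ r, ENNReal.ofReal (h (preact m α r) ^ 2) * ENNReal.ofReal (linForm m β r ^ 2) ∂rowLaw ≤
      formConst h V * ENNReal.ofReal (dotRange m β β) := by
  have hlm := measurable_linForm m β
  have hd := dotRange_self_nonneg m β
  have hnn := quadConst_nonneg
  refine (lintegral_sq_preact_mul_le hm hα hV (by fun_prop) fun r b => by
    rw [linForm_update_none]).trans ?_
  rw [formConst, mul_assoc]
  gcongr
  have h1 : ∫⁻ r, ENNReal.ofReal (linForm m β r ^ 2) ^ 2 ∂rowLaw ≤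
      ENNReal.ofReal (2 * (quadConst + 1)) * ENNReal.ofReal (dotRange m β β) ^ 2 := by
    refine le_trans (le_of_eq (lintegral_congr fun r => ?_))
      ((lintegral_linForm_four_le m β).trans (le_of_eq ?_))
    · rw [← ENNReal.ofReal_pow (sq_nonneg _)]
      congr 1
      ring
    · rw [← ENNReal.ofReal_pow hd, ← ENNReal.ofReal_mul (by positivity)]
  refine (ENNReal.rpow_le_rpow h1 (by norm_num)).trans (le_of_eq ?_)
  rw [ENNReal.mul_rpow_of_nonneg _ _ (by norm_num), ← ENNReal.rpow_natCast, ← ENNReal.rpow_mul]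
  norm_num

lemma weightForm_eq_linForm (m : ℕ) (M : ℕ → ℕ → ℝ) (r r' : Row) :
    weightForm m M r r' = linForm m (fun j => linForm m (M j) r') r := by
  simp only [weightForm, linForm, Finset.mul_sum]
  exact Finset.sum_congr rfl fun j _ => Finset.sum_congr rfl fun k _ => by ring

/-- The weighted second moment of the bilinear form of two independent neurons. -/
lemma lintegral_prod_weightForm_le {h : ℝ → ℝ} (hm : Measurable h) {m : ℕ} {α β : ℕ → ℝ}
    {V : ℝ≥0} (hα : dotRange m α α ≤ V) (hβ : dotRange m β β ≤ V) (hV : 0 < V)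
    (M : ℕ → ℕ → ℝ) :
    ∫⁻ p, ENNReal.ofReal ((h (preact m α p.1) * h (preact m β p.2) *
      weightForm m M p.1 p.2) ^ 2) ∂(rowLaw.prod rowLaw) ≤
      formConst h V ^ 2 * ENNReal.ofReal (frobSq m M) := by
  have hpa := measurable_preact m α
  have hpb := measurable_preact m β
  have hw := measurable_weightForm m M
  have hl := fun j => measurable_linForm m (M j)
  rw [lintegral_prod_symm _ (by fun_prop)]
  calc ∫⁻ r', ∫⁻ r, ENNReal.ofReal ((h (preact m α r) * h (preact m β r') *
        weightForm m M r r') ^ 2) ∂rowLaw ∂rowLaw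
      ≤ ∫⁻ r', ENNReal.ofReal (h (preact m β r') ^ 2) * (formConst h V *
          ∑ j ∈ Finset.range m, ENNReal.ofReal (linForm m (M j) r' ^ 2)) ∂rowLaw := by
        refine lintegral_mono fun r' => ?_
        have h1 := lintegral_sq_preact_mul_linForm_le hm hα hV (fun j => linForm m (M j) r')
        have h2 : ENNReal.ofReal (dotRange m (fun j => linForm m (M j) r')
            (fun j => linForm m (M j) r')) =
            ∑ j ∈ Finset.range m, ENNReal.ofReal (linForm m (M j) r' ^ 2) := by
          rw [dotRange, ENNReal.ofReal_sum_of_nonneg fun _ _ => mul_self_nonneg _]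
          simp only [pow_two]
        rw [h2] at h1
        refine le_trans (le_of_eq ?_) (mul_le_mul_right h1 (ENNReal.ofReal (h (preact m β r') ^ 2)))
        rw [← lintegral_const_mul' _ _ ENNReal.ofReal_ne_top]
        refine lintegral_congr fun r => ?_
        rw [← ENNReal.ofReal_mul (sq_nonneg _), ← ENNReal.ofReal_mul (sq_nonneg _),
          weightForm_eq_linForm]
        congr 1
        ring
    _ = formConst h V * ∑ j ∈ Finset.range m, ∫⁻ r', ENNReal.ofReal (h (preact m β r') ^ 2) *
          ENNReal.ofReal (linForm m (M j) r' ^ 2) ∂rowLaw := by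
        rw [← lintegral_finsetSum _ (by fun_prop), ← lintegral_const_mul _ (by fun_prop)]
        refine lintegral_congr fun r' => ?_
        rw [← Finset.mul_sum]
        ring
    _ ≤ formConst h V * ∑ j ∈ Finset.range m,
          formConst h V * ENNReal.ofReal (dotRange m (M j) (M j)) := by
        gcongr with j
        exact lintegral_sq_preact_mul_linForm_le hm hβ hV (M j)
    _ = _ := by
        rw [← Finset.mul_sum, ← ENNReal.ofReal_sum_of_nonneg fun j _ => dotRange_self_nonneg m (M j),
          ← mul_assoc, pow_two, frobSq]
        simp only [dotRange, pow_two]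

/-- The weighted first moment of a centred Gaussian quadratic form. -/
lemma lintegral_sq_preact_mul_weightForm_sub_le {h : ℝ → ℝ} (hm : Measurable h) {m : ℕ}
    {α : ℕ → ℝ} {V : ℝ≥0} (hα : dotRange m α α ≤ V) (hV : 0 < V) (M : ℕ → ℕ → ℝ) :
    ∫⁻ r, ENNReal.ofReal (h (preact m α r) ^ 2) *
      ENNReal.ofReal |weightForm m M r r - traceRange m M| ∂rowLaw ≤
      smoothBound h V ^ (1 / 2 : ℝ) *
        ENNReal.ofReal (quadConst * frobSq m M) ^ (1 / 2 : ℝ) := by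
  have hw := measurable_weightForm_self m M
  have habs : Measurable fun r : Row => |weightForm m M r r - traceRange m M| :=
    (hw.sub_const _).norm
  refine (lintegral_sq_preact_mul_le hm hα hV (by fun_prop) fun r b => by
    rw [weightForm_update_none]).trans ?_
  gcongr
  refine le_trans (le_of_eq (lintegral_congr fun r => ?_)) (lintegral_sq_weightForm_sub_le m M)
  rw [← ENNReal.ofReal_pow (abs_nonneg _), sq_abs]

/-! ### Continuity of Gaussian kernels in the covariance -/

/-- The value at `S` of the Gaussian kernel of `h`: the expectation of `h u * h v` for a centred
Gaussian pair `(u, v)` with covariance matrix `S`. -/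
def gaussKernel (h : ℝ → ℝ) (S : Matrix (Fin 2) (Fin 2) ℝ) : ℝ :=
  ∫ u, h (u 0) * h (u 1) ∂(multivariateGaussian 0 S)

lemma GaussianSqIntegrable.memLp_eval {h : ℝ → ℝ} (hh : GaussianSqIntegrable h)
    {S : Matrix (Fin 2) (Fin 2) ℝ} (hS : S.PosSemidef) (i : Fin 2) :
    MemLp (fun u : EuclideanSpace ℝ (Fin 2) => h (u i)) 2 (multivariateGaussian 0 S) :=
  (hh (S i i).toNNReal).comp_measurePreserving
    (measurePreserving_eval_multivariateGaussian (μ := 0) hS)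

lemma GaussianSqIntegrable.integrable_mul {h : ℝ → ℝ} (hh : GaussianSqIntegrable h)
    {S : Matrix (Fin 2) (Fin 2) ℝ} (hS : S.PosSemidef) :
    Integrable (fun u : EuclideanSpace ℝ (Fin 2) => h (u 0) * h (u 1))
      (multivariateGaussian 0 S) :=
  (hh.memLp_eval hS 0).integrable_mul (hh.memLp_eval hS 1)

lemma enorm_mul_indicator_le (a b : ℝ) (t : ℕ) :
    {p : ℝ × ℝ | (t : ℝ) < |p.1 * p.2|}.indicator (fun p => ‖p.1 * p.2‖ₑ) (a, b) ≤
      {x : ℝ | (t : ℝ) < x ^ 2}.indicator (fun x => ENNReal.ofReal (x ^ 2)) a +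
        {x : ℝ | (t : ℝ) < x ^ 2}.indicator (fun x => ENNReal.ofReal (x ^ 2)) b := by
  by_cases h : (t : ℝ) < |a * b|
  · rw [Set.indicator_of_mem (by exact h), Real.enorm_eq_ofReal_abs]
    rcases le_total |a| |b| with hab | hab
    · have h1 : |a * b| ≤ b ^ 2 := by
        rw [abs_mul, ← sq_abs b]
        nlinarith [abs_nonneg a, abs_nonneg b]
      rw [Set.indicator_of_mem (a := b) (by exact h.trans_le h1)]
      exact (ENNReal.ofReal_le_ofReal h1).trans le_add_self
    · have h1 : |a * b| ≤ a ^ 2 := by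
        rw [abs_mul, ← sq_abs a]
        nlinarith [abs_nonneg a, abs_nonneg b]
      rw [Set.indicator_of_mem (a := a) (by exact h.trans_le h1)]
      exact (ENNReal.ofReal_le_ofReal h1).trans le_self_add
  · rw [Set.indicator_of_notMem (by exact h)]
    exact zero_le

/-- Uniform integrability of `h u * h v` over the centred Gaussian pairs `(u, v)` with variances
between `1` and `V`. -/
lemma lintegral_pair_tail_le {h : ℝ → ℝ} (hm : Measurable h) {V : ℝ≥0}
    {S : Matrix (Fin 2) (Fin 2) ℝ} (hS : S.PosSemidef) (h1 : ∀ i, 1 ≤ S i i)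
    (hV : ∀ i, S i i ≤ V) (t : ℕ) :
    ∫⁻ u in {u : EuclideanSpace ℝ (Fin 2) | (t : ℝ) < |h (u 0) * h (u 1)|},
      ‖h (u 0) * h (u 1)‖ₑ ∂(multivariateGaussian 0 S) ≤ 2 * tailMass h V t := by
  have hms : MeasurableSet {x | (t : ℝ) < h x ^ 2} :=
    measurableSet_lt measurable_const (hm.pow_const 2)
  have hF : Measurable fun x => {x | (t : ℝ) < h x ^ 2}.indicator
      (fun x => ENNReal.ofReal (h x ^ 2)) x := Measurable.indicator (by fun_prop) hms
  have hms2 : MeasurableSet {u : EuclideanSpace ℝ (Fin 2) | (t : ℝ) < |h (u 0) * h (u 1)|} :=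
    measurableSet_lt measurable_const (by
      have : Measurable fun u : EuclideanSpace ℝ (Fin 2) => h (u 0) * h (u 1) := by fun_prop
      exact this.norm)
  have hi : ∀ i : Fin 2, ∫⁻ u : EuclideanSpace ℝ (Fin 2), {x | (t : ℝ) < h x ^ 2}.indicator
      (fun x => ENNReal.ofReal (h x ^ 2)) (u i) ∂(multivariateGaussian 0 S) ≤ tailMass h V t := by
    intro i
    have h2 := measurePreserving_eval_multivariateGaussian (μ := 0) hS (i := i)
    rw [h2.lintegral_comp hF, lintegral_indicator hms]
    exact lintegral_tail_le (Real.one_le_toNNReal.2 (h1 i))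
      (Real.toNNReal_le_iff_le_coe.2 (hV i)) t
  rw [← lintegral_indicator hms2]
  calc _ ≤ ∫⁻ u : EuclideanSpace ℝ (Fin 2), ({x | (t : ℝ) < h x ^ 2}.indicator
          (fun x => ENNReal.ofReal (h x ^ 2)) (u 0) + {x | (t : ℝ) < h x ^ 2}.indicator
          (fun x => ENNReal.ofReal (h x ^ 2)) (u 1)) ∂(multivariateGaussian 0 S) :=
        lintegral_mono fun u => enorm_mul_indicator_le (h (u 0)) (h (u 1)) t
    _ ≤ tailMass h V t + tailMass h V t := by
        rw [lintegral_add_left (by fun_prop)]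
        exact add_le_add (hi 0) (hi 1)
    _ = 2 * tailMass h V t := (two_mul _).symm

/-- Weak continuity of Gaussian laws in the covariance, by Lévy's continuity theorem. -/
lemma continuousWithinAt_integral_multivariateGaussian
    (f : BoundedContinuousFunction (EuclideanSpace ℝ (Fin 2)) ℝ)
    {S₀ : Matrix (Fin 2) (Fin 2) ℝ} (hS₀ : S₀.PosSemidef) :
    ContinuousWithinAt (fun S => ∫ u, f u ∂(multivariateGaussian 0 S)) {S | S.PosSemidef} S₀ := by
  have : FirstCountableTopology (Matrix (Fin 2) (Fin 2) ℝ) :=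
    inferInstanceAs (FirstCountableTopology (Fin 2 → Fin 2 → ℝ))
  refine tendsto_of_seq_tendsto fun S hS => ?_
  rw [tendsto_nhdsWithin_iff] at hS
  set P : Matrix (Fin 2) (Fin 2) ℝ → ProbabilityMeasure (EuclideanSpace ℝ (Fin 2)) :=
    fun S => ⟨multivariateGaussian 0 S, inferInstance⟩
  have h1 : Tendsto (fun k => P (S k)) atTop (𝓝 (P S₀)) := by
    refine ProbabilityMeasure.tendsto_of_tendsto_charFun fun t => ?_
    have h2 : ContinuousAt (fun S : Matrix (Fin 2) (Fin 2) ℝ =>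
        Complex.exp (inner ℝ t (0 : EuclideanSpace ℝ (Fin 2)) * Complex.I -
          (t.ofLp ⬝ᵥ S.mulVec t.ofLp : ℝ) / 2)) S₀ := by
      refine Continuous.continuousAt ?_
      have : Continuous fun S : Matrix (Fin 2) (Fin 2) ℝ => t.ofLp ⬝ᵥ S.mulVec t.ofLp :=
        Continuous.dotProduct continuous_const (Continuous.matrix_mulVec continuous_id
          continuous_const)
      fun_prop
    have h3 := h2.tendsto.comp hS.1
    have h4 : charFun (P S₀ : Measure (EuclideanSpace ℝ (Fin 2))) t = _ :=
      charFun_multivariateGaussian hS₀ t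
    rw [h4]
    refine h3.congr' ?_
    filter_upwards [hS.2] with k hk
    exact (charFun_multivariateGaussian hk t).symm
  exact (ProbabilityMeasure.tendsto_iff_forall_integral_tendsto.1 h1) f

/-- The covariance matrices of centred Gaussian pairs with variances at least `1`. -/
def admissibleCov : Set (Matrix (Fin 2) (Fin 2) ℝ) := {S | S.PosSemidef ∧ ∀ i, 1 ≤ S i i}

lemma isClosed_admissibleCov : IsClosed admissibleCov := by
  have h : admissibleCov = {S | Matrix.transpose S = S} ∩
      (⋂ x : Fin 2 → ℝ, {S | 0 ≤ x ⬝ᵥ S.mulVec x}) ∩ ⋂ i, {S | 1 ≤ S i i} := by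
    ext S
    simp only [admissibleCov, Matrix.posSemidef_iff_dotProduct_mulVec, star_trivial,
      Matrix.IsHermitian, Matrix.conjTranspose_eq_transpose_of_trivial, Set.mem_inter_iff,
      Set.mem_iInter, Set.mem_ofPred_eq]
  rw [h]
  refine ((isClosed_eq (by fun_prop) (by fun_prop)).inter (isClosed_iInter fun x => ?_)).inter
    (isClosed_iInter fun i => ?_)
  · exact isClosed_le continuous_const (Continuous.dotProduct continuous_const
      (Continuous.matrix_mulVec continuous_id continuous_const))
  · exact isClosed_le continuous_const (by fun_prop)

/-- Continuity of the Gaussian kernel in the covariance: truncation reduces it to bounded continuous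
functions, with an error that is uniform for variances between `1` and `V`. -/
lemma continuousWithinAt_gaussKernel {h : ℝ → ℝ} (hc : Continuous h)
    (hh : GaussianSqIntegrable h) {S₀ : Matrix (Fin 2) (Fin 2) ℝ} (hS₀ : S₀ ∈ admissibleCov) :
    ContinuousWithinAt (gaussKernel h) admissibleCov S₀ := by
  set V : ℝ≥0 := (S₀ 0 0 + S₀ 1 1 + 1).toNNReal with hV
  have hV0 : (V : ℝ) = S₀ 0 0 + S₀ 1 1 + 1 :=
    Real.coe_toNNReal _ (by linarith [hS₀.2 0, hS₀.2 1])
  have hlt : ∀ i, S₀ i i < V := by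
    intro i
    rw [hV0]
    fin_cases i
    · simpa using by linarith [hS₀.2 1]
    · simpa using by linarith [hS₀.2 0]
  -- truncation at level `t`
  let trunc : ℕ → BoundedContinuousFunction (EuclideanSpace ℝ (Fin 2)) ℝ := fun t =>
    BoundedContinuousFunction.ofNormedAddCommGroup
      (fun u => max (-(t : ℝ)) (min t (h (u 0) * h (u 1)))) (by fun_prop) t (fun u => by
        rw [Real.norm_eq_abs, abs_le]
        exact ⟨le_max_left _ _, max_le (by linarith [(Nat.cast_nonneg t : (0 : ℝ) ≤ t)])
          (min_le_left _ _)⟩)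
  have hbound : ∀ (t : ℕ) (S : Matrix (Fin 2) (Fin 2) ℝ), S ∈ admissibleCov →
      (∀ i, S i i ≤ V) →
      ‖gaussKernel h S - ∫ u, trunc t u ∂(multivariateGaussian 0 S)‖ₑ ≤ 2 * tailMass h V t := by
    intro t S hS hSV
    have hms2 : MeasurableSet {u : EuclideanSpace ℝ (Fin 2) | (t : ℝ) < |h (u 0) * h (u 1)|} :=
      (isOpen_lt (by fun_prop) (by fun_prop)).measurableSet
    rw [gaussKernel, ← integral_sub (hh.integrable_mul hS.1) ((trunc t).integrable _)]
    refine (enorm_integral_le_lintegral_enorm _).trans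
      (le_trans ?_ (lintegral_pair_tail_le hc.measurable hS.1 hS.2 hSV t))
    rw [← lintegral_indicator hms2]
    refine lintegral_mono fun u => ?_
    simp only [trunc, BoundedContinuousFunction.coe_ofNormedAddCommGroup]
    by_cases hu : (t : ℝ) < |h (u 0) * h (u 1)|
    · rw [Set.indicator_of_mem (by exact hu), Real.enorm_eq_ofReal_abs, Real.enorm_eq_ofReal_abs]
      refine ENNReal.ofReal_le_ofReal ?_
      have ht : (0 : ℝ) ≤ t := Nat.cast_nonneg t
      rcases lt_abs.1 hu with h1 | h1
      · rw [min_eq_left h1.le, max_eq_right (by linarith), abs_of_nonneg (by linarith),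
          abs_of_nonneg (by linarith)]
        linarith
      · rw [min_eq_right (by linarith), max_eq_left (by linarith), abs_of_nonpos (by linarith),
          abs_of_nonpos (by linarith)]
        linarith
    · rw [Set.indicator_of_notMem (by exact hu)]
      obtain ⟨h1, h2⟩ := abs_le.1 (not_lt.1 hu)
      rw [min_eq_right h2, max_eq_right h1, sub_self, enorm_zero]
  have hdiag : ∀ᶠ S : Matrix (Fin 2) (Fin 2) ℝ in 𝓝[admissibleCov] S₀,
      ∀ i, S i i ≤ (V : ℝ) := by
    refine eventually_all.2 fun i => ?_
    have : ContinuousWithinAt (fun S : Matrix (Fin 2) (Fin 2) ℝ => S i i) admissibleCov S₀ :=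
      (Continuous.continuousAt (by fun_prop)).continuousWithinAt
    filter_upwards [this.eventually_lt_const (hlt i)] with S hS using hS.le
  refine EMetric.tendsto_nhds.2 fun ε hε => ?_
  rcases eq_or_ne ε ∞ with rfl | hε'
  · exact Eventually.of_forall fun S => edist_lt_top _ _
  have h3 : 0 < ε / 3 := ENNReal.div_pos hε.ne' (by simp)
  have hT := ENNReal.Tendsto.const_mul (a := 2) (tendsto_tailMass hc.measurable hh V)
    (Or.inr (by simp))
  rw [mul_zero] at hT
  obtain ⟨t, ht⟩ := (hT.eventually_lt_const h3).exists
  have hw := EMetric.tendsto_nhds.1 ((continuousWithinAt_integral_multivariateGaussian (trunc t)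
    hS₀.1).mono (fun S hS => hS.1 : admissibleCov ⊆ {S | S.PosSemidef}))
  filter_upwards [hw (ε / 3) h3, hdiag, self_mem_nhdsWithin] with S h4 h5 h6
  have h7 := hbound t S h6 h5
  have h8 := hbound t S₀ hS₀ fun i => (hlt i).le
  rw [← edist_eq_enorm_sub] at h7 h8
  rw [edist_comm] at h8
  calc edist (gaussKernel h S) (gaussKernel h S₀)
      ≤ edist (gaussKernel h S) (∫ u, trunc t u ∂(multivariateGaussian 0 S)) +
        edist (∫ u, trunc t u ∂(multivariateGaussian 0 S))
          (∫ u, trunc t u ∂(multivariateGaussian 0 S₀)) +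
        edist (∫ u, trunc t u ∂(multivariateGaussian 0 S₀)) (gaussKernel h S₀) :=
        edist_triangle4 _ _ _ _
    _ < ε / 3 + ε / 3 + ε / 3 :=
        ENNReal.add_lt_add (ENNReal.add_lt_add (h7.trans_lt ht) h4) (h8.trans_lt ht)
    _ = ε := ENNReal.add_thirds ε

/-! ### An L¹ law of large numbers with truncation -/

lemma measurePreserving_neuron (j : ℕ) :
    MeasurePreserving (fun ω : LayerArray => ω j) layerLaw rowLaw :=
  measurePreserving_eval_infinitePi (fun _ => rowLaw) j

lemma lintegral_sum_neurons {Y : Row → ℝ≥0∞} (hY : Measurable Y) (n : ℕ) :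
    ∫⁻ ω, ∑ j ∈ Finset.range n, Y (ω j) ∂layerLaw = n * ∫⁻ r, Y r ∂rowLaw := by
  rw [lintegral_finsetSum _ fun j _ => by fun_prop]
  simp only [(measurePreserving_neuron _).lintegral_comp hY, Finset.sum_const, Finset.card_range,
    nsmul_eq_mul]

/-- The weak law of large numbers for a bounded function of the neurons of a layer. -/
lemma lintegral_average_bounded_le {B : Row → ℝ} (hB : Measurable B) {t : ℝ}
    (ht : ∀ r, |B r| ≤ t) {n : ℕ} (hn : 0 < n) :
    ∫⁻ ω, ‖1 / (n : ℝ) * ∑ j ∈ Finset.range n, B (ω j) - ∫ r, B r ∂rowLaw‖ₑ ∂layerLaw ≤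
      ENNReal.ofReal (t / √n) := by
  have hn0 : (0 : ℝ) < n := by exact_mod_cast hn
  have ht0 : 0 ≤ t := (abs_nonneg _).trans (ht 0)
  have hBj : ∀ j, MemLp (fun ω : LayerArray => B (ω j)) 2 layerLaw := fun j =>
    MemLp.of_bound (hB.comp (measurable_pi_apply j)).aestronglyMeasurable t
      (ae_of_all _ fun ω => ht _)
  have hind : iIndepFun (fun j (ω : LayerArray) => B (ω j)) layerLaw :=
    iIndepFun_infinitePi (X := fun _ => B) fun _ => hB
  have hmean : ∀ j, ∫ ω, B (ω j) ∂layerLaw = ∫ r, B r ∂rowLaw := fun j => by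
    rw [← (measurePreserving_neuron j).map_eq,
      integral_map (measurable_pi_apply j).aemeasurable hB.aestronglyMeasurable]
  set S : LayerArray → ℝ := ∑ j ∈ Finset.range n, fun ω : LayerArray => B (ω j) with hS
  have hSm : MemLp S 2 layerLaw := memLp_finsetSum' _ fun j _ => hBj j
  have hSapp : ∀ ω, S ω = ∑ j ∈ Finset.range n, B (ω j) := fun ω => by simp [hS]
  have hSmean : ∫ ω, S ω ∂layerLaw = n * ∫ r, B r ∂rowLaw := by
    simp only [hSapp]
    rw [integral_finsetSum _ fun j _ => (hBj j).integrable (by norm_num)]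
    simp [hmean]
  have hvar : Var[S; layerLaw] ≤ n * t ^ 2 := by
    rw [hS, IndepFun.variance_sum (fun j _ => hBj j) fun i _ j _ hij => hind.indepFun hij]
    have h1 : ∀ j, Var[fun ω : LayerArray => B (ω j); layerLaw] ≤ t ^ 2 := by
      intro j
      refine (variance_le_expectation_sq (hBj j).aestronglyMeasurable).trans ?_
      refine (integral_mono (hBj j).integrable_sq (integrable_const (t ^ 2)) fun ω => ?_).trans
        (by simp)
      exact sq_le_sq' (abs_le.1 (ht _)).1 (abs_le.1 (ht _)).2
    refine (Finset.sum_le_sum fun j _ => h1 j).trans (by simp)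
  set Z : LayerArray → ℝ := fun ω => 1 / (n : ℝ) * S ω - ∫ r, B r ∂rowLaw with hZ
  have hZm : MemLp Z 2 layerLaw := (hSm.const_mul _).sub (memLp_const _)
  have hZ2 : ∫ ω, Z ω ^ 2 ∂layerLaw ≤ t ^ 2 / n := by
    have h1 : ∀ ω, Z ω ^ 2 = 1 / (n : ℝ) ^ 2 * (S ω - ∫ ω, S ω ∂layerLaw) ^ 2 := by
      intro ω
      rw [hZ, hSmean]
      field_simp
    simp only [h1]
    rw [integral_const_mul, ← variance_eq_integral hSm.aestronglyMeasurable.aemeasurable]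
    calc 1 / (n : ℝ) ^ 2 * Var[S; layerLaw] ≤ 1 / (n : ℝ) ^ 2 * (n * t ^ 2) := by gcongr
      _ = t ^ 2 / n := by field_simp
  have hZ1 : ∫ ω, |Z ω| ∂layerLaw ≤ t / √n := by
    have h1 := variance_nonneg (fun ω => |Z ω|) layerLaw
    rw [variance_eq_sub (by simpa using hZm.norm)] at h1
    have h2 : ∫ ω, ((fun ω => |Z ω|) ^ 2) ω ∂layerLaw = ∫ ω, Z ω ^ 2 ∂layerLaw := by
      simp
    rw [h2] at h1
    refine abs_le_of_sq_le_sq' (a := ∫ ω, |Z ω| ∂layerLaw) ?_ (by positivity) |>.2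
    rw [div_pow, Real.sq_sqrt hn0.le]
    linarith
  have h2 : ∫⁻ ω, ‖Z ω‖ₑ ∂layerLaw = ENNReal.ofReal (∫ ω, |Z ω| ∂layerLaw) := by
    rw [ofReal_integral_eq_lintegral_ofReal (hZm.integrable (by norm_num)).abs
      (ae_of_all _ fun _ => abs_nonneg _)]
    simp only [Real.enorm_eq_ofReal_abs]
  refine le_trans (le_of_eq ?_) (h2.le.trans (ENNReal.ofReal_le_ofReal hZ1))
  simp only [hZ, hSapp]

/-- The mass of `G` above the level `t`. -/
def rowTail (G : Row → ℝ) (t : ℕ) : ℝ≥0∞ := ∫⁻ r in {r | (t : ℝ) < |G r|}, ‖G r‖ₑ ∂rowLaw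

/-- The weak law of large numbers for an integrable function of the neurons of a layer, with an
explicit rate in terms of the tail of the function. -/
lemma lintegral_average_le {G : Row → ℝ} (hG : Measurable G) (hGi : Integrable G rowLaw) (t : ℕ)
    {n : ℕ} (hn : 0 < n) :
    ∫⁻ ω, ‖1 / (n : ℝ) * ∑ j ∈ Finset.range n, G (ω j) - ∫ r, G r ∂rowLaw‖ₑ ∂layerLaw ≤
      ENNReal.ofReal (t / √n) + 2 * rowTail G t := by
  have hn0 : (0 : ℝ) < n := by exact_mod_cast hn
  have hms : MeasurableSet {r | (t : ℝ) < |G r|} := measurableSet_lt measurable_const hG.norm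
  set A : Row → ℝ := {r | (t : ℝ) < |G r|}.indicator G with hA
  set B : Row → ℝ := {r | (t : ℝ) < |G r|}ᶜ.indicator G with hB
  have hAm : Measurable A := hG.indicator hms
  have hBm : Measurable B := hG.indicator hms.compl
  have hAB : ∀ r, G r = B r + A r := fun r =>
    (congrFun (Set.indicator_compl_add_self {r | (t : ℝ) < |G r|} G) r).symm
  have hBt : ∀ r, |B r| ≤ t := by
    intro r
    by_cases hr : (t : ℝ) < |G r|
    · rw [hB, Set.indicator_of_notMem (by simpa using hr), abs_zero]
      exact Nat.cast_nonneg t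
    · rw [hB, Set.indicator_of_mem (by simpa using hr)]
      exact not_lt.1 hr
  have hAi : Integrable A rowLaw := hGi.indicator hms
  have hBi : Integrable B rowLaw := hGi.indicator hms.compl
  have hAt : ∫⁻ r, ‖A r‖ₑ ∂rowLaw = rowTail G t := by
    rw [rowTail, ← lintegral_indicator hms]
    exact lintegral_congr fun r => enorm_indicator_eq_indicator_enorm _ _
  have hsplit : ∀ ω : LayerArray,
      ‖1 / (n : ℝ) * ∑ j ∈ Finset.range n, G (ω j) - ∫ r, G r ∂rowLaw‖ₑ ≤
      ‖1 / (n : ℝ) * ∑ j ∈ Finset.range n, B (ω j) - ∫ r, B r ∂rowLaw‖ₑ +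
        (‖1 / (n : ℝ)‖ₑ * ∑ j ∈ Finset.range n, ‖A (ω j)‖ₑ + ‖∫ r, A r ∂rowLaw‖ₑ) := by
    intro ω
    have h1 : 1 / (n : ℝ) * ∑ j ∈ Finset.range n, G (ω j) - ∫ r, G r ∂rowLaw =
        (1 / (n : ℝ) * ∑ j ∈ Finset.range n, B (ω j) - ∫ r, B r ∂rowLaw) +
          (1 / (n : ℝ) * ∑ j ∈ Finset.range n, A (ω j) - ∫ r, A r ∂rowLaw) := by
      simp only [hAB, Finset.sum_add_distrib]
      rw [integral_add hBi hAi]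
      ring
    rw [h1]
    refine (enorm_add_le _ _).trans (add_le_add le_rfl (enorm_sub_le.trans ?_))
    rw [enorm_mul]
    gcongr
    exact enorm_sum_le _ _
  refine (lintegral_mono hsplit).trans ?_
  rw [lintegral_add_left (by fun_prop), lintegral_add_right _ measurable_const,
    lintegral_const_mul _ (by fun_prop), lintegral_sum_neurons (Y := fun r => ‖A r‖ₑ) (by fun_prop),
    hAt, lintegral_const, measure_univ, mul_one, two_mul]
  refine add_le_add (lintegral_average_bounded_le hBm hBt hn) (add_le_add (le_of_eq ?_) ?_)
  · rw [← mul_assoc, Real.enorm_eq_ofReal (by positivity), ← ENNReal.ofReal_natCast,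
      ← ENNReal.ofReal_mul (by positivity), one_div, inv_mul_cancel₀ hn0.ne', ENNReal.ofReal_one,
      one_mul]
  · exact (enorm_integral_le_lintegral_enorm _).trans hAt.le

/-- A bound for the Euclidean norm of the values of a function at `n` neurons. It shows that the
norm is of smaller order than `n` for an integrable function, square integrable or not. -/
lemma lintegral_sqrt_sum_sq_le {G : Row → ℝ} (hG : Measurable G) (t : ℕ) {n : ℕ} (hn : 0 < n) :
    ∫⁻ ω, ENNReal.ofReal (√(∑ j ∈ Finset.range n, G (ω j) ^ 2) / n) ∂layerLaw ≤
      ENNReal.ofReal (t / √n) + rowTail G t := by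
  have hn0 : (0 : ℝ) < n := by exact_mod_cast hn
  have hms : MeasurableSet {r | (t : ℝ) < |G r|} := measurableSet_lt measurable_const hG.norm
  set A : Row → ℝ := {r | (t : ℝ) < |G r|}.indicator (fun r => |G r|) with hA
  have hAm : Measurable A := (show Measurable fun r => |G r| from hG.norm).indicator hms
  have hA0 : ∀ r, 0 ≤ A r := fun r => Set.indicator_nonneg (fun _ _ => abs_nonneg _) r
  have hAt : ∫⁻ r, ENNReal.ofReal (A r) ∂rowLaw = rowTail G t := by
    rw [rowTail, ← lintegral_indicator hms]
    refine lintegral_congr fun r => ?_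
    by_cases hr : (t : ℝ) < |G r|
    · rw [hA, Set.indicator_of_mem (by exact hr), Set.indicator_of_mem (by exact hr),
        Real.enorm_eq_ofReal_abs]
    · rw [hA, Set.indicator_of_notMem (by exact hr), Set.indicator_of_notMem (by exact hr),
        ENNReal.ofReal_zero]
  have hpt : ∀ ω : LayerArray, √(∑ j ∈ Finset.range n, G (ω j) ^ 2) / n ≤
      t / √n + 1 / (n : ℝ) * ∑ j ∈ Finset.range n, A (ω j) := by
    intro ω
    have hA1 : 0 ≤ ∑ j ∈ Finset.range n, A (ω j) := Finset.sum_nonneg fun j _ => hA0 _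
    have h1 : √(∑ j ∈ Finset.range n, G (ω j) ^ 2) ≤ t * √n + ∑ j ∈ Finset.range n, A (ω j) := by
      rw [Real.sqrt_le_left (by positivity)]
      have h2 : ∀ j ∈ Finset.range n, G (ω j) ^ 2 ≤ (t : ℝ) ^ 2 + A (ω j) ^ 2 := by
        intro j _
        rw [← sq_abs]
        by_cases hr : (t : ℝ) < |G (ω j)|
        · rw [hA, Set.indicator_of_mem (by exact hr)]
          have := sq_nonneg (t : ℝ)
          linarith
        · rw [hA, Set.indicator_of_notMem (by exact hr)]
          have := not_lt.1 hr
          nlinarith [abs_nonneg (G (ω j))]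
      have h3 : ∑ j ∈ Finset.range n, A (ω j) ^ 2 ≤ (∑ j ∈ Finset.range n, A (ω j)) ^ 2 :=
        Finset.sum_sq_le_sq_sum_of_nonneg fun j _ => hA0 _
      have h4 := Finset.sum_le_sum h2
      rw [Finset.sum_add_distrib, Finset.sum_const, Finset.card_range, nsmul_eq_mul] at h4
      have h5 : 0 ≤ 2 * (t * √n) * ∑ j ∈ Finset.range n, A (ω j) := by positivity
      have h6 : (t * √n : ℝ) ^ 2 = n * (t : ℝ) ^ 2 := by
        rw [mul_pow, Real.sq_sqrt hn0.le]
        ring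
      rw [add_sq, h6]
      linarith
    have h7 : (t : ℝ) / √n = t * √n / n := by
      rw [mul_div_assoc, Real.sqrt_div_self', mul_one_div]
    rw [h7, one_div, inv_mul_eq_div, ← add_div]
    exact div_le_div_of_nonneg_right h1 hn0.le
  calc _ ≤ ∫⁻ ω : LayerArray, (ENNReal.ofReal (t / √n) + ENNReal.ofReal (1 / (n : ℝ)) *
          ∑ j ∈ Finset.range n, ENNReal.ofReal (A (ω j))) ∂layerLaw := by
        refine lintegral_mono fun ω => (ENNReal.ofReal_le_ofReal (hpt ω)).trans ?_
        refine ENNReal.ofReal_add_le.trans ?_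
        rw [ENNReal.ofReal_mul (by positivity), ENNReal.ofReal_sum_of_nonneg fun j _ => hA0 _]
    _ = _ := by
        rw [lintegral_add_left measurable_const, lintegral_const_mul _ (by fun_prop),
          lintegral_sum_neurons (Y := fun r => ENNReal.ofReal (A r)) (by fun_prop), hAt,
          lintegral_const, measure_univ, mul_one, ← mul_assoc, ← ENNReal.ofReal_natCast,
          ← ENNReal.ofReal_mul (by positivity), one_div, inv_mul_cancel₀ hn0.ne',
          ENNReal.ofReal_one, one_mul]

/-! ### Conditional L¹ bounds for one layer -/

/-- The product of `h` of the preactivations of one neuron at two inputs. -/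
def preactProd (h : ℝ → ℝ) (m : ℕ) (α β : ℕ → ℝ) (r : Row) : ℝ :=
  h (preact m α r) * h (preact m β r)

lemma measurable_preactProd {h : ℝ → ℝ} (hm : Measurable h) (m : ℕ) (α β : ℕ → ℝ) :
    Measurable (preactProd h m α β) := by
  have := measurable_preact m α
  have := measurable_preact m β
  unfold preactProd
  fun_prop

lemma gramMatrix_mem_admissibleCov (m : ℕ) (α β : ℕ → ℝ) :
    gramMatrix m α β ∈ admissibleCov := by
  refine ⟨posSemidef_gramMatrix m α β, fun i => ?_⟩
  fin_cases i
  · simpa [gramMatrix] using dotRange_self_nonneg m α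
  · simpa [gramMatrix] using dotRange_self_nonneg m β

lemma gramMatrix_diag_le {m : ℕ} {α β : ℕ → ℝ} {V : ℝ} (hα : dotRange m α α + 1 ≤ V)
    (hβ : dotRange m β β + 1 ≤ V) (i : Fin 2) : gramMatrix m α β i i ≤ V := by
  fin_cases i
  · simpa [gramMatrix] using hα
  · simpa [gramMatrix] using hβ

lemma integral_preactProd {h : ℝ → ℝ} (hm : Measurable h) (m : ℕ) (α β : ℕ → ℝ) :
    ∫ r, preactProd h m α β r ∂rowLaw = gaussKernel h (gramMatrix m α β) := by
  rw [gaussKernel, ← map_preactPair, integral_map (measurable_preactPair m α β).aemeasurable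
    (Measurable.aestronglyMeasurable (by fun_prop))]
  rfl

lemma integrable_preactProd {h : ℝ → ℝ} (hh : GaussianSqIntegrable h)
    (m : ℕ) (α β : ℕ → ℝ) : Integrable (preactProd h m α β) rowLaw := by
  have h1 := hh.integrable_mul (posSemidef_gramMatrix m α β)
  rw [← map_preactPair] at h1
  exact h1.comp_measurable (measurable_preactPair m α β)

lemma rowTail_preactProd_le {h : ℝ → ℝ} (hm : Measurable h) {m : ℕ} {α β : ℕ → ℝ} {V : ℝ≥0}
    (hα : dotRange m α α + 1 ≤ V) (hβ : dotRange m β β + 1 ≤ V) (t : ℕ) :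
    rowTail (preactProd h m α β) t ≤ 2 * tailMass h V t := by
  have h1 := lintegral_pair_tail_le hm (posSemidef_gramMatrix m α β)
    (gramMatrix_mem_admissibleCov m α β).2 (gramMatrix_diag_le hα hβ) t
  refine le_trans (le_of_eq ?_) h1
  have hms2 : MeasurableSet {u : EuclideanSpace ℝ (Fin 2) | (t : ℝ) < |h (u 0) * h (u 1)|} :=
    measurableSet_lt measurable_const (by
      have : Measurable fun u : EuclideanSpace ℝ (Fin 2) => h (u 0) * h (u 1) := by fun_prop
      exact this.norm)
  rw [← map_preactPair, setLIntegral_map hms2 (by fun_prop) (measurable_preactPair m α β)]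
  rfl

/-- The empirical kernel of a layer is close to the Gaussian kernel of its inputs, uniformly over
inputs of bounded norm. -/
lemma lintegral_average_preactProd_le {h : ℝ → ℝ} (hm : Measurable h)
    (hh : GaussianSqIntegrable h) {m : ℕ} {α β : ℕ → ℝ} {V : ℝ≥0}
    (hα : dotRange m α α + 1 ≤ V) (hβ : dotRange m β β + 1 ≤ V) (t : ℕ) {n : ℕ} (hn : 0 < n) :
    ∫⁻ ω, ‖1 / (n : ℝ) * ∑ j ∈ Finset.range n, preactProd h m α β (ω j) -
      gaussKernel h (gramMatrix m α β)‖ₑ ∂layerLaw ≤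
      ENNReal.ofReal (t / √n) + 4 * tailMass h V t := by
  rw [← integral_preactProd hm]
  refine (lintegral_average_le (measurable_preactProd hm m α β) (integrable_preactProd hh m α β)
    t hn).trans (add_le_add le_rfl ?_)
  refine (mul_le_mul_right (rowTail_preactProd_le hm hα hβ t) 2).trans (le_of_eq ?_)
  rw [← mul_assoc]
  norm_num

lemma lintegral_sqrt_preactProd_le {h : ℝ → ℝ} (hm : Measurable h)
    {m : ℕ} {α β : ℕ → ℝ} {V : ℝ≥0}
    (hα : dotRange m α α + 1 ≤ V) (hβ : dotRange m β β + 1 ≤ V) (t : ℕ) {n : ℕ} (hn : 0 < n) :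
    ∫⁻ ω, ENNReal.ofReal (√(∑ j ∈ Finset.range n, preactProd h m α β (ω j) ^ 2) / n) ∂layerLaw ≤
      ENNReal.ofReal (t / √n) + 4 * tailMass h V t := by
  refine (lintegral_sqrt_sum_sq_le (measurable_preactProd hm m α β) t hn).trans
    (add_le_add le_rfl ?_)
  refine (rowTail_preactProd_le hm hα hβ t).trans (mul_le_mul_left ?_ _)
  norm_num

/-- The fluctuations of the diagonal of the kernel around its conditional mean are negligible on
average when the matrix of the lower layers has small Frobenius norm. -/
lemma lintegral_average_fluctuation_le {h : ℝ → ℝ} (hm : Measurable h) {m : ℕ} {α β : ℕ → ℝ}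
    {V : ℝ≥0} (hα : dotRange m α α + 1 ≤ V) (hβ : dotRange m β β + 1 ≤ V) (M : ℕ → ℕ → ℝ) (n : ℕ) :
    ∫⁻ ω, ENNReal.ofReal (1 / (n : ℝ) * ∑ j ∈ Finset.range n,
      |preactProd h m α β (ω j) * (weightForm m M (ω j) (ω j) - traceRange m M)|) ∂layerLaw ≤
      smoothBound h V ^ (1 / 2 : ℝ) *
        ENNReal.ofReal (quadConst * frobSq m M) ^ (1 / 2 : ℝ) := by
  have hV : 0 < V := by
    have := dotRange_self_nonneg m α
    exact_mod_cast (by linarith : (0 : ℝ) < V)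
  have hpa := measurable_preact m α
  have hpb := measurable_preact m β
  have hpp := measurable_preactProd hm m α β
  have hw : Measurable fun r : Row => weightForm m M r r - traceRange m M :=
    (measurable_weightForm_self m M).sub_const _
  have habs : Measurable fun r : Row => |weightForm m M r r - traceRange m M| := hw.norm
  have habs2 : Measurable fun r : Row =>
      |preactProd h m α β r * (weightForm m M r r - traceRange m M)| := (hpp.mul hw).norm
  set C := smoothBound h V ^ (1 / 2 : ℝ) *
    ENNReal.ofReal (quadConst * frobSq m M) ^ (1 / 2 : ℝ)
  have hrow : ∫⁻ r, ENNReal.ofReal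
      |preactProd h m α β r * (weightForm m M r r - traceRange m M)| ∂rowLaw ≤ C := by
    have h1 := lintegral_sq_preact_mul_weightForm_sub_le hm
      (by linarith : dotRange m α α ≤ V) hV M
    have h2 := lintegral_sq_preact_mul_weightForm_sub_le hm
      (by linarith : dotRange m β β ≤ V) hV M
    calc _ ≤ ∫⁻ r, ENNReal.ofReal (1 / 2) * (ENNReal.ofReal (h (preact m α r) ^ 2) *
            ENNReal.ofReal |weightForm m M r r - traceRange m M| +
            ENNReal.ofReal (h (preact m β r) ^ 2) *
            ENNReal.ofReal |weightForm m M r r - traceRange m M|) ∂rowLaw := by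
          refine lintegral_mono fun r => ?_
          rw [← add_mul, ← ENNReal.ofReal_add (sq_nonneg _) (sq_nonneg _),
            ← ENNReal.ofReal_mul (by positivity), ← ENNReal.ofReal_mul (by positivity)]
          refine ENNReal.ofReal_le_ofReal ?_
          rw [abs_mul, ← mul_assoc]
          refine mul_le_mul_of_nonneg_right ?_ (abs_nonneg _)
          rw [preactProd, abs_le]
          constructor
          · nlinarith [sq_nonneg (h (preact m α r) + h (preact m β r))]
          · nlinarith [sq_nonneg (h (preact m α r) - h (preact m β r))]
      _ ≤ ENNReal.ofReal (1 / 2) * (C + C) := by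
          rw [lintegral_const_mul _ (by fun_prop), lintegral_add_left (by fun_prop)]
          gcongr
      _ = C := by
          rw [← two_mul, ← mul_assoc, ← ENNReal.ofReal_ofNat 2, ← ENNReal.ofReal_mul (by norm_num)]
          norm_num
  calc _ = ∫⁻ ω : LayerArray, ENNReal.ofReal (1 / (n : ℝ)) * ∑ j ∈ Finset.range n, ENNReal.ofReal
          |preactProd h m α β (ω j) * (weightForm m M (ω j) (ω j) - traceRange m M)| ∂layerLaw := by
        refine lintegral_congr fun ω => ?_
        rw [ENNReal.ofReal_mul (by positivity), ENNReal.ofReal_sum_of_nonneg fun j _ => abs_nonneg _]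
    _ = ENNReal.ofReal (1 / (n : ℝ)) * (n * ∫⁻ r, ENNReal.ofReal
          |preactProd h m α β r * (weightForm m M r r - traceRange m M)| ∂rowLaw) := by
        have habs3 : Measurable fun r : Row => ENNReal.ofReal
          |preactProd h m α β r * (weightForm m M r r - traceRange m M)| := by fun_prop
        rw [lintegral_const_mul, lintegral_sum_neurons habs3]
        exact Finset.measurable_sum _ fun j _ => habs3.comp (measurable_pi_apply j)
    _ ≤ ENNReal.ofReal (1 / (n : ℝ)) * (n * C) := by gcongr
    _ ≤ C := by
        rw [← mul_assoc, ← ENNReal.ofReal_natCast, ← ENNReal.ofReal_mul (by positivity)]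
        refine (mul_le_mul_left (ENNReal.ofReal_le_one.2 ?_) C).trans (one_mul C).le
        rw [one_div]
        exact inv_mul_le_one

/-- Averages over the pairs of distinct neurons of a layer. -/
lemma lintegral_average_pairs_le {T : Row → Row → ℝ}
    (hT : Measurable fun p : Row × Row => T p.1 p.2) (hT0 : ∀ r r', 0 ≤ T r r') {C : ℝ≥0∞}
    (hC : ∫⁻ p, ENNReal.ofReal (T p.1 p.2) ∂(rowLaw.prod rowLaw) ≤ C) (n : ℕ) :
    ∫⁻ ω, ENNReal.ofReal (1 / (n : ℝ) ^ 2 * ∑ j ∈ Finset.range n, ∑ j' ∈ Finset.range n,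
      if j = j' then 0 else T (ω j) (ω j')) ∂layerLaw ≤ C := by
  have hF : Measurable fun p : Row × Row => ENNReal.ofReal (T p.1 p.2) := by fun_prop
  have hpair : ∀ j j' : ℕ, ∫⁻ ω : LayerArray,
      (if j = j' then 0 else ENNReal.ofReal (T (ω j) (ω j'))) ∂layerLaw ≤ C := by
    intro j j'
    split_ifs with hjj
    · simp
    · rw [← Measure.infinitePi_map_eval_prod (P := fun _ : ℕ => rowLaw) hjj,
        lintegral_map hF (by fun_prop)] at hC
      exact hC
  have hmeas : ∀ j j' : ℕ, Measurable fun ω : LayerArray =>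
      if j = j' then 0 else ENNReal.ofReal (T (ω j) (ω j')) := by
    intro j j'
    split_ifs
    · exact measurable_const
    · have h2 : Measurable fun ω : LayerArray => (ω j, ω j') := by fun_prop
      exact hF.comp h2
  calc _ = ∫⁻ ω : LayerArray, ENNReal.ofReal (1 / (n : ℝ) ^ 2) * ∑ j ∈ Finset.range n,
          ∑ j' ∈ Finset.range n, (if j = j' then 0 else ENNReal.ofReal (T (ω j) (ω j')))
          ∂layerLaw := by
        refine lintegral_congr fun ω => ?_
        have hnn : ∀ j j' : ℕ, 0 ≤ if j = j' then (0 : ℝ) else T (ω j) (ω j') := by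
          intro j j'
          split_ifs
          · exact le_rfl
          · exact hT0 _ _
        rw [ENNReal.ofReal_mul (by positivity), ENNReal.ofReal_sum_of_nonneg fun j _ =>
          Finset.sum_nonneg fun j' _ => hnn j j']
        congr 1
        refine Finset.sum_congr rfl fun j _ => ?_
        rw [ENNReal.ofReal_sum_of_nonneg fun j' _ => hnn j j']
        refine Finset.sum_congr rfl fun j' _ => ?_
        split_ifs <;> simp
    _ ≤ ENNReal.ofReal (1 / (n : ℝ) ^ 2) * ∑ j ∈ Finset.range n, ∑ j' ∈ Finset.range n, C := by
        rw [lintegral_const_mul _ (Finset.measurable_sum _ fun j _ =>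
          Finset.measurable_sum _ fun j' _ => hmeas j j'),
          lintegral_finsetSum _ fun j _ => Finset.measurable_sum _ fun j' _ => hmeas j j']
        gcongr with j hj
        rw [lintegral_finsetSum _ fun j' _ => hmeas j j']
        gcongr with j' hj'
        exact hpair j j'
    _ ≤ C := by
        simp only [Finset.sum_const, Finset.card_range, nsmul_eq_mul]
        rw [← mul_assoc, ← mul_assoc, mul_assoc (ENNReal.ofReal _), ← ENNReal.ofReal_natCast,
          ← ENNReal.ofReal_mul (by positivity), ← ENNReal.ofReal_mul (by positivity)]
        refine (mul_le_mul_left (ENNReal.ofReal_le_one.2 ?_) C).trans (one_mul C).le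
        rw [one_div, ← pow_two]
        exact inv_mul_le_one

/-- The off-diagonal part of the backpropagated matrix is controlled in Frobenius norm by the matrix
of the lower layers. -/
lemma lintegral_offDiag_le {h : ℝ → ℝ} (hm : Measurable h) {m : ℕ} {α β : ℕ → ℝ}
    {V : ℝ≥0} (hα : dotRange m α α + 1 ≤ V) (hβ : dotRange m β β + 1 ≤ V) (M : ℕ → ℕ → ℝ) (n : ℕ) :
    ∫⁻ ω, ENNReal.ofReal (1 / (n : ℝ) ^ 2 * ∑ j ∈ Finset.range n, ∑ j' ∈ Finset.range n,
      if j = j' then 0 else (h (preact m α (ω j)) * h (preact m β (ω j')) *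
        weightForm m M (ω j) (ω j')) ^ 2) ∂layerLaw ≤
      formConst h V ^ 2 * ENNReal.ofReal (frobSq m M) := by
  have hV : 0 < V := by
    have := dotRange_self_nonneg m α
    exact_mod_cast (by linarith : (0 : ℝ) < V)
  have hpa := measurable_preact m α
  have hpb := measurable_preact m β
  have hw := measurable_weightForm m M
  exact lintegral_average_pairs_le (T := fun r r' => (h (preact m α r) * h (preact m β r') *
    weightForm m M r r') ^ 2) (by fun_prop) (fun _ _ => sq_nonneg _)
    (lintegral_prod_weightForm_le hm (by linarith) (by linarith) hV M) n

/-! ### Dependence on the lower layers, measurability and limiting kernels -/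

lemma inputVec_congr (φ a : ℝ → ℝ) {d : ℕ} (n : ℕ → ℕ) (x : EuclideanSpace ℝ (Fin d)) :
    ∀ (l : ℕ) {ω ω' : ParamArray}, (∀ k < l, ω k = ω' k) →
      inputVec φ a n x ω l = inputVec φ a n x ω' l := by
  intro l
  induction l with
  | zero =>
    intro ω ω' _
    funext j
    rfl
  | succ l ih =>
    intro ω ω' h
    funext j
    simp only [inputVec]
    rw [ih fun k hk => h k (by omega), h l (by omega)]

lemma backForm_congr (φ a : ℝ → ℝ) {d : ℕ} (n : ℕ → ℕ) (x x' : EuclideanSpace ℝ (Fin d)) :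
    ∀ (l : ℕ) {ω ω' : ParamArray}, (∀ k < l, ω k = ω' k) →
      backForm φ a n x x' ω l = backForm φ a n x x' ω' l := by
  intro l
  induction l with
  | zero =>
    intro ω ω' _
    funext j j'
    rfl
  | succ l ih =>
    intro ω ω' h
    funext j j'
    have h' : ∀ k < l, ω k = ω' k := fun k hk => h k (by omega)
    simp only [backForm]
    rw [ih h', inputVec_congr φ a n x l h', inputVec_congr φ a n x' l h', h l (by omega)]

lemma inputVec_update (φ a : ℝ → ℝ) {d : ℕ} (n : ℕ → ℕ) (x : EuclideanSpace ℝ (Fin d)) (l : ℕ)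
    (ω : ParamArray) (ω' : LayerArray) :
    inputVec φ a n x (Function.update ω l ω') l = inputVec φ a n x ω l :=
  inputVec_congr φ a n x l fun _ hk => Function.update_of_ne hk.ne _ _

lemma backForm_update (φ a : ℝ → ℝ) {d : ℕ} (n : ℕ → ℕ) (x x' : EuclideanSpace ℝ (Fin d)) (l : ℕ)
    (ω : ParamArray) (ω' : LayerArray) :
    backForm φ a n x x' (Function.update ω l ω') l = backForm φ a n x x' ω l :=
  backForm_congr φ a n x x' l fun _ hk => Function.update_of_ne hk.ne _ _

lemma measurable_inputVec {φ a : ℝ → ℝ} (hφ : Differentiable ℝ φ) (ha : Differentiable ℝ a)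
    {d : ℕ} (n : ℕ → ℕ) (x : EuclideanSpace ℝ (Fin d)) :
    ∀ l j, Measurable fun ω : ParamArray => inputVec φ a n x ω l j := by
  intro l
  induction l with
  | zero => exact fun j => measurable_const
  | succ l ih =>
    intro j
    have hσ := (nonlin_differentiable hφ ha l).continuous.measurable
    simp only [inputVec, preact]
    fun_prop

lemma measurable_preact_inputVec {φ a : ℝ → ℝ} (hφ : Differentiable ℝ φ) (ha : Differentiable ℝ a)
    {d : ℕ} (n : ℕ → ℕ) (x : EuclideanSpace ℝ (Fin d)) (l j : ℕ) :
    Measurable fun ω : ParamArray => preact (fanIn d n l) (inputVec φ a n x ω l) (ω l j) := by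
  have h := measurable_inputVec hφ ha n x l
  simp only [preact]
  fun_prop

lemma measurable_backForm {φ a : ℝ → ℝ} (hφ : Differentiable ℝ φ) (ha : Differentiable ℝ a)
    {d : ℕ} (n : ℕ → ℕ) (x x' : EuclideanSpace ℝ (Fin d)) :
    ∀ l j j', Measurable fun ω : ParamArray => backForm φ a n x x' ω l j j' := by
  intro l
  induction l with
  | zero => exact fun j j' => measurable_const
  | succ l ih =>
    intro j j'
    have h1 := measurable_preact_inputVec hφ ha n x l
    have h2 := measurable_preact_inputVec hφ ha n x' l
    have h3 := measurable_inputVec hφ ha n x l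
    have h4 := measurable_inputVec hφ ha n x' l
    have h5 := measurable_deriv (nonlin φ a l)
    simp only [backForm, kernelValue, weightForm, dotRange]
    split_ifs <;> fun_prop

lemma measurable_weightForm_backForm {φ a : ℝ → ℝ} (hφ : Differentiable ℝ φ)
    (ha : Differentiable ℝ a) {d : ℕ} (n : ℕ → ℕ) (x x' : EuclideanSpace ℝ (Fin d)) (l i i' : ℕ) :
    Measurable fun ω : ParamArray =>
      weightForm (fanIn d n l) (backForm φ a n x x' ω l) (ω l i) (ω l i') := by
  have h1 := measurable_backForm hφ ha n x x' l
  simp only [weightForm]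
  fun_prop

lemma measurable_dotRange_inputVec {φ a : ℝ → ℝ} (hφ : Differentiable ℝ φ)
    (ha : Differentiable ℝ a) {d : ℕ} (n : ℕ → ℕ) (x x' : EuclideanSpace ℝ (Fin d)) (l : ℕ) :
    Measurable fun ω : ParamArray =>
      dotRange (fanIn d n l) (inputVec φ a n x ω l) (inputVec φ a n x' ω l) := by
  have h1 := measurable_inputVec hφ ha n x l
  have h2 := measurable_inputVec hφ ha n x' l
  simp only [dotRange]
  fun_prop

lemma measurable_traceRange_backForm {φ a : ℝ → ℝ} (hφ : Differentiable ℝ φ)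
    (ha : Differentiable ℝ a) {d : ℕ} (n : ℕ → ℕ) (x x' : EuclideanSpace ℝ (Fin d)) (l : ℕ) :
    Measurable fun ω : ParamArray => traceRange (fanIn d n l) (backForm φ a n x x' ω l) := by
  have h1 := measurable_backForm hφ ha n x x' l
  simp only [traceRange]
  fun_prop

/-- A choice of the widths together with two neurons of the layer under consideration. Carrying the
neurons along makes the limits uniform in them. -/
abbrev NetConfig : Type := (ℕ → ℕ) × ℕ × ℕ

/-- All widths of the layers below layer `l` tend to infinity. -/
def widthsToInfty (l : ℕ) : Filter NetConfig := comap (fun c (k : Fin l) => c.1 k) atTop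

lemma tendsto_width {l k : ℕ} (hk : k < l) :
    Tendsto (fun c : NetConfig => c.1 k) (widthsToInfty l) atTop := by
  have h : Tendsto (fun f : Fin l → ℕ => f ⟨k, hk⟩) atTop atTop := tendsto_atTop_atTop.2 fun b =>
    ⟨fun _ => b, fun f hf => hf ⟨k, hk⟩⟩
  exact h.comp tendsto_comap

lemma widthsToInfty_succ_le (l : ℕ) : widthsToInfty (l + 1) ≤ widthsToInfty l := by
  refine tendsto_iff_comap.1 ?_
  refine tendsto_atTop.2 fun f => eventually_all.2 fun k => ?_
  exact (tendsto_width (k.2.trans (Nat.lt_succ_self l))).eventually_ge_atTop (f k)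

instance (l : ℕ) : (widthsToInfty l).NeBot := by
  refine comap_neBot fun A hA => ?_
  obtain ⟨f, hf⟩ := (atTop : Filter (Fin l → ℕ)).nonempty_of_mem hA
  refine ⟨(fun k => if h : k < l then f ⟨k, h⟩ else 0, 0, 0), ?_⟩
  simpa using hf

lemma exists_of_mem_widthsToInfty {l : ℕ} {A : Set NetConfig} (hA : A ∈ widthsToInfty l) :
    ∃ N : ℕ, ∀ c : NetConfig, (∀ k < l, N ≤ c.1 k) → c ∈ A := by
  obtain ⟨B, hB, hBA⟩ := hA
  obtain ⟨f, hf⟩ := mem_atTop_sets.1 hB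
  refine ⟨Finset.univ.sup f, fun c hc => hBA (hf _ fun k => ?_)⟩
  exact (Finset.le_sup (Finset.mem_univ k)).trans (hc k k.2)

lemma tendsto_zero_of_ofReal {ι : Type*} {F : Filter ι} {f : ι → ℝ} (hf : ∀ i, 0 ≤ f i)
    (h : Tendsto (fun i => ENNReal.ofReal (f i)) F (𝓝 0)) : Tendsto f F (𝓝 0) := by
  have h1 := (ENNReal.tendsto_toReal ENNReal.zero_ne_top).comp h
  refine h1.congr fun i => ?_
  exact ENNReal.toReal_ofReal (hf i)

lemma tendsto_zero_of_tail_bound {ι : Type*} {F : Filter ι} {h : ℝ → ℝ} (hm : Measurable h)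
    (hh : GaussianSqIntegrable h) (V : ℝ≥0) {n : ι → ℕ} (hn : Tendsto n F atTop) {f : ι → ℝ≥0∞}
    (hf : ∀ t : ℕ, ∀ᶠ i in F, f i ≤ ENNReal.ofReal (t / √(n i)) + 4 * tailMass h V t) :
    Tendsto f F (𝓝 0) := by
  rw [ENNReal.tendsto_nhds_zero]
  intro ε hε
  have hT := ENNReal.Tendsto.const_mul (a := 4) (tendsto_tailMass hm hh V) (Or.inr (by simp))
  rw [mul_zero, ENNReal.tendsto_nhds_zero] at hT
  obtain ⟨t, ht⟩ := (hT (ε / 2) (ENNReal.half_pos hε.ne')).exists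
  have h1 : Tendsto (fun i => ENNReal.ofReal (t / √(n i))) F (𝓝 0) := by
    rw [← ENNReal.ofReal_zero]
    refine ENNReal.tendsto_ofReal ?_
    exact tendsto_const_nhds.div_atTop (Real.tendsto_sqrt_atTop.comp
      (tendsto_natCast_atTop_atTop.comp hn))
  rw [ENNReal.tendsto_nhds_zero] at h1
  filter_upwards [hf t, h1 (ε / 2) (ENNReal.half_pos hε.ne')] with i h2 h3
  exact (h2.trans (add_le_add h3 ht)).trans (ENNReal.add_halves ε).le

/-- The limiting neural tangent kernels. -/
def ntkLimit (φ a : ℝ → ℝ) (d : ℕ) :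
    ℕ → EuclideanSpace ℝ (Fin d) → EuclideanSpace ℝ (Fin d) → ℝ
  | 0, x, x' => inner ℝ x x' + 1
  | l + 1, x, x' => ntkLimit φ a d l x x' * CKDot φ a d (l + 1) x x' + CK φ a d (l + 1) x x'

/-- The limiting covariance matrix of the outputs of layer `l` at two inputs. -/
def covLimit (φ a : ℝ → ℝ) (d l : ℕ) (x x' : EuclideanSpace ℝ (Fin d)) :
    Matrix (Fin 2) (Fin 2) ℝ :=
  !![CK φ a d l x x, CK φ a d l x x'; CK φ a d l x' x, CK φ a d l x' x']

lemma CK_succ (φ a : ℝ → ℝ) (d l : ℕ) (x x' : EuclideanSpace ℝ (Fin d)) :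
    CK φ a d (l + 1) x x' = gaussKernel (nonlin φ a l) (covLimit φ a d l x x') + 1 := rfl

lemma CKDot_succ (φ a : ℝ → ℝ) (d l : ℕ) (x x' : EuclideanSpace ℝ (Fin d)) :
    CKDot φ a d (l + 1) x x' = gaussKernel (deriv (nonlin φ a l)) (covLimit φ a d l x x') := rfl

/-- The covariance matrix of the outputs of layer `l` at two inputs, given the lower layers. -/
def layerGram (φ a : ℝ → ℝ) {d : ℕ} (n : ℕ → ℕ) (ω : ParamArray) (l : ℕ)
    (x x' : EuclideanSpace ℝ (Fin d)) : Matrix (Fin 2) (Fin 2) ℝ :=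
  gramMatrix (fanIn d n l) (inputVec φ a n x ω l) (inputVec φ a n x' ω l)

/-- The outputs of layer `l` have asymptotically the covariances `CK φ a d l`, in probability. -/
def CovTendsto (φ a : ℝ → ℝ) (d l : ℕ) : Prop :=
  ∀ x x' : EuclideanSpace ℝ (Fin d),
    Tendsto (fun p : NetConfig × ParamArray => dotRange (fanIn d p.1.1 l)
      (inputVec φ a p.1.1 x p.2 l) (inputVec φ a p.1.1 x' p.2 l) + 1)
      (whp (widthsToInfty l) arrayLaw) (𝓝 (CK φ a d l x x'))

lemma tendsto_layerGram {φ a : ℝ → ℝ} {d l : ℕ} (H : CovTendsto φ a d l)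
    (x x' : EuclideanSpace ℝ (Fin d)) :
    Tendsto (fun p : NetConfig × ParamArray => layerGram φ a p.1.1 p.2 l x x')
      (whp (widthsToInfty l) arrayLaw) (𝓝 (covLimit φ a d l x x')) := by
  refine tendsto_pi_nhds.2 fun i => tendsto_pi_nhds.2 fun j => ?_
  fin_cases i <;> fin_cases j
  · exact H x x
  · exact H x x'
  · exact H x' x
  · exact H x' x'

lemma covLimit_mem_admissibleCov {φ a : ℝ → ℝ} {d l : ℕ} (H : CovTendsto φ a d l)
    (x x' : EuclideanSpace ℝ (Fin d)) : covLimit φ a d l x x' ∈ admissibleCov :=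
  isClosed_admissibleCov.mem_of_tendsto (tendsto_layerGram H x x')
    (Eventually.of_forall fun _ => gramMatrix_mem_admissibleCov _ _ _)

lemma dotRange_inputVec_zero (φ a : ℝ → ℝ) {d : ℕ} (n : ℕ → ℕ) (ω : ParamArray)
    (x x' : EuclideanSpace ℝ (Fin d)) :
    dotRange (fanIn d n 0) (inputVec φ a n x ω 0) (inputVec φ a n x' ω 0) = inner ℝ x x' := by
  simp [dotRange, fanIn, inputVec, Finset.sum_range, PiLp.inner_apply, mul_comm]

lemma layerGram_zero (φ a : ℝ → ℝ) {d : ℕ} (n : ℕ → ℕ) (ω : ParamArray)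
    (x x' : EuclideanSpace ℝ (Fin d)) : layerGram φ a n ω 0 x x' = covLimit φ a d 0 x x' := by
  simp only [layerGram, gramMatrix, covLimit, dotRange_inputVec_zero, CK]

/-- The Gaussian kernel of the random covariances converges. For `l = 0` the covariances are exact,
so that no continuity of `h` is needed. -/
lemma tendsto_gaussKernel_layerGram {φ a : ℝ → ℝ} {d l : ℕ} (H : CovTendsto φ a d l)
    {h : ℝ → ℝ} (hh : GaussianSqIntegrable h) (hc : l ≠ 0 → Continuous h)
    (x x' : EuclideanSpace ℝ (Fin d)) :
    Tendsto (fun p : NetConfig × ParamArray => gaussKernel h (layerGram φ a p.1.1 p.2 l x x'))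
      (whp (widthsToInfty l) arrayLaw) (𝓝 (gaussKernel h (covLimit φ a d l x x'))) := by
  rcases eq_or_ne l 0 with rfl | hl
  · simp only [layerGram_zero]
    exact tendsto_const_nhds
  · exact (continuousWithinAt_gaussKernel (hc hl) hh (covLimit_mem_admissibleCov H x x')).tendsto.comp
      (tendsto_nhdsWithin_iff.2 ⟨tendsto_layerGram H x x',
        Eventually.of_forall fun _ => gramMatrix_mem_admissibleCov _ _ _⟩)

/-- A bound for the variances of layer `l` that holds with high probability. -/
def varBound (φ a : ℝ → ℝ) (d l : ℕ) (x x' : EuclideanSpace ℝ (Fin d)) : ℝ≥0 :=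
  (CK φ a d l x x + CK φ a d l x' x' + 1).toNNReal

lemma eventually_le_varBound {φ a : ℝ → ℝ} {d l : ℕ} (H : CovTendsto φ a d l)
    (x x' : EuclideanSpace ℝ (Fin d)) :
    ∀ᶠ p in whp (widthsToInfty l) arrayLaw,
      dotRange (fanIn d p.1.1 l) (inputVec φ a p.1.1 x p.2 l) (inputVec φ a p.1.1 x p.2 l) + 1 ≤
        varBound φ a d l x x' ∧
      dotRange (fanIn d p.1.1 l) (inputVec φ a p.1.1 x' p.2 l) (inputVec φ a p.1.1 x' p.2 l) + 1 ≤
        varBound φ a d l x x' := by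
  have h1 := (covLimit_mem_admissibleCov H x x').2 0
  have h2 := (covLimit_mem_admissibleCov H x x').2 1
  simp only [covLimit, Matrix.of_apply, Matrix.cons_val_zero, Matrix.cons_val_one,
    Matrix.cons_val', Matrix.cons_val_fin_one] at h1 h2
  have hV : (varBound φ a d l x x' : ℝ) = CK φ a d l x x + CK φ a d l x' x' + 1 :=
    Real.coe_toNNReal _ (by linarith)
  filter_upwards [(H x x).eventually_lt_const (show _ < (varBound φ a d l x x' : ℝ) by
    rw [hV]; linarith), (H x' x').eventually_lt_const (show _ < (varBound φ a d l x x' : ℝ) by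
    rw [hV]; linarith)] with p h3 h4
  exact ⟨h3.le, h4.le⟩

/-! ### Propagation through the layers -/

/-- A nonnegative quantity tends to zero in probability as soon as its conditional expectation,
given all layers but layer `l`, is bounded by a quantity that does. -/
lemma tendsto_zero_of_condExp {ι : Type*} {F : Filter ι} (l : ℕ) (X : ι → ParamArray → ℝ)
    (hX : ∀ c, Measurable (X c)) (h0 : ∀ c ω, 0 ≤ X c ω)
    (h : Tendsto (fun p : ι × ParamArray =>
      ∫⁻ ω', ENNReal.ofReal (X p.1 (Function.update p.2 l ω')) ∂layerLaw)
      (whp F arrayLaw) (𝓝 0)) :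
    Tendsto (fun p : ι × ParamArray => X p.1 p.2) (whp F arrayLaw) (𝓝 0) :=
  tendsto_zero_of_ofReal (fun p => h0 p.1 p.2) (tendsto_whp_of_condExp l
    (X := fun c ω => ENNReal.ofReal (X c ω)) (fun c => (hX c).ennreal_ofReal) h)

/-- The empirical kernel of layer `l` converges to the Gaussian kernel of the limiting covariances,
in probability. -/
lemma tendsto_average_preactProd {φ a : ℝ → ℝ} (hφ : Differentiable ℝ φ) (ha : Differentiable ℝ a)
    {d l : ℕ} (H : CovTendsto φ a d l) {h : ℝ → ℝ} (hm : Measurable h)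
    (hh : GaussianSqIntegrable h) (hc : l ≠ 0 → Continuous h) (x x' : EuclideanSpace ℝ (Fin d)) :
    Tendsto (fun p : NetConfig × ParamArray => 1 / (p.1.1 l : ℝ) *
      ∑ j ∈ Finset.range (p.1.1 l), preactProd h (fanIn d p.1.1 l) (inputVec φ a p.1.1 x p.2 l)
        (inputVec φ a p.1.1 x' p.2 l) (p.2 l j))
      (whp (widthsToInfty (l + 1)) arrayLaw) (𝓝 (gaussKernel h (covLimit φ a d l x x'))) := by
  have hle : whp (widthsToInfty (l + 1)) arrayLaw ≤ whp (widthsToInfty l) arrayLaw :=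
    whp_mono (widthsToInfty_succ_le l) _
  have hn : Tendsto (fun p : NetConfig × ParamArray => p.1.1 l)
      (whp (widthsToInfty (l + 1)) arrayLaw) atTop :=
    (tendsto_width (Nat.lt_succ_self l)).comp (tendsto_fst_whp _ _)
  have hker := (tendsto_gaussKernel_layerGram H hh hc x x').mono_left hle
  set X : NetConfig → ParamArray → ℝ≥0∞ := fun c ω => ‖1 / (c.1 l : ℝ) *
    ∑ j ∈ Finset.range (c.1 l), preactProd h (fanIn d c.1 l) (inputVec φ a c.1 x ω l)
      (inputVec φ a c.1 x' ω l) (ω l j) - gaussKernel h (layerGram φ a c.1 ω l x x')‖ₑ with hX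
  have hXm : ∀ c, Measurable (X c) := by
    intro c
    have h1 := measurable_preact_inputVec hφ ha c.1 x l
    have h2 := measurable_preact_inputVec hφ ha c.1 x' l
    have h3 : Measurable fun ω : ParamArray => gaussKernel h (layerGram φ a c.1 ω l x x') := by
      have h4 : (fun ω : ParamArray => gaussKernel h (layerGram φ a c.1 ω l x x')) = fun ω =>
          ∫ r, preactProd h (fanIn d c.1 l) (inputVec φ a c.1 x ω l)
            (inputVec φ a c.1 x' ω l) r ∂rowLaw :=
        funext fun ω => (integral_preactProd hm _ _ _).symm
      rw [h4]
      refine StronglyMeasurable.measurable (StronglyMeasurable.integral_prod_right ?_)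
      refine Measurable.stronglyMeasurable ?_
      have h5 := measurable_inputVec hφ ha c.1 x l
      have h6 := measurable_inputVec hφ ha c.1 x' l
      simp only [Function.uncurry_def, preactProd, preact]
      fun_prop
    simp only [hX, preactProd]
    fun_prop
  have hX0 : Tendsto (fun p : NetConfig × ParamArray => X p.1 p.2)
      (whp (widthsToInfty (l + 1)) arrayLaw) (𝓝 0) := by
    refine tendsto_whp_of_condExp l hXm
      (tendsto_zero_of_tail_bound hm hh (varBound φ a d l x x') hn fun t => ?_)
    filter_upwards [hle (eventually_le_varBound H x x'), hn.eventually_gt_atTop 0] with p h1 h2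
    simp only [hX, inputVec_update, layerGram, Function.update_self]
    exact lintegral_average_preactProd_le hm hh h1.1 h1.2 t h2
  have hX1 := tendsto_zero_iff_enorm_tendsto_zero.2 hX0
  have h1 := hX1.add hker
  rw [zero_add] at h1
  refine h1.congr fun p => ?_
  ring

lemma dotRange_inputVec_succ (φ a : ℝ → ℝ) {d : ℕ} (n : ℕ → ℕ) (ω : ParamArray)
    (x x' : EuclideanSpace ℝ (Fin d)) (l : ℕ) :
    dotRange (fanIn d n (l + 1)) (inputVec φ a n x ω (l + 1)) (inputVec φ a n x' ω (l + 1)) =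
      1 / (n l : ℝ) * ∑ j ∈ Finset.range (n l), preactProd (nonlin φ a l) (fanIn d n l)
        (inputVec φ a n x ω l) (inputVec φ a n x' ω l) (ω l j) := by
  have hs : (1 / √(n l : ℝ)) * (1 / √(n l : ℝ)) = 1 / (n l : ℝ) := by
    rw [div_mul_div_comm, Real.mul_self_sqrt (Nat.cast_nonneg _), one_mul]
  rw [dotRange, Finset.mul_sum]
  refine Finset.sum_congr rfl fun j _ => ?_
  simp only [inputVec, preactProd]
  rw [← hs]
  ring

/-- Propagation of the conjugate kernels through the layers. -/
lemma covTendsto {φ a : ℝ → ℝ} (hφ : Differentiable ℝ φ) (ha : Differentiable ℝ a)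
    (hφint : GaussianSqIntegrable φ) (haint : GaussianSqIntegrable a) (d : ℕ) :
    ∀ l, CovTendsto φ a d l := by
  intro l
  induction l with
  | zero =>
    intro x x'
    simp only [dotRange_inputVec_zero]
    exact tendsto_const_nhds
  | succ l ih =>
    intro x x'
    have hσ := (nonlin_differentiable hφ ha l).continuous
    have hint : GaussianSqIntegrable (nonlin φ a l) := by
      cases l
      · exact hφint
      · exact haint
    have h := (tendsto_average_preactProd hφ ha ih hσ.measurable hint (fun _ => hσ) x x').add_const 1
    rw [CK_succ]
    refine h.congr fun p => ?_
    rw [dotRange_inputVec_succ]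

/-- The trace and the Frobenius norm of the matrix that the layers below layer `l` contribute to
the neural tangent kernel of layer `l` converge in probability. -/
def BackFormTendsto (φ a : ℝ → ℝ) (d l : ℕ) : Prop :=
  ∀ x x' : EuclideanSpace ℝ (Fin d),
    Tendsto (fun p : NetConfig × ParamArray =>
      traceRange (fanIn d p.1.1 l) (backForm φ a p.1.1 x x' p.2 l))
      (whp (widthsToInfty l) arrayLaw) (𝓝 (ntkLimit φ a d l x x' - CK φ a d l x x')) ∧
    Tendsto (fun p : NetConfig × ParamArray =>
      frobSq (fanIn d p.1.1 l) (backForm φ a p.1.1 x x' p.2 l))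
      (whp (widthsToInfty l) arrayLaw) (𝓝 0)

/-- The fluctuation of the diagonal entry of the kernel around its conditional mean, weighted by
the derivatives of the nonlinearity. -/
def diagFluct (φ a : ℝ → ℝ) {d : ℕ} (n : ℕ → ℕ) (x x' : EuclideanSpace ℝ (Fin d)) (l : ℕ)
    (ω : ParamArray) (j : ℕ) : ℝ :=
  preactProd (deriv (nonlin φ a l)) (fanIn d n l) (inputVec φ a n x ω l) (inputVec φ a n x' ω l)
    (ω l j) * (weightForm (fanIn d n l) (backForm φ a n x x' ω l) (ω l j) (ω l j) -
      traceRange (fanIn d n l) (backForm φ a n x x' ω l))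

/-- The conditional mean of the diagonal entries of the kernel, given the lower layers. -/
def diagMean (φ a : ℝ → ℝ) {d : ℕ} (n : ℕ → ℕ) (x x' : EuclideanSpace ℝ (Fin d)) (l : ℕ)
    (ω : ParamArray) : ℝ :=
  dotRange (fanIn d n l) (inputVec φ a n x ω l) (inputVec φ a n x' ω l) + 1 +
    traceRange (fanIn d n l) (backForm φ a n x x' ω l)

lemma backForm_succ_self (φ a : ℝ → ℝ) {d : ℕ} (n : ℕ → ℕ) (x x' : EuclideanSpace ℝ (Fin d))
    (l : ℕ) (ω : ParamArray) (j : ℕ) :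
    backForm φ a n x x' ω (l + 1) j j = 1 / (n l : ℝ) *
      (diagMean φ a n x x' l ω * preactProd (deriv (nonlin φ a l)) (fanIn d n l)
        (inputVec φ a n x ω l) (inputVec φ a n x' ω l) (ω l j) + diagFluct φ a n x x' l ω j) := by
  simp only [backForm, kernelValue, diagMean, diagFluct, preactProd, if_true]
  ring

lemma traceRange_backForm_succ (φ a : ℝ → ℝ) {d : ℕ} (n : ℕ → ℕ) (x x' : EuclideanSpace ℝ (Fin d))
    (l : ℕ) (ω : ParamArray) :
    traceRange (fanIn d n (l + 1)) (backForm φ a n x x' ω (l + 1)) =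
      diagMean φ a n x x' l ω * (1 / (n l : ℝ) * ∑ j ∈ Finset.range (n l),
        preactProd (deriv (nonlin φ a l)) (fanIn d n l) (inputVec φ a n x ω l)
          (inputVec φ a n x' ω l) (ω l j)) +
      1 / (n l : ℝ) * ∑ j ∈ Finset.range (n l), diagFluct φ a n x x' l ω j := by
  simp only [traceRange, backForm_succ_self, fanIn, Finset.mul_sum, ← Finset.sum_add_distrib]
  exact Finset.sum_congr rfl fun j _ => by ring

/-- The three contributions to the Frobenius norm of the next matrix: the diagonal at its
conditional mean, the fluctuations of the diagonal, and the off-diagonal entries. -/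
lemma frobSq_backForm_succ_le (φ a : ℝ → ℝ) {d : ℕ} (n : ℕ → ℕ) (x x' : EuclideanSpace ℝ (Fin d))
    (l : ℕ) (ω : ParamArray) :
    frobSq (fanIn d n (l + 1)) (backForm φ a n x x' ω (l + 1)) ≤
      2 * diagMean φ a n x x' l ω ^ 2 * (√(∑ j ∈ Finset.range (n l),
        preactProd (deriv (nonlin φ a l)) (fanIn d n l) (inputVec φ a n x ω l)
          (inputVec φ a n x' ω l) (ω l j) ^ 2) / n l) ^ 2 +
      2 * (1 / (n l : ℝ) * ∑ j ∈ Finset.range (n l), |diagFluct φ a n x x' l ω j|) ^ 2 +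
      1 / (n l : ℝ) ^ 2 * ∑ j ∈ Finset.range (n l), ∑ j' ∈ Finset.range (n l), if j = j' then 0 else
        (deriv (nonlin φ a l) (preact (fanIn d n l) (inputVec φ a n x ω l) (ω l j)) *
          deriv (nonlin φ a l) (preact (fanIn d n l) (inputVec φ a n x' ω l) (ω l j')) *
          weightForm (fanIn d n l) (backForm φ a n x x' ω l) (ω l j) (ω l j')) ^ 2 := by
  set N : ℝ := (n l : ℝ)
  set κ := diagMean φ a n x x' l ω
  set P : ℕ → ℝ := fun j => preactProd (deriv (nonlin φ a l)) (fanIn d n l) (inputVec φ a n x ω l)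
    (inputVec φ a n x' ω l) (ω l j)
  set D : ℕ → ℝ := fun j => diagFluct φ a n x x' l ω j
  set T : ℕ → ℕ → ℝ := fun j j' => (deriv (nonlin φ a l) (preact (fanIn d n l)
    (inputVec φ a n x ω l) (ω l j)) * deriv (nonlin φ a l) (preact (fanIn d n l)
    (inputVec φ a n x' ω l) (ω l j')) *
    weightForm (fanIn d n l) (backForm φ a n x x' ω l) (ω l j) (ω l j')) ^ 2
  have hentry : ∀ j ∈ Finset.range (n l), ∀ j' ∈ Finset.range (n l),
      backForm φ a n x x' ω (l + 1) j j' ^ 2 ≤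
        (if j = j' then 1 / N ^ 2 * (2 * κ ^ 2 * P j ^ 2 + 2 * |D j| ^ 2) else 0) +
        1 / N ^ 2 * (if j = j' then 0 else T j j') := by
    intro j _ j' _
    by_cases hj : j = j'
    · subst hj
      rw [backForm_succ_self, mul_pow, div_pow, one_pow]
      simp only [if_true, mul_zero, add_zero, sq_abs]
      gcongr
      change (κ * P j + D j) ^ 2 ≤ _
      nlinarith [sq_nonneg (κ * P j - D j)]
    · simp only [hj, if_false, zero_add]
      refine le_of_eq ?_
      simp only [backForm, kernelValue, hj, if_false, zero_add, T]
      ring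
  have hsum : frobSq (fanIn d n (l + 1)) (backForm φ a n x x' ω (l + 1)) ≤
      ∑ j ∈ Finset.range (n l), 1 / N ^ 2 * (2 * κ ^ 2 * P j ^ 2 + 2 * |D j| ^ 2) +
        1 / N ^ 2 * ∑ j ∈ Finset.range (n l), ∑ j' ∈ Finset.range (n l),
          if j = j' then 0 else T j j' := by
    refine (Finset.sum_le_sum fun j hj => Finset.sum_le_sum (hentry j hj)).trans (le_of_eq ?_)
    simp only [Finset.sum_add_distrib, Finset.mul_sum]
    congr 1
    refine Finset.sum_congr rfl fun j hj => ?_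
    rw [Finset.sum_ite_eq, if_pos hj]
  refine hsum.trans (add_le_add ?_ le_rfl)
  have h1 : (√(∑ j ∈ Finset.range (n l), P j ^ 2) / N) ^ 2 =
      1 / N ^ 2 * ∑ j ∈ Finset.range (n l), P j ^ 2 := by
    rw [div_pow, Real.sq_sqrt (Finset.sum_nonneg fun _ _ => sq_nonneg _)]
    ring
  have h2 : 1 / N ^ 2 * ∑ j ∈ Finset.range (n l), |D j| ^ 2 ≤
      (1 / N * ∑ j ∈ Finset.range (n l), |D j|) ^ 2 := by
    rw [mul_pow, div_pow, one_pow]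
    gcongr
    exact Finset.sum_sq_le_sq_sum_of_nonneg fun _ _ => abs_nonneg _
  rw [h1, ← Finset.mul_sum, Finset.sum_add_distrib, ← Finset.mul_sum, ← Finset.mul_sum]
  linarith

/-- Propagation of the trace and of the Frobenius norm of the backpropagated matrix. -/
lemma backFormTendsto_succ {φ a : ℝ → ℝ} (hφ : Differentiable ℝ φ) (ha : Differentiable ℝ a)
    {d l : ℕ} (H : CovTendsto φ a d l) (hint : GaussianSqIntegrable (deriv (nonlin φ a l)))
    (hc : l ≠ 0 → Continuous (deriv (nonlin φ a l))) (B : BackFormTendsto φ a d l) :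
    BackFormTendsto φ a d (l + 1) := by
  intro x x'
  have hle : whp (widthsToInfty (l + 1)) arrayLaw ≤ whp (widthsToInfty l) arrayLaw :=
    whp_mono (widthsToInfty_succ_le l) _
  have hn : Tendsto (fun p : NetConfig × ParamArray => p.1.1 l)
      (whp (widthsToInfty (l + 1)) arrayLaw) atTop :=
    (tendsto_width (Nat.lt_succ_self l)).comp (tendsto_fst_whp _ _)
  have hm : Measurable (deriv (nonlin φ a l)) := measurable_deriv _
  have hV := hle (eventually_le_varBound H x x')
  have hF := (B x x').2.mono_left hle
  have hFe : Tendsto (fun p : NetConfig × ParamArray => ENNReal.ofReal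
      (frobSq (fanIn d p.1.1 l) (backForm φ a p.1.1 x x' p.2 l)))
      (whp (widthsToInfty (l + 1)) arrayLaw) (𝓝 0) := by
    simpa using ENNReal.tendsto_ofReal hF
  have hκ : Tendsto (fun p : NetConfig × ParamArray => diagMean φ a p.1.1 x x' l p.2)
      (whp (widthsToInfty (l + 1)) arrayLaw) (𝓝 (ntkLimit φ a d l x x')) := by
    have h1 := ((H x x').mono_left hle).add ((B x x').1.mono_left hle)
    rwa [add_sub_cancel] at h1
  have hpm : ∀ (c : NetConfig) (j : ℕ), Measurable fun ω : ParamArray =>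
      preactProd (deriv (nonlin φ a l)) (fanIn d c.1 l) (inputVec φ a c.1 x ω l)
        (inputVec φ a c.1 x' ω l) (ω l j) := fun c j =>
    (hm.comp (measurable_preact_inputVec hφ ha c.1 x l j)).mul
      (hm.comp (measurable_preact_inputVec hφ ha c.1 x' l j))
  have hdm : ∀ (c : NetConfig) (j : ℕ), Measurable fun ω : ParamArray =>
      diagFluct φ a c.1 x x' l ω j := fun c j =>
    (hpm c j).mul ((measurable_weightForm_backForm hφ ha c.1 x x' l j j).sub
      (measurable_traceRange_backForm hφ ha c.1 x x' l))
  -- The products of derivatives are merely integrable, so that their squares may have infinite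
  -- mean; the first moment of the Euclidean norm does the job.
  have hsqrt : Tendsto (fun p : NetConfig × ParamArray => √(∑ j ∈ Finset.range (p.1.1 l),
      preactProd (deriv (nonlin φ a l)) (fanIn d p.1.1 l) (inputVec φ a p.1.1 x p.2 l)
        (inputVec φ a p.1.1 x' p.2 l) (p.2 l j) ^ 2) / p.1.1 l)
      (whp (widthsToInfty (l + 1)) arrayLaw) (𝓝 0) := by
    set X : NetConfig → ParamArray → ℝ := fun c ω => √(∑ j ∈ Finset.range (c.1 l),
      preactProd (deriv (nonlin φ a l)) (fanIn d c.1 l) (inputVec φ a c.1 x ω l)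
        (inputVec φ a c.1 x' ω l) (ω l j) ^ 2) / c.1 l with hX
    have hXm : ∀ c, Measurable (X c) := fun c =>
      ((Finset.measurable_sum _ fun j _ => (hpm c j).pow_const 2).sqrt).div_const _
    have hX0 : ∀ c ω, 0 ≤ X c ω := fun c ω =>
      div_nonneg (Real.sqrt_nonneg _) (Nat.cast_nonneg _)
    refine tendsto_zero_of_condExp l X hXm hX0
      (tendsto_zero_of_tail_bound hm hint (varBound φ a d l x x') hn fun t => ?_)
    filter_upwards [hV, hn.eventually_gt_atTop 0] with p h1 h2
    simp only [hX, inputVec_update, Function.update_self]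
    exact lintegral_sqrt_preactProd_le hm h1.1 h1.2 t h2
  have hfluct : Tendsto (fun p : NetConfig × ParamArray => 1 / (p.1.1 l : ℝ) *
      ∑ j ∈ Finset.range (p.1.1 l), |diagFluct φ a p.1.1 x x' l p.2 j|)
      (whp (widthsToInfty (l + 1)) arrayLaw) (𝓝 0) := by
    set X : NetConfig → ParamArray → ℝ := fun c ω => 1 / (c.1 l : ℝ) *
      ∑ j ∈ Finset.range (c.1 l), |diagFluct φ a c.1 x x' l ω j| with hX
    have hXm : ∀ c, Measurable (X c) := fun c =>
      (Finset.measurable_sum _ fun j _ => (hdm c j).norm).const_mul _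
    have hX0 : ∀ c ω, 0 ≤ X c ω := fun c ω =>
      mul_nonneg (by positivity) (Finset.sum_nonneg fun _ _ => abs_nonneg _)
    refine tendsto_zero_of_condExp l X hXm hX0 ?_
    have h1 : Tendsto (fun p : NetConfig × ParamArray =>
        smoothBound (deriv (nonlin φ a l)) (varBound φ a d l x x') ^ (1 / 2 : ℝ) *
        ENNReal.ofReal (quadConst * frobSq (fanIn d p.1.1 l) (backForm φ a p.1.1 x x' p.2 l)) ^
          (1 / 2 : ℝ)) (whp (widthsToInfty (l + 1)) arrayLaw) (𝓝 0) := by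
      have h2 := ENNReal.tendsto_ofReal (hF.const_mul quadConst)
      have h3 := (ENNReal.continuous_rpow_const (y := (1 / 2 : ℝ))).tendsto _ |>.comp h2
      have h4 := ENNReal.Tendsto.const_mul
        (a := smoothBound (deriv (nonlin φ a l)) (varBound φ a d l x x') ^ (1 / 2 : ℝ)) h3
        (Or.inr (ENNReal.rpow_lt_top_of_nonneg (by norm_num) (smoothBound_lt_top hint _).ne).ne)
      simpa using h4
    refine tendsto_of_tendsto_of_tendsto_of_le_of_le' tendsto_const_nhds h1
      (Eventually.of_forall fun _ => zero_le) ?_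
    filter_upwards [hV] with p h1
    simp only [hX, diagFluct, inputVec_update, backForm_update, Function.update_self]
    exact lintegral_average_fluctuation_le hm h1.1 h1.2 _ _
  have hoff : Tendsto (fun p : NetConfig × ParamArray => 1 / (p.1.1 l : ℝ) ^ 2 *
      ∑ j ∈ Finset.range (p.1.1 l), ∑ j' ∈ Finset.range (p.1.1 l), if j = j' then 0 else
        (deriv (nonlin φ a l) (preact (fanIn d p.1.1 l) (inputVec φ a p.1.1 x p.2 l) (p.2 l j)) *
          deriv (nonlin φ a l) (preact (fanIn d p.1.1 l) (inputVec φ a p.1.1 x' p.2 l) (p.2 l j')) *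
          weightForm (fanIn d p.1.1 l) (backForm φ a p.1.1 x x' p.2 l) (p.2 l j) (p.2 l j')) ^ 2)
      (whp (widthsToInfty (l + 1)) arrayLaw) (𝓝 0) := by
    set X : NetConfig → ParamArray → ℝ := fun c ω => 1 / (c.1 l : ℝ) ^ 2 *
      ∑ j ∈ Finset.range (c.1 l), ∑ j' ∈ Finset.range (c.1 l), if j = j' then 0 else
        (deriv (nonlin φ a l) (preact (fanIn d c.1 l) (inputVec φ a c.1 x ω l) (ω l j)) *
          deriv (nonlin φ a l) (preact (fanIn d c.1 l) (inputVec φ a c.1 x' ω l) (ω l j')) *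
          weightForm (fanIn d c.1 l) (backForm φ a c.1 x x' ω l) (ω l j) (ω l j')) ^ 2 with hX
    have hXm : ∀ c, Measurable (X c) := fun c => by
      refine Measurable.const_mul (Finset.measurable_sum _
        fun j _ => Finset.measurable_sum _ fun j' _ => ?_) _
      split_ifs
      · exact measurable_const
      · exact (((hm.comp (measurable_preact_inputVec hφ ha c.1 x l j)).mul
          (hm.comp (measurable_preact_inputVec hφ ha c.1 x' l j'))).mul
          (measurable_weightForm_backForm hφ ha c.1 x x' l j j')).pow_const 2
    have hX0 : ∀ c ω, 0 ≤ X c ω := fun c ω => by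
      refine mul_nonneg (by positivity)
        (Finset.sum_nonneg fun j _ => Finset.sum_nonneg fun j' _ => ?_)
      split_ifs
      · exact le_rfl
      · exact sq_nonneg _
    refine tendsto_zero_of_condExp l X hXm hX0 ?_
    have h1 := ENNReal.Tendsto.const_mul
      (a := formConst (deriv (nonlin φ a l)) (varBound φ a d l x x') ^ 2) hFe
      (Or.inr (ENNReal.pow_lt_top (formConst_lt_top hint _)).ne)
    rw [mul_zero] at h1
    refine tendsto_of_tendsto_of_tendsto_of_le_of_le' tendsto_const_nhds h1
      (Eventually.of_forall fun _ => zero_le) ?_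
    filter_upwards [hV] with p h1
    simp only [hX, inputVec_update, backForm_update, Function.update_self]
    exact lintegral_offDiag_le hm h1.1 h1.2 _ _
  constructor
  · have havg := tendsto_average_preactProd hφ ha H hm hint hc x x'
    have hsmall : Tendsto (fun p : NetConfig × ParamArray => 1 / (p.1.1 l : ℝ) *
        ∑ j ∈ Finset.range (p.1.1 l), diagFluct φ a p.1.1 x x' l p.2 j)
        (whp (widthsToInfty (l + 1)) arrayLaw) (𝓝 0) := by
      refine squeeze_zero_norm (fun p => ?_) hfluct
      rw [Real.norm_eq_abs, abs_mul, abs_of_nonneg (by positivity)]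
      gcongr
      exact Finset.abs_sum_le_sum_abs _ _
    have h1 := (hκ.mul havg).add hsmall
    rw [add_zero, ← CKDot_succ] at h1
    rw [ntkLimit, add_sub_cancel_right]
    refine h1.congr fun p => ?_
    rw [traceRange_backForm_succ]
  · have h1 := ((((hκ.pow 2).const_mul 2).mul (hsqrt.pow 2)).add
      ((hfluct.pow 2).const_mul 2)).add hoff
    have h2 : 2 * ntkLimit φ a d l x x' ^ 2 * 0 ^ 2 + 2 * (0 : ℝ) ^ 2 + 0 = 0 := by ring
    rw [h2] at h1
    exact squeeze_zero (fun p => frobSq_nonneg _ _)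
      (fun p => frobSq_backForm_succ_le φ a p.1.1 x x' l p.2) h1

lemma backFormTendsto {φ a : ℝ → ℝ} (hφ : Differentiable ℝ φ) (ha : Differentiable ℝ a)
    (ha' : Differentiable ℝ (deriv a)) (hφint : GaussianSqIntegrable φ)
    (hφint' : GaussianSqIntegrable (deriv φ)) (haint : GaussianSqIntegrable a)
    (haint' : GaussianSqIntegrable (deriv a)) (d : ℕ) : ∀ l, BackFormTendsto φ a d l := by
  intro l
  induction l with
  | zero =>
    intro x x'
    constructor
    · simp only [ntkLimit, CK, sub_self, traceRange, backForm, Finset.sum_const_zero]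
      exact tendsto_const_nhds
    · simp only [frobSq, backForm, ne_eq, OfNat.ofNat_ne_zero, not_false_eq_true, zero_pow,
        Finset.sum_const_zero]
      exact tendsto_const_nhds
  | succ l ih =>
    refine backFormTendsto_succ hφ ha (covTendsto hφ ha hφint haint d l) ?_ ?_ ih
    · cases l
      · exact hφint'
      · exact haint'
    · intro hl
      cases l
      · exact absurd rfl hl
      · exact ha'.continuous

/-- Given the lower layers, the bilinear form of the weights of two neurons concentrates around
the trace if the neurons agree, and around zero otherwise. -/
lemma lintegral_sq_weightForm_le (m : ℕ) (M : ℕ → ℕ → ℝ) (i i' : ℕ) :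
    ∫⁻ ω, ENNReal.ofReal ((weightForm m M (ω i) (ω i') -
      if i = i' then traceRange m M else 0) ^ 2) ∂layerLaw ≤
      ENNReal.ofReal (quadConst * frobSq m M) +
        formConst (fun _ => 1) 1 ^ 2 * ENNReal.ofReal (frobSq m M) := by
  by_cases hi : i = i'
  · subst hi
    simp only [if_true]
    have h1 : Measurable fun r : Row =>
        ENNReal.ofReal ((weightForm m M r r - traceRange m M) ^ 2) := by
      have := measurable_weightForm_self m M
      fun_prop
    rw [(measurePreserving_neuron i).lintegral_comp h1]
    exact (lintegral_sq_weightForm_sub_le m M).trans le_self_add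
  · simp only [hi, if_false, sub_zero]
    -- the weighted bound with the constant weight `1`, for which the inputs do not matter
    have h0 : dotRange m (fun _ => 0) (fun _ => 0) ≤ ((1 : ℝ≥0) : ℝ) := by simp [dotRange]
    have h1 := lintegral_prod_weightForm_le (h := fun _ => 1) measurable_const h0 h0 one_pos M
    simp only [one_mul] at h1
    have h2 := measurable_weightForm m M
    rw [← Measure.infinitePi_map_eval_prod (P := fun _ : ℕ => rowLaw) hi,
      lintegral_map (by fun_prop) (by fun_prop)] at h1
    exact h1.trans le_add_self

lemma gaussianSqIntegrable_one : GaussianSqIntegrable fun _ => 1 := fun _ => memLp_const 1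

/-- The limit of the neural tangent kernel on the space of parameter arrays. -/
lemma tendsto_kernelValue {φ a : ℝ → ℝ} (hφ : Differentiable ℝ φ) (ha : Differentiable ℝ a)
    {d l : ℕ} (H : CovTendsto φ a d l) (B : BackFormTendsto φ a d l)
    (x x' : EuclideanSpace ℝ (Fin d)) :
    Tendsto (fun p : NetConfig × ParamArray =>
      kernelValue (fanIn d p.1.1 l) (inputVec φ a p.1.1 x p.2 l) (inputVec φ a p.1.1 x' p.2 l)
        (backForm φ a p.1.1 x x' p.2 l) (p.1.2.1 = p.1.2.2) (p.2 l p.1.2.1) (p.2 l p.1.2.2) -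
        if p.1.2.1 = p.1.2.2 then ntkLimit φ a d l x x' else 0)
      (whp (widthsToInfty l) arrayLaw) (𝓝 0) := by
  have hF := (B x x').2
  have hsq : Tendsto (fun p : NetConfig × ParamArray =>
      (weightForm (fanIn d p.1.1 l) (backForm φ a p.1.1 x x' p.2 l) (p.2 l p.1.2.1)
        (p.2 l p.1.2.2) - if p.1.2.1 = p.1.2.2 then
        traceRange (fanIn d p.1.1 l) (backForm φ a p.1.1 x x' p.2 l) else 0) ^ 2)
      (whp (widthsToInfty l) arrayLaw) (𝓝 0) := by
    set X : NetConfig → ParamArray → ℝ := fun c ω =>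
      (weightForm (fanIn d c.1 l) (backForm φ a c.1 x x' ω l) (ω l c.2.1) (ω l c.2.2) -
        if c.2.1 = c.2.2 then traceRange (fanIn d c.1 l) (backForm φ a c.1 x x' ω l) else 0) ^ 2
      with hX
    have hXm : ∀ c, Measurable (X c) := fun c => by
      have h1 := measurable_weightForm_backForm hφ ha c.1 x x' l c.2.1 c.2.2
      refine (h1.sub ?_).pow_const 2
      split_ifs
      · exact measurable_traceRange_backForm hφ ha c.1 x x' l
      · exact measurable_const
    refine tendsto_zero_of_condExp l X hXm (fun c ω => sq_nonneg _) ?_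
    have h1 := ENNReal.tendsto_ofReal (hF.const_mul quadConst)
    have h2 := ENNReal.Tendsto.const_mul (a := formConst (fun _ => 1) 1 ^ 2)
      (ENNReal.tendsto_ofReal hF)
      (Or.inr (ENNReal.pow_lt_top (formConst_lt_top gaussianSqIntegrable_one _)).ne)
    have h3 := h1.add h2
    simp only [mul_zero, ENNReal.ofReal_zero, add_zero] at h3
    refine tendsto_of_tendsto_of_tendsto_of_le_of_le tendsto_const_nhds h3
      (fun _ => zero_le) fun p => ?_
    simp only [hX, backForm_update, Function.update_self]
    exact lintegral_sq_weightForm_le _ _ _ _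
  have habs : Tendsto (fun p : NetConfig × ParamArray =>
      |weightForm (fanIn d p.1.1 l) (backForm φ a p.1.1 x x' p.2 l) (p.2 l p.1.2.1)
        (p.2 l p.1.2.2) - if p.1.2.1 = p.1.2.2 then
        traceRange (fanIn d p.1.1 l) (backForm φ a p.1.1 x x' p.2 l) else 0|)
      (whp (widthsToInfty l) arrayLaw) (𝓝 0) := by
    have h1 := (Real.continuous_sqrt.tendsto 0).comp hsq
    rw [Real.sqrt_zero] at h1
    exact h1.congr fun p => Real.sqrt_sq_eq_abs _
  have hmean : Tendsto (fun p : NetConfig × ParamArray =>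
      |diagMean φ a p.1.1 x x' l p.2 - ntkLimit φ a d l x x'|)
      (whp (widthsToInfty l) arrayLaw) (𝓝 0) := by
    have h1 := (((H x x').add (B x x').1).sub_const (ntkLimit φ a d l x x')).abs
    rwa [add_sub_cancel, sub_self, abs_zero] at h1
  have h := habs.add hmean
  rw [add_zero] at h
  refine squeeze_zero_norm (fun p => ?_) h
  rw [Real.norm_eq_abs, kernelValue, diagMean]
  split_ifs
  · refine le_trans (le_of_eq ?_) (abs_add_le _ _)
    congr 1
    ring
  · rw [zero_add]
    exact le_add_of_nonneg_right (abs_nonneg _)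

/-- An array that extends the parameters of a finite network; the other entries are `0`. -/
def extendParams {L d : ℕ} {n : ℕ → ℕ} (θ : Params L d n) : ParamArray := fun k i o =>
  open Classical in
  if h : ∃ p : ParamIdx L d n, paramPos p = (k, i, o) then θ h.choose else 0

lemma measurable_extendParams {L d : ℕ} {n : ℕ → ℕ} :
    Measurable (extendParams (L := L) (d := d) (n := n)) := by
  refine measurable_pi_iff.2 fun k => measurable_pi_iff.2 fun i => measurable_pi_iff.2 fun o => ?_
  unfold extendParams
  split_ifs <;> fun_prop

lemma cutParams_extendParams {L d : ℕ} {n : ℕ → ℕ} (θ : Params L d n) :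
    cutParams L d n (extendParams θ) = θ := by
  ext p
  have h : ∃ q : ParamIdx L d n, paramPos q = ((paramPos p).1, (paramPos p).2.1, (paramPos p).2.2) :=
    ⟨p, rfl⟩
  change extendParams θ (paramPos p).1 (paramPos p).2.1 (paramPos p).2.2 = θ p
  rw [extendParams, dif_pos h, paramPos_injective (h.choose_spec.trans rfl)]

/-- Measurability is transported from the array: a network is cut out of any array extending it. -/
lemma measurable_empiricalNTK {φ a : ℝ → ℝ} (hφ : Differentiable ℝ φ) (ha : Differentiable ℝ a)
    {L d : ℕ} {n : ℕ → ℕ} (x x' : EuclideanSpace ℝ (Fin d)) (l : ℕ) (hl : l ≤ L)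
    (i i' : Fin (n l)) :
    Measurable fun θ : Params L d n => empiricalNTK φ a θ l hl x x' i i' := by
  have h2 := measurable_weightForm_backForm hφ ha n x x' l i i'
  have h3 := measurable_dotRange_inputVec hφ ha n x x' l
  have h4 : Measurable fun ω : ParamArray =>
      (if (i : ℕ) = i' then dotRange (fanIn d n l) (inputVec φ a n x ω l)
        (inputVec φ a n x' ω l) + 1 else 0) +
      weightForm (fanIn d n l) (backForm φ a n x x' ω l) (ω l i) (ω l i') := by
    split_ifs <;> fun_prop
  convert h4.comp (measurable_extendParams (L := L) (d := d) (n := n)) using 2 with θ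
  have h5 := empiricalNTK_cutParams hφ ha (L := L) (extendParams θ) x x' l hl i i'
  rw [cutParams_extendParams] at h5
  rw [h5, kernelValue]
  rfl

/-- The limit on the space of arrays gives the limit for the parameters of each finite network. -/
lemma ntkTendsto_ntkLimit {φ a : ℝ → ℝ} (hφ : Differentiable ℝ φ) (ha : Differentiable ℝ a)
    {d l : ℕ} (H : CovTendsto φ a d l) (B : BackFormTendsto φ a d l) :
    NTKTendsto φ a d l (ntkLimit φ a d l) := by
  intro x x' ε hε δ hδ
  have h1 := (tendsto_kernelValue hφ ha H B x x').abs
  rw [abs_zero] at h1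
  have h2 := eventually_whp.1 (h1.eventually_lt_const hε)
  have h3 := (ENNReal.tendsto_nhds_zero.1 h2) (ENNReal.ofReal δ) (ENNReal.ofReal_pos.2 hδ)
  obtain ⟨N, hN⟩ := exists_of_mem_widthsToInfty h3
  refine ⟨N, fun L hl n hn i i' => ?_⟩
  have h4 := hN (n, i, i') hn
  have hms : MeasurableSet {θ : Params L d n | ε ≤ |empiricalNTK φ a θ l hl x x' i i' -
      (if i = i' then ntkLimit φ a d l x x' else 0)|} :=
    measurableSet_le measurable_const
      (((measurable_empiricalNTK hφ ha x x' l hl i i').sub_const _).norm)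
  rw [Measure.real, ← map_cutParams, Measure.map_apply (measurable_cutParams L d n) hms]
  refine ENNReal.toReal_le_of_le_ofReal hδ.le (le_trans (measure_mono fun ω hω => ?_) h4)
  have h5 : ε ≤ |empiricalNTK φ a (cutParams L d n ω) l hl x x' i i' -
      (if i = i' then ntkLimit φ a d l x x' else 0)| := hω
  rw [empiricalNTK_cutParams hφ ha] at h5
  simp only [Fin.ext_iff] at h5
  exact not_lt.2 h5

end

end FeatureNet

theorem theorem3p2 (φ a : ℝ → ℝ)
    (hφ : Differentiable ℝ φ)
    (ha : Differentiable ℝ a) (ha' : Differentiable ℝ (deriv a))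
    (hφint : FeatureNet.GaussianSqIntegrable φ)
    (hφint' : FeatureNet.GaussianSqIntegrable (deriv φ))
    (haint : FeatureNet.GaussianSqIntegrable a)
    (haint' : FeatureNet.GaussianSqIntegrable (deriv a))
    (d : ℕ) :
    ∃ Θ : ℕ → EuclideanSpace ℝ (Fin d) → EuclideanSpace ℝ (Fin d) → ℝ,
      (∀ l : ℕ, FeatureNet.NTKTendsto φ a d l (Θ l)) ∧
      (∀ x x', Θ 0 x x' = inner ℝ x x' + 1) ∧
      (∀ l : ℕ, 1 ≤ l → ∀ x x', Θ l x x' =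
        Θ (l - 1) x x' * FeatureNet.CKDot φ a d l x x' + FeatureNet.CK φ a d l x x') := by
  refine ⟨FeatureNet.ntkLimit φ a d, fun l => ?_, fun x x' => rfl, fun l hl x x' => ?_⟩
  · exact FeatureNet.ntkTendsto_ntkLimit hφ ha (FeatureNet.covTendsto hφ ha hφint haint d l)
      (FeatureNet.backFormTendsto hφ ha ha' hφint hφint' haint haint' d l)
  · obtain ⟨l, rfl⟩ := Nat.exists_eq_add_of_le' hl
    rfl
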